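/- There exist absolute constants $\gamma>0$ and $c>0$ such that for every integer $n\ge 3$ there is a simple polygon $P\subset\mathbb{R}^2$ with exactly $n$ vertices (no three consecutive vertices being collinear) with the following two properties. Here $P$ denotes the closed region bounded by the polygon. (i) $P$ is locally $\gamma$-fat: for every closed Euclidean disk $D$ of positive radius that is centered at a point of $P$ and does not fully contain $P$, we have $\mathrm{area}(D\sqcap P)\ge \gamma\cdot \mathrm{area}(D)$, where $D\sqcap P$ denotes the connected component of $D\cap P$ that contains the center of $D$. (ii) The doubling constant of the metric space $(P,d_{\mathrm g})$ is at least $c\,n^{1/3}$, where $d_{\mathrm g}(p,q)$ is the geodesic distance, that is, the length of a shortest path from $p$ to $q$ inside $P$. Here the doubling constant of a metric space is the smallest $k$ such that, for every $r>0$, every closed ball of radius $r$ can be covered by $k$ closed balls of radius $r/2$ centered at points of the space. -/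

import Mathlib

open scoped ENNReal

noncomputable section

namespace FatPolygon

/-- The Euclidean plane. -/
abbrev Plane : Type := EuclideanSpace ℝ (Fin 2)

/-- A polygon is simple if no three consecutive vertices are collinear (so that `n` is the number
of genuine vertices), consecutive edges meet only in their common vertex, and any other two edges
are disjoint. The `i`-th edge joins the vertices `i` and `i + 1`, cyclically. -/
structure IsSimple {n : ℕ} [NeZero n] (poly : Polygon Plane n) : Prop where
  nondegenerate : poly.HasNondegenerateVertices ℝ
  consecutive : ∀ i : Fin n, poly.edgeSet ℝ i ∩ poly.edgeSet ℝ (i + 1) = {poly (i + 1)}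
  nonconsecutive : ∀ i j : Fin n, i ≠ j → j ≠ i + 1 → i ≠ j + 1 →
    Disjoint (poly.edgeSet ℝ i) (poly.edgeSet ℝ j)

/-- The closed region enclosed by a polygon: its boundary curve together with the bounded
connected components of the complement of that curve. -/
def region {n : ℕ} (poly : Polygon Plane n) : Set Plane :=
  poly.boundary ℝ ∪
    {x | x ∉ poly.boundary ℝ ∧ Bornology.IsBounded (connectedComponentIn (poly.boundary ℝ)ᶜ x)}

/-- `P` is locally `γ`-fat: for every disk `D` of positive radius that is centred at a point of `P`
and does not contain `P`, the connected component of `D ∩ P` that contains the centre of `D` has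
area at least `γ * area D`. -/
def IsLocallyFat (γ : ℝ) (P : Set Plane) : Prop :=
  ∀ p ∈ P, ∀ r : ℝ, 0 < r → ¬ P ⊆ Metric.closedBall p r →
    ENNReal.ofReal γ * MeasureTheory.volume (Metric.closedBall p r) ≤
      MeasureTheory.volume (connectedComponentIn (Metric.closedBall p r ∩ P) p)

/-- The geodesic distance in `P`: the infimum of the Euclidean lengths of the paths in `P`
from `p` to `q`. -/
def geodesicDist (P : Set Plane) (p q : P) : ℝ≥0∞ :=
  ⨅ σ : Path p q, eVariationOn (fun t => (σ t : Plane)) Set.univ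

/-- A space with distance function `d` is `k`-doubling if every ball of radius `r` can be covered
by (at most) `k` balls of radius `r / 2`. -/
def IsDoubling {X : Type*} (d : X → X → ℝ≥0∞) (k : ℕ) : Prop :=
  ∀ x : X, ∀ r : ℝ, 0 < r → ∃ s : Finset X, s.card ≤ k ∧
    ∀ y : X, d x y ≤ ENNReal.ofReal r → ∃ z ∈ s, d z y ≤ ENNReal.ofReal (r / 2)

/-- The doubling constant: the least `k` for which the space is `k`-doubling (`⊤` if there is
none). -/
def doublingConstant {X : Type*} (d : X → X → ℝ≥0∞) : ℕ∞ :=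
  ⨅ k ∈ {k : ℕ | IsDoubling d k}, (k : ℕ∞)

end FatPolygon

end

noncomputable section

namespace FatPolygon

/-! The polygon is a large convex base carrying `k` thin corridors ("arms"). Each arm is a chain of
cells of bounded size that follows a Hilbert curve of order `l`, so about `4 ^ l` cells are folded
into a square of side `2 ^ l`.

Doubling. All arms start on the upper side of the base, within mutual distance about `k * 2 ^ l`,
whereas each arm has geodesic length of order `4 ^ l`. When the arms are much longer than the base
is wide, one geodesic ball around the mouth of an arm contains all tips, but a ball of half the
radius can reach a tip only if its centre lies in that very arm. The arms are pairwise disjoint, so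
at least `k` half-balls are needed. With `k = 2 ^ j` and `l = j + 4` the polygon has of order `k * 4
^ l ~ 8 ^ j` vertices, and `k` is of order `n ^ (1 / 3)`. The lower bound on lengths comes from a
potential along the arm that is 1-Lipschitz inside the region (`Paths.potential_lipschitz`,
`edist_le_eVariationOn`); the conclusion is `Paths.le_of_isDoubling`.

Fatness. The Hilbert curve is used for its locality: any `4 ^ s` consecutive cells stay within
distance of order `2 ^ s` (`hilbert_window`). Hence a disk of radius `r ~ 2 ^ s` around a point of
an arm contains a connected run of `4 ^ s` cells, of total area proportional to `r ^ 2`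
(`fat_of_window`), unless the mouth of the arm comes first, in which case the component reaches a
fat piece of the base (`fat_of_near_base`). Smaller disks are handled inside one triangle, and disks
centred in the base by convexity.

Simplicity. The region is built by gluing triangles, one along an existing edge at a time, each
gluing inserting one vertex in the boundary list (`Bounds.glue`). The invariant `Bounds` records
that the edges meet properly, that the region is compact with connected complement, and that its
frontier lies on the edges. This identifies the region with the one enclosed by the polygon
(`region_eq`), with no appeal to the Jordan curve theorem. Collinear vertices are allowed during the
construction; that none remain at the end is the separate condition `Turning`. The doors of an arm
have alternating widths, so that the posts along a straight stretch are not collinear. Extra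
vertices on a parabola in the base bring the number of vertices to exactly `n`. -/

/-- Twice the signed area of the triangle `a b c`. -/
def cr (a b c : Plane) : ℝ := (b 0 - a 0) * (c 1 - a 1) - (b 1 - a 1) * (c 0 - a 0)

/-- The barycentric coordinate belonging to `v` with respect to the triangle `u v w`. -/
def bary (u v w y : Plane) : ℝ := cr u y w / cr u v w

/-- The closed triangle with the given vertices. -/
def tri (p x q : Plane) : Set Plane := convexHull ℝ {p, x, q}

/-! ### Barycentric coordinates and triangles -/

lemma plane_ext {x y : Plane} (h0 : x 0 = y 0) (h1 : x 1 = y 1) : x = y := by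
  ext i; fin_cases i <;> assumption

lemma cr_swap (a b c : Plane) : cr c b a = - cr a b c := by unfold cr; ring
lemma cr_rot (a b c : Plane) : cr b c a = cr a b c := by unfold cr; ring
lemma cr_swap_left (a b c : Plane) : cr b a c = - cr a b c := by unfold cr; ring
lemma cr_swap_right (a b c : Plane) : cr a c b = - cr a b c := by unfold cr; ring

@[fun_prop]
lemma continuous_cr {X : Type*} [TopologicalSpace X] {f g h : X → Plane} (hf : Continuous f)
    (hg : Continuous g) (hh : Continuous h) : Continuous fun x => cr (f x) (g x) (h x) := by
  unfold cr; fun_prop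

lemma continuous_bary (u v w : Plane) : Continuous (bary u v w) := by
  unfold bary; fun_prop

lemma cr_combo (u w y z : Plane) {s t : ℝ} (h : s + t = 1) :
    cr u (s • y + t • z) w = s * cr u y w + t * cr u z w := by
  obtain rfl : t = 1 - s := by linarith
  simp only [cr, PiLp.add_apply, PiLp.smul_apply, smul_eq_mul]; ring

lemma bary_combo (u v w y z : Plane) {s t : ℝ} (h : s + t = 1) :
    bary u v w (s • y + t • z) = s * bary u v w y + t * bary u v w z := by
  unfold bary; rw [cr_combo _ _ _ _ h]; ring

lemma bary_left (u v w : Plane) : bary u v w u = 0 := by simp [bary, cr]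
lemma bary_right (u v w : Plane) : bary u v w w = 0 := by
  have : cr u w w = 0 := by unfold cr; ring
  simp [bary, this]
lemma bary_self {u v w : Plane} (h : cr u v w ≠ 0) : bary u v w v = 1 := div_self h

lemma convex_setOf_bary_lt (u v w : Plane) (c : ℝ) : Convex ℝ {y | bary u v w y < c} := by
  intro x hx y hy s t hs ht hst
  simp only [Set.mem_ofPred_eq] at *
  rw [bary_combo _ _ _ _ _ hst]
  rcases hs.eq_or_lt with rfl | hs
  · obtain rfl : t = 1 := by linarith
    linarith
  · obtain rfl : t = 1 - s := by linarith
    nlinarith [mul_nonneg ht (sub_nonneg.2 hy.le), mul_pos hs (sub_pos.2 hx)]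

lemma convex_setOf_le_bary (u v w : Plane) (c : ℝ) : Convex ℝ {y | c ≤ bary u v w y} := by
  intro x hx y hy s t hs ht hst
  simp only [Set.mem_ofPred_eq] at *
  rw [bary_combo _ _ _ _ _ hst]
  obtain rfl : t = 1 - s := by linarith
  nlinarith [mul_nonneg ht (sub_nonneg.2 hy), mul_nonneg hs (sub_nonneg.2 hx)]

lemma bary_add {p x q : Plane} (h : cr p x q ≠ 0) (y : Plane) :
    bary x p q y + bary p x q y + bary p q x y = 1 := by
  unfold bary
  rw [cr_swap_left p x q, cr_swap_right p x q]
  field_simp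
  unfold cr; ring

lemma bary_reconstruct {p x q : Plane} (h : cr p x q ≠ 0) (y : Plane) :
    bary x p q y • p + bary p x q y • x + bary p q x y • q = y := by
  unfold bary
  rw [cr_swap_left p x q, cr_swap_right p x q]
  apply plane_ext <;> simp only [PiLp.add_apply, PiLp.smul_apply, smul_eq_mul] <;> field_simp <;>
    unfold cr <;> ring

lemma mem_tri_of_combo {p x q y : Plane} {a b c : ℝ} (ha : 0 ≤ a) (hb : 0 ≤ b) (hc : 0 ≤ c)
    (h : a + b + c = 1) (hy : a • p + b • x + c • q = y) : y ∈ tri p x q := by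
  have hT : Convex ℝ (tri p x q) := convex_convexHull _ _
  have h1 : p ∈ tri p x q := subset_convexHull _ _ (by simp)
  have h2 : x ∈ tri p x q := subset_convexHull _ _ (by simp)
  have h3 : q ∈ tri p x q := subset_convexHull _ _ (by simp)
  rw [← hy]
  simpa [Fin.sum_univ_three] using
    hT.sum_mem (t := Finset.univ) (w := ![a, b, c]) (z := ![p, x, q])
      (by intro i _; fin_cases i <;> assumption) (by simp [Fin.sum_univ_three, h])
      (by intro i _; fin_cases i <;> assumption)

lemma mem_tri_iff {p x q : Plane} (h : cr p x q ≠ 0) {y : Plane} :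
    y ∈ tri p x q ↔ 0 ≤ bary x p q y ∧ 0 ≤ bary p x q y ∧ 0 ≤ bary p q x y := by
  constructor
  · intro hy
    have h' : cr x p q ≠ 0 := by rw [cr_swap_left]; simpa using h
    have h'' : cr p q x ≠ 0 := by rw [cr_swap_right]; simpa using h
    have key : tri p x q ⊆ {y | 0 ≤ bary x p q y} ∩ ({y | 0 ≤ bary p x q y} ∩
        {y | 0 ≤ bary p q x y}) := by
      apply convexHull_min
      · rintro z (rfl | rfl | rfl) <;> simp [bary_left, bary_right, bary_self, h, h', h'']
      · exact (convex_setOf_le_bary _ _ _ _).inter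
          ((convex_setOf_le_bary _ _ _ _).inter (convex_setOf_le_bary _ _ _ _))
    exact key hy
  · rintro ⟨h1, h2, h3⟩
    exact mem_tri_of_combo h1 h2 h3 (bary_add h y) (bary_reconstruct h y)

lemma left_mem_tri (p x q : Plane) : p ∈ tri p x q := subset_convexHull _ _ (by simp)
lemma mid_mem_tri (p x q : Plane) : x ∈ tri p x q := subset_convexHull _ _ (by simp)
lemma right_mem_tri (p x q : Plane) : q ∈ tri p x q := subset_convexHull _ _ (by simp)
lemma convex_tri (p x q : Plane) : Convex ℝ (tri p x q) := convex_convexHull _ _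
lemma isCompact_tri (p x q : Plane) : IsCompact (tri p x q) :=
  Set.Finite.isCompact_convexHull (𝕜 := ℝ) (Set.toFinite _)
lemma isClosed_tri (p x q : Plane) : IsClosed (tri p x q) := (isCompact_tri _ _ _).isClosed

lemma tri_swap (p x q : Plane) : tri q x p = tri p x q := by
  unfold tri; congr 1; ext; simp; tauto

lemma tri_swap_left (p x q : Plane) : tri x p q = tri p x q := by
  unfold tri; congr 1; ext; simp; tauto

lemma segment_left_mid_subset_tri (p x q : Plane) : segment ℝ p x ⊆ tri p x q :=
  (convex_tri p x q).segment_subset (left_mem_tri _ _ _) (mid_mem_tri _ _ _)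
lemma segment_mid_right_subset_tri (p x q : Plane) : segment ℝ x q ⊆ tri p x q :=
  (convex_tri p x q).segment_subset (mid_mem_tri _ _ _) (right_mem_tri _ _ _)
lemma segment_left_right_subset_tri (p x q : Plane) : segment ℝ p q ⊆ tri p x q :=
  (convex_tri p x q).segment_subset (left_mem_tri _ _ _) (right_mem_tri _ _ _)

lemma bary_eq_zero_of_mem_segment {p x q y : Plane} (hy : y ∈ segment ℝ p q) :
    bary p x q y = 0 := by
  obtain ⟨s, t, -, -, hst, rfl⟩ := hy
  rw [bary_combo _ _ _ _ _ hst, bary_left, bary_right]; ring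

lemma mem_segment_of_bary_eq_zero {p x q y : Plane} (h : cr p x q ≠ 0) (hy : y ∈ tri p x q)
    (h0 : bary p x q y = 0) : y ∈ segment ℝ p q := by
  obtain ⟨h1, -, h3⟩ := (mem_tri_iff h).1 hy
  refine ⟨_, _, h1, h3, ?_, ?_⟩
  · have := bary_add h y; linarith
  · have := bary_reconstruct h y; rw [h0] at this; simpa using this

lemma cr_ne_swap_left {a b c : Plane} (h : cr a b c ≠ 0) : cr b a c ≠ 0 := by
  rw [cr_swap_left]; simpa using h
lemma cr_ne_swap_right {a b c : Plane} (h : cr a b c ≠ 0) : cr a c b ≠ 0 := by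
  rw [cr_swap_right]; simpa using h
lemma cr_ne_swap {a b c : Plane} (h : cr a b c ≠ 0) : cr c b a ≠ 0 := by
  rw [cr_swap]; simpa using h

lemma bary_swap (u v w y : Plane) : bary w v u y = bary u v w y := by
  unfold bary; rw [cr_swap, cr_swap u v w, neg_div_neg_eq]

/-! ### Connectedness of complements under gluing -/

/-- The complement of a triangle is connected. -/
lemma isPreconnected_compl_tri {p x q : Plane} (h : cr p x q ≠ 0) :
    IsPreconnected (tri p x q)ᶜ := by
  have hx := cr_ne_swap_left h
  have hq := cr_ne_swap_right h
  have e : (tri p x q)ᶜ = ({y | bary x p q y < 0} ∪ {y | bary p x q y < 0}) ∪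
      {y | bary p q x y < 0} := by
    ext y
    simp only [Set.mem_compl_iff, mem_tri_iff h, Set.mem_union, Set.mem_ofPred_eq, not_and_or,
      not_le, or_assoc]
  -- The complement is a union of three open half planes; two of them meet beyond the common vertex
  -- of the corresponding sides, reached by moving from the midpoint of the opposite side through
  -- that vertex.
  have aux : ∀ {a b c : Plane}, cr a b c ≠ 0 →
      ∃ z, bary b a c z < 0 ∧ bary a b c z < 0 := by
    intro a b c h
    refine ⟨(3 : ℝ) • c + (-2 : ℝ) • ((1 / 2 : ℝ) • a + (1 / 2 : ℝ) • b), ?_, ?_⟩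
    · rw [bary_combo _ _ _ _ _ (by norm_num), bary_combo _ _ _ _ _ (by norm_num), bary_left,
        bary_right, bary_self (cr_ne_swap_left h)]; norm_num
    · rw [bary_combo _ _ _ _ _ (by norm_num), bary_combo _ _ _ _ _ (by norm_num), bary_left,
        bary_right, bary_self h]; norm_num
  rw [e]
  obtain ⟨z, hz1, hz2⟩ := aux h
  obtain ⟨z', hz1', hz2'⟩ := aux (by rwa [cr_rot] : cr x q p ≠ 0)
  rw [bary_swap] at hz1' hz2'
  exact IsPreconnected.union z' (Or.inr hz1') hz2' (IsPreconnected.union z hz1 hz2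
    (convex_setOf_bary_lt _ _ _ _).isPreconnected (convex_setOf_bary_lt _ _ _ _).isPreconnected)
    (convex_setOf_bary_lt _ _ _ _).isPreconnected

lemma bary_pos_nhds {u v w s : Plane} (h : 0 < bary u v w s) :
    ∃ ε > 0, ∀ y ∈ Metric.ball s ε, 0 < bary u v w y := by
  have : {y | 0 < bary u v w y} ∈ nhds s :=
    (isOpen_lt continuous_const (continuous_bary u v w)).mem_nhds h
  obtain ⟨ε, h1, h2⟩ := Metric.mem_nhds_iff.1 this
  exact ⟨ε, h1, fun y hy => h2 hy⟩

/-- Near a point of the two free sides `p x`, `x q` away from the glued side `p q`, the third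
coordinate stays positive, so leaving the triangle means crossing one of the free sides. The outside
is then a disk cut by one open half plane, or, at the apex `x`, by two that overlap. -/
lemma ball_diff_tri {p x q s : Plane} (h : cr p x q ≠ 0) (hs : s ∈ tri p x q)
    (h1 : 0 < bary p x q s) (h2 : bary x p q s = 0 ∨ bary p q x s = 0) :
    ∃ ε₀ > 0, ∀ ε > 0, ε ≤ ε₀ → IsPreconnected (Metric.ball s ε \ tri p x q) ∧
      (Metric.ball s ε \ tri p x q).Nonempty := by
  have hx := cr_ne_swap_left h
  have hq := cr_ne_swap_right h
  obtain ⟨hP, -, hQ⟩ := (mem_tri_iff h).1 hs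
  have near : ∀ ε > 0, ∃ z ∈ Metric.ball s ε, (bary x p q s = 0 → bary x p q z < 0) ∧
      (bary p q x s = 0 → bary p q x z < 0) := by
    intro ε hε
    -- Moving `s` away from the midpoint of `p q` makes every free-side coordinate that vanishes at
    -- `s` negative.
    let f : ℝ → Plane := fun t => (1 + t) • s + (-t) • ((1 / 2 : ℝ) • p + (1 / 2 : ℝ) • q)
    have hf : Continuous f := by fun_prop
    have h0 : f 0 = s := by simp [f]
    have : f ⁻¹' Metric.ball s ε ∈ nhds (0 : ℝ) :=
      hf.continuousAt.preimage_mem_nhds (by rw [h0]; exact Metric.ball_mem_nhds _ hε)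
    obtain ⟨δ, hδ, hb⟩ := Metric.mem_nhds_iff.1 this
    have hm : f (δ / 2) ∈ Metric.ball s ε :=
      hb (by rw [Metric.mem_ball, Real.dist_eq, sub_zero, abs_of_pos (by linarith)]; linarith)
    refine ⟨_, hm, fun e => ?_, fun e => ?_⟩
    · rw [bary_combo _ _ _ _ _ (by ring), bary_combo _ _ _ _ _ (by norm_num), bary_self hx,
        bary_right, e]; linarith
    · rw [bary_combo _ _ _ _ _ (by ring), bary_combo _ _ _ _ _ (by norm_num), bary_self hq,
        bary_left, e]; linarith
  have ne : ∀ ε > 0, (Metric.ball s ε \ tri p x q).Nonempty := by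
    intro ε hε
    obtain ⟨z, hz, hz1, hz2⟩ := near ε hε
    refine ⟨z, hz, fun hT => ?_⟩
    obtain ⟨g1, -, g2⟩ := (mem_tri_iff h).1 hT
    rcases h2 with e | e
    · exact absurd (hz1 e) (not_lt.2 g1)
    · exact absurd (hz2 e) (not_lt.2 g2)
  obtain ⟨ε₁, hε₁, hb1⟩ := bary_pos_nhds h1
  have diff_eq : ∀ ε ≤ ε₁, Metric.ball s ε \ tri p x q =
      (Metric.ball s ε ∩ {y | bary x p q y < 0}) ∪ (Metric.ball s ε ∩ {y | bary p q x y < 0}) := by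
    intro ε hε
    ext y
    simp only [Set.mem_sdiff, mem_tri_iff h, Set.mem_union, Set.mem_inter_iff, Set.mem_ofPred_eq,
      not_and_or, not_le]
    constructor
    · rintro ⟨hy, h | h | h⟩
      · exact Or.inl ⟨hy, h⟩
      · exact absurd (hb1 y (Metric.ball_subset_ball hε hy)) (not_lt.2 h.le)
      · exact Or.inr ⟨hy, h⟩
    · rintro (⟨hy, h⟩ | ⟨hy, h⟩)
      · exact ⟨hy, Or.inl h⟩
      · exact ⟨hy, Or.inr (Or.inr h)⟩
  have cvx : ∀ (u v w : Plane) ε, IsPreconnected (Metric.ball s ε ∩ {y | bary u v w y < 0}) :=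
    fun u v w ε => ((convex_ball s ε).inter (convex_setOf_bary_lt u v w 0)).isPreconnected
  rcases hP.eq_or_lt with eP | lP
  · rcases hQ.eq_or_lt with eQ | lQ
    · refine ⟨ε₁, hε₁, fun ε hε hle => ⟨?_, ne ε hε⟩⟩
      rw [diff_eq ε hle]
      obtain ⟨z, hz, hz1, hz2⟩ := near ε hε
      exact IsPreconnected.union z ⟨hz, hz1 eP.symm⟩ ⟨hz, hz2 eQ.symm⟩ (cvx _ _ _ _) (cvx _ _ _ _)
    · obtain ⟨ε₂, hε₂, hb2⟩ := bary_pos_nhds lQ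
      refine ⟨min ε₁ ε₂, lt_min hε₁ hε₂, fun ε hε hle => ⟨?_, ne ε hε⟩⟩
      rw [diff_eq ε (hle.trans (min_le_left _ _))]
      have : Metric.ball s ε ∩ {y | bary p q x y < 0} = ∅ := by
        ext y
        simp only [Set.mem_inter_iff, Set.mem_ofPred_eq, Set.mem_empty_iff_false, iff_false,
          not_and, not_lt]
        exact fun hy => (hb2 y (Metric.ball_subset_ball (hle.trans (min_le_right _ _)) hy)).le
      rw [this, Set.union_empty]
      exact cvx _ _ _ _
  · obtain ⟨ε₂, hε₂, hb2⟩ := bary_pos_nhds lP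
    refine ⟨min ε₁ ε₂, lt_min hε₁ hε₂, fun ε hε hle => ⟨?_, ne ε hε⟩⟩
    rw [diff_eq ε (hle.trans (min_le_left _ _))]
    have : Metric.ball s ε ∩ {y | bary x p q y < 0} = ∅ := by
      ext y
      simp only [Set.mem_inter_iff, Set.mem_ofPred_eq, Set.mem_empty_iff_false, iff_false,
        not_and, not_lt]
      exact fun hy => (hb2 y (Metric.ball_subset_ball (hle.trans (min_le_right _ _)) hy)).le
    rw [this, Set.empty_union]
    exact cvx _ _ _ _

/-- Gluing a triangle to a compact set along an edge keeps the complement connected. -/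
lemma isPreconnected_compl_union_tri {K : Set Plane} {p x q : Plane} (hK : IsClosed K)
    (hKc : IsPreconnected Kᶜ) (h : cr p x q ≠ 0) (hT : tri p x q ∩ K = segment ℝ p q) :
    IsPreconnected (K ∪ tri p x q)ᶜ := by
  have hx := cr_ne_swap_left h
  have hq := cr_ne_swap_right h
  have notK : ∀ y ∈ tri p x q, 0 < bary p x q y → y ∉ K := fun y hy hp hyK =>
    hp.ne' (bary_eq_zero_of_mem_segment (hT ▸ ⟨hy, hyK⟩))
  set S := (K ∪ tri p x q)ᶜ with hS
  have hSo : IsOpen S := (hK.union (isClosed_tri _ _ _)).isOpen_compl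
  rw [isPreconnected_iff_subset_of_disjoint]
  intro u v hu hv huv hdisj
  -- `E` is the union of the two free sides without `p` and `q`; it is connected through `x`. Seen
  -- from outside, all points of `E` border the same part of a hypothetical separation of `S`.
  let E : Set Plane := (tri p x q ∩ {y | 0 < bary p x q y} ∩ {y | bary x p q y = 0}) ∪
    (tri p x q ∩ {y | 0 < bary p x q y} ∩ {y | bary p q x y = 0})
  let U : Set Plane → Set Plane := fun A => {s | ∃ ε > 0, Metric.ball s ε \ tri p x q ⊆ A}
  have hUo : ∀ A, IsOpen (U A) := by
    intro A
    rw [Metric.isOpen_iff]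
    rintro s ⟨ε, hε, hs⟩
    refine ⟨ε, hε, fun s' hs' => ⟨ε - dist s' s, by simpa using hs', fun y hy => hs ⟨?_, hy.2⟩⟩⟩
    have h1 := hy.1
    rw [Metric.mem_ball] at *
    linarith [dist_triangle y s' s]
  have convex_pos : Convex ℝ {y | 0 < bary p x q y} := by
    intro a ha b hb s t hs ht hst
    simp only [Set.mem_ofPred_eq] at *
    rw [bary_combo _ _ _ _ _ hst]
    rcases hs.eq_or_lt with rfl | hs
    · obtain rfl : t = 1 := by linarith
      linarith
    · have := mul_pos hs ha
      have := mul_nonneg ht hb.le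
      linarith
  have convex_zero : ∀ a b c : Plane, Convex ℝ {y | bary a b c y = 0} := by
    intro a b c y hy z hz s t hs ht hst
    simp only [Set.mem_ofPred_eq] at *
    rw [bary_combo _ _ _ _ _ hst, hy, hz]; ring
  have hE : IsPreconnected E := by
    refine IsPreconnected.union x ?_ ?_ ((((convex_tri _ _ _).inter convex_pos).inter
      (convex_zero _ _ _)).isPreconnected) ((((convex_tri _ _ _).inter convex_pos).inter
      (convex_zero _ _ _)).isPreconnected)
    · refine ⟨⟨mid_mem_tri _ _ _, ?_⟩, bary_left _ _ _⟩
      show 0 < bary p x q x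
      rw [bary_self h]; norm_num
    · refine ⟨⟨mid_mem_tri _ _ _, ?_⟩, bary_right _ _ _⟩
      show 0 < bary p x q x
      rw [bary_self h]; norm_num
  have hE' : ∀ s ∈ E, s ∈ tri p x q ∧ 0 < bary p x q s ∧
      (bary x p q s = 0 ∨ bary p q x s = 0) := by
    rintro s (⟨⟨a, b⟩, c⟩ | ⟨⟨a, b⟩, c⟩)
    · exact ⟨a, b, Or.inl c⟩
    · exact ⟨a, b, Or.inr c⟩
  -- each local complement lies on one side
  have cover : E ⊆ U (S ∩ u) ∪ U (S ∩ v) := by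
    intro s hs
    obtain ⟨hsT, hpos, hz⟩ := hE' s hs
    obtain ⟨ε₀, hε₀, hb⟩ := ball_diff_tri h hsT hpos hz
    obtain ⟨ε₁, hε₁, hb1⟩ := Metric.isOpen_iff.1 hK.isOpen_compl s (notK s hsT hpos)
    obtain ⟨hpc, -⟩ := hb (min ε₀ ε₁) (lt_min hε₀ hε₁) (min_le_left _ _)
    have hsub : Metric.ball s (min ε₀ ε₁) \ tri p x q ⊆ S := by
      rintro y ⟨hy, hyT⟩ (hyK | hyT')
      · exact hb1 (Metric.ball_subset_ball (min_le_right _ _) hy) hyK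
      · exact hyT hyT'
    rcases isPreconnected_iff_subset_of_disjoint.1 hpc u v hu hv (hsub.trans huv) (by
      rw [← Set.subset_empty_iff] at hdisj ⊢
      exact fun y hy => hdisj ⟨hsub hy.1, hy.2⟩) with h' | h'
    · exact Or.inl ⟨_, lt_min hε₀ hε₁, Set.subset_inter hsub h'⟩
    · exact Or.inr ⟨_, lt_min hε₀ hε₁, Set.subset_inter hsub h'⟩
  have disj : E ∩ (U (S ∩ u) ∩ U (S ∩ v)) = ∅ := by
    rw [← Set.subset_empty_iff]
    rintro s ⟨hs, ⟨ε₁, hε₁, h1⟩, ⟨ε₂, hε₂, h2⟩⟩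
    obtain ⟨hsT, hpos, hz⟩ := hE' s hs
    obtain ⟨ε₀, hε₀, hb⟩ := ball_diff_tri h hsT hpos hz
    obtain ⟨-, y, hy, hyT⟩ := hb (min ε₀ (min ε₁ ε₂)) (lt_min hε₀ (lt_min hε₁ hε₂))
      (min_le_left _ _)
    have a1 := h1 ⟨Metric.ball_subset_ball ((min_le_right _ _).trans (min_le_left _ _)) hy, hyT⟩
    have a2 := h2 ⟨Metric.ball_subset_ball ((min_le_right _ _).trans (min_le_right _ _)) hy, hyT⟩
    exact (hdisj.subset (⟨a1.1, a1.2, a2.2⟩ : y ∈ S ∩ (u ∩ v))).elim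
  have main : ∀ u v : Set Plane, IsOpen u → IsOpen v → S ⊆ u ∪ v → S ∩ (u ∩ v) = ∅ →
      E ⊆ U (S ∩ u) → S ⊆ u := by
    intro u v hu hv huv hdisj hEu
    -- If the outside of `E` lies in `u`, then adding the triangle without `K` to `S ∩ u` gives an
    -- open set, which together with `S ∩ v` would separate the connected set `Kᶜ`; hence `S ∩ v` is
    -- empty.
    have hA' : IsOpen ((S ∩ u) ∪ (tri p x q \ K)) := by
      rw [isOpen_iff_mem_nhds]
      rintro y (hy | ⟨hyT, hyK⟩)
      · exact Filter.mem_of_superset ((hSo.inter hu).mem_nhds hy) Set.subset_union_left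
      · have hnK : Kᶜ ∈ nhds y := hK.isOpen_compl.mem_nhds hyK
        obtain ⟨h1, h2, h3⟩ := (mem_tri_iff h).1 hyT
        have h2' : 0 < bary p x q y := by
          refine lt_of_le_of_ne h2 fun e => hyK ?_
          have : y ∈ segment ℝ p q := mem_segment_of_bary_eq_zero h hyT e.symm
          rw [← hT] at this
          exact this.2
        by_cases hyE : y ∈ E
        · obtain ⟨ε, hε, hb⟩ := hEu hyE
          filter_upwards [hnK, Metric.ball_mem_nhds y hε] with z hz1 hz2
          by_cases hzT : z ∈ tri p x q
          · exact Or.inr ⟨hzT, hz1⟩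
          · exact Or.inl (hb ⟨hz2, hzT⟩)
        · have h1' : 0 < bary x p q y :=
            lt_of_le_of_ne h1 fun e => hyE (Or.inl ⟨⟨hyT, h2'⟩, e.symm⟩)
          have h3' : 0 < bary p q x y :=
            lt_of_le_of_ne h3 fun e => hyE (Or.inr ⟨⟨hyT, h2'⟩, e.symm⟩)
          filter_upwards [hnK, (isOpen_lt continuous_const (continuous_bary x p q)).mem_nhds h1',
            (isOpen_lt continuous_const (continuous_bary p x q)).mem_nhds h2',
            (isOpen_lt continuous_const (continuous_bary p q x)).mem_nhds h3'] with z g0 g1 g2 g3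
          exact Or.inr ⟨(mem_tri_iff h).2 ⟨le_of_lt g1, le_of_lt g2, le_of_lt g3⟩, g0⟩
    have hcov : Kᶜ ⊆ (S ∩ v) ∪ ((S ∩ u) ∪ (tri p x q \ K)) := by
      intro y hy
      by_cases hyT : y ∈ tri p x q
      · exact Or.inr (Or.inr ⟨hyT, hy⟩)
      · have hyS : y ∈ S := fun hh => hh.elim hy hyT
        rcases huv hyS with hh | hh
        · exact Or.inr (Or.inl ⟨hyS, hh⟩)
        · exact Or.inl ⟨hyS, hh⟩
    have hSK : S ⊆ Kᶜ := fun y hy hyK => hy (Or.inl hyK)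
    have hdisj' : Kᶜ ∩ ((S ∩ v) ∩ ((S ∩ u) ∪ (tri p x q \ K))) = ∅ := by
      rw [← Set.subset_empty_iff]
      rintro y ⟨-, ⟨hyS, hyv⟩, (⟨-, hyu⟩ | ⟨hyT, -⟩)⟩
      · exact hdisj.subset ⟨hyS, hyu, hyv⟩
      · exact hyS (Or.inr hyT)
    rcases isPreconnected_iff_subset_of_disjoint.1 hKc _ _ (hSo.inter hv) hA' hcov hdisj' with
      h' | h'
    · have hxK : x ∈ Kᶜ := notK x (mid_mem_tri _ _ _) (by rw [bary_self h]; norm_num)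
      exact absurd (Or.inr (mid_mem_tri p x q)) (h' hxK).1
    · intro y hy
      rcases h' (hSK hy) with hh | ⟨hyT, -⟩
      · exact hh.2
      · exact absurd (Or.inr hyT) hy
  rcases isPreconnected_iff_subset_of_disjoint.1 hE _ _ (hUo _) (hUo _) cover disj with h' | h'
  · exact Or.inl (main u v hu hv huv hdisj h')
  · exact Or.inr (main v u hv hu (by rwa [Set.union_comm]) (by rwa [Set.inter_comm v u]) h')

/-! ### Regions bounded by vertex lists, and gluing of triangles -/

/-- The pairs of consecutive entries of a list. -/
def pairs : List Plane → List (Plane × Plane)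
  | a :: b :: l => (a, b) :: pairs (b :: l)
  | _ => []

lemma pairs_map_snd : ∀ l : List Plane, (pairs l).map Prod.snd = l.tail
  | [] => rfl
  | [_] => rfl
  | a :: b :: l => by simp [pairs, pairs_map_snd (b :: l)]

lemma pairs_append : ∀ (A : List Plane) (p : Plane) (B : List Plane),
    pairs (A ++ p :: B) = pairs (A ++ [p]) ++ pairs (p :: B)
  | [], p, B => by simp [pairs]
  | [a], p, B => by simp [pairs]
  | a :: b :: A, p, B => by simpa [pairs] using pairs_append (b :: A) p B

/-- The edge joining a pair of points. -/
def seg (e : Plane × Plane) : Set Plane := segment ℝ e.1 e.2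

/-- The closed list `l` of vertices bounds the region `K`; collinear consecutive vertices are
allowed. -/
structure Bounds (l : List Plane) (K : Set Plane) : Prop where
  -- The list is closed, with its first vertex repeated at the end; dropping the head leaves each
  -- vertex once.
  nodup : l.tail.Nodup
  edges : ∀ e ∈ pairs l, ∀ f ∈ pairs l, e ≠ f → ∀ z ∈ seg e, z ∈ seg f →
    (z = e.1 ∨ z = e.2) ∧ (z = f.1 ∨ z = f.2)
  compact : IsCompact K
  compl : IsPreconnected Kᶜ
  frontier_subset : ∀ z ∈ frontier K, ∃ e ∈ pairs l, z ∈ seg e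
  -- A triangle of `K` on each edge shows on which side of that edge the region lies. A triangle
  -- glued there must then lie on the other side.
  thick : ∀ e ∈ pairs l, ∃ y, cr e.1 y e.2 ≠ 0 ∧ tri e.1 y e.2 ⊆ K

lemma bary_left_mid_eq_zero {p x q z : Plane} (hz : z ∈ segment ℝ p x) : bary p q x z = 0 :=
  bary_eq_zero_of_mem_segment hz

lemma bary_mid_right_eq_zero {p x q z : Plane} (hz : z ∈ segment ℝ x q) : bary x p q z = 0 :=
  bary_eq_zero_of_mem_segment hz

lemma eq_of_bary {p x q z : Plane} (h : cr p x q ≠ 0) :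
    (bary p q x z = 0 → bary x p q z = 0 → z = x) ∧
    (bary p q x z = 0 → bary p x q z = 0 → z = p) ∧
    (bary p x q z = 0 → bary x p q z = 0 → z = q) := by
  have h1 := bary_add h z
  have h2 := bary_reconstruct h z
  refine ⟨fun a b => ?_, fun a b => ?_, fun a b => ?_⟩
  all_goals
    rw [a, b] at h1 h2
    simp only [zero_smul, zero_add, add_zero] at h1 h2
    rw [h1, one_smul] at h2
    exact h2.symm

lemma seg_subset_of_thick {K : Set Plane} {e : Plane × Plane}
    (h : ∃ y, cr e.1 y e.2 ≠ 0 ∧ tri e.1 y e.2 ⊆ K) : seg e ⊆ K := by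
  obtain ⟨y, -, hy⟩ := h
  exact (segment_left_right_subset_tri _ _ _).trans hy

lemma Bounds.seg_subset {l : List Plane} {K : Set Plane} (hB : Bounds l K) {e : Plane × Plane}
    (he : e ∈ pairs l) : seg e ⊆ K := seg_subset_of_thick (hB.thick e he)

/-- Along a glued edge the two triangles lie on opposite sides. -/
lemma bary_neg_of_glue {K : Set Plane} {p x q y : Plane} (h : cr p x q ≠ 0)
    (hT : tri p x q ∩ K = segment ℝ p q) (hy : cr p y q ≠ 0) (hyK : tri p y q ⊆ K) :
    bary p x q y < 0 := by
  by_contra hlt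
  have h0 : 0 < bary p x q y := lt_of_le_of_ne (not_lt.1 hlt) (Ne.symm (div_ne_zero hy h))
  -- If `y` were on the side of `x`, a short step from the midpoint of `p q` towards `y` would stay
  -- in both triangles but leave the line `p q`, against the hypothesis on the intersection.
  let f : ℝ → Plane := fun t => (1 - t) • ((1 / 2 : ℝ) • p + (1 / 2 : ℝ) • q) + t • y
  have hf : Continuous f := by fun_prop
  have hx := cr_ne_swap_left h
  have hq := cr_ne_swap_right h
  have f1 : ∀ t, bary x p q (f t) = (1 - t) * (1 / 2) + t * bary x p q y := by
    intro t
    rw [bary_combo _ _ _ _ _ (by ring), bary_combo _ _ _ _ _ (by norm_num), bary_self hx,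
      bary_right]; ring
  have f2 : ∀ t, bary p q x (f t) = (1 - t) * (1 / 2) + t * bary p q x y := by
    intro t
    rw [bary_combo _ _ _ _ _ (by ring), bary_combo _ _ _ _ _ (by norm_num), bary_self hq,
      bary_left]; ring
  have f3 : ∀ t, bary p x q (f t) = t * bary p x q y := by
    intro t
    rw [bary_combo _ _ _ _ _ (by ring), bary_combo _ _ _ _ _ (by norm_num), bary_left,
      bary_right]; ring
  have ev : ∀ᶠ t in nhdsWithin (0 : ℝ) (Set.Ioi 0),
      0 < bary x p q (f t) ∧ 0 < bary p q x (f t) ∧ t ∈ Set.Ioo (0 : ℝ) 1 := by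
    refine Filter.Eventually.and ?_ (Filter.Eventually.and ?_ (Ioo_mem_nhdsGT one_pos))
    · apply nhdsWithin_le_nhds
      have c : Continuous fun t => bary x p q (f t) := (continuous_bary _ _ _).comp hf
      exact (isOpen_lt continuous_const c).mem_nhds (by
        show 0 < bary x p q (f 0)
        rw [f1]; norm_num)
    · apply nhdsWithin_le_nhds
      have c : Continuous fun t => bary p q x (f t) := (continuous_bary _ _ _).comp hf
      exact (isOpen_lt continuous_const c).mem_nhds (by
        show 0 < bary p q x (f 0)
        rw [f2]; norm_num)
  obtain ⟨t, ht1, ht2, ht0, ht3⟩ := ev.exists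
  have h3 : 0 < bary p x q (f t) := by rw [f3]; positivity
  have hm : f t ∈ tri p x q := (mem_tri_iff h).2 ⟨ht1.le, h3.le, ht2.le⟩
  have hmK : f t ∈ K := by
    apply hyK
    refine mem_tri_of_combo (a := (1 - t) / 2) (b := t) (c := (1 - t) / 2) (by linarith) ht0.le
      (by linarith) (by ring) ?_
    simp only [f, smul_add, smul_smul]
    rw [add_right_comm]
    congr 3 <;> ring
  exact h3.ne' (bary_eq_zero_of_mem_segment (hT ▸ ⟨hm, hmK⟩))

/-- Two triangles on opposite sides of a common edge cover a neighbourhood of its inner points. -/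
lemma mem_interior_of_glue {p x q y z : Plane} (h : cr p x q ≠ 0) (hy : bary p x q y < 0)
    (hz : z ∈ segment ℝ p q) (hzp : z ≠ p) (hzq : z ≠ q) :
    z ∈ interior (tri p y q ∪ tri p x q) := by
  have hcy : cr p y q ≠ 0 := by
    intro e
    simp [bary, e] at hy
  have aux : ∀ {w}, cr p w q ≠ 0 → 0 < bary w p q z ∧ 0 < bary p q w z := by
    intro w hw
    have h0 := bary_eq_zero_of_mem_segment (x := w) hz
    obtain ⟨h1, -, h2⟩ := (mem_tri_iff hw).1 (segment_left_right_subset_tri p w q hz)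
    refine ⟨lt_of_le_of_ne h1 fun e => hzq ((eq_of_bary hw).2.2 h0 e.symm),
      lt_of_le_of_ne h2 fun e => hzp ((eq_of_bary hw).2.1 e.symm h0)⟩
  rw [mem_interior_iff_mem_nhds]
  filter_upwards [(isOpen_lt continuous_const (continuous_bary x p q)).mem_nhds (aux h).1,
    (isOpen_lt continuous_const (continuous_bary p q x)).mem_nhds (aux h).2,
    (isOpen_lt continuous_const (continuous_bary y p q)).mem_nhds (aux hcy).1,
    (isOpen_lt continuous_const (continuous_bary p q y)).mem_nhds (aux hcy).2] with u h1 h2 h3 h4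
  rcases le_or_gt 0 (bary p x q u) with hu | hu
  · exact Or.inr ((mem_tri_iff h).2 ⟨h1.le, hu, h2.le⟩)
  · refine Or.inl ((mem_tri_iff hcy).2 ⟨h3.le, ?_, h4.le⟩)
    have : bary p y q u = bary p x q u / bary p x q y := by
      unfold bary; field_simp
    rw [this]
    exact (div_pos_of_neg_of_neg hu hy).le

/-- Gluing a triangle onto the edge `p q`. -/
theorem Bounds.glue {A B : List Plane} {K : Set Plane} {p x q : Plane}
    (hB : Bounds (A ++ p :: q :: B) K) (h : cr p x q ≠ 0)
    (hT : tri p x q ∩ K = segment ℝ p q) :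
    Bounds (A ++ p :: x :: q :: B) (K ∪ tri p x q) := by
  have e1 : pairs (A ++ p :: q :: B) = pairs (A ++ [p]) ++ (p, q) :: pairs (q :: B) := by
    rw [pairs_append]; rfl
  have e2 : pairs (A ++ p :: x :: q :: B) =
      pairs (A ++ [p]) ++ (p, x) :: (x, q) :: pairs (q :: B) := by
    rw [pairs_append]; rfl
  have nd : (pairs (A ++ p :: q :: B)).Nodup :=
    List.Nodup.of_map Prod.snd (by rw [pairs_map_snd]; exact hB.nodup)
  have hpq : (p, q) ∈ pairs (A ++ p :: q :: B) := by rw [e1]; simp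
  have split : ∀ e ∈ pairs (A ++ p :: x :: q :: B),
      e = (p, x) ∨ e = (x, q) ∨ (e ∈ pairs (A ++ p :: q :: B) ∧ e ≠ (p, q)) := by
    intro e he
    rw [e2] at he
    rw [e1] at nd ⊢
    rw [List.nodup_middle, List.nodup_cons] at nd
    simp only [List.mem_append, List.mem_cons] at he nd ⊢
    have : e ∈ pairs (A ++ [p]) ∨ e ∈ pairs (q :: B) → e ≠ (p, q) := by
      rintro h rfl; exact nd.1 h
    tauto
  have unsplit : ∀ e ∈ pairs (A ++ p :: q :: B), e ≠ (p, q) →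
      e ∈ pairs (A ++ p :: x :: q :: B) := by
    intro e he hne
    rw [e1] at he
    rw [e2]
    simp only [List.mem_append, List.mem_cons] at he ⊢
    tauto
  -- The new vertex is off `K`, hence distinct from all old vertices.
  have hxK : x ∉ K := fun hx => by
    have : x ∈ segment ℝ p q := hT ▸ ⟨mid_mem_tri _ _ _, hx⟩
    have := bary_eq_zero_of_mem_segment (x := x) this
    rw [bary_self h] at this
    exact one_ne_zero this
  have hsegK := fun e he => hB.seg_subset (e := e) he
  have old1 : ∀ e ∈ pairs (A ++ p :: q :: B), e ≠ (p, q) → ∀ z ∈ seg e, z ∈ segment ℝ p x →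
      z = p ∧ (z = e.1 ∨ z = e.2) := by
    intro e he hne z hze hz
    have hzpq : z ∈ segment ℝ p q := hT ▸ ⟨segment_left_mid_subset_tri _ _ _ hz, hsegK e he hze⟩
    have := hB.edges e he (p, q) hpq hne z hze hzpq
    exact ⟨(eq_of_bary h).2.1 (bary_left_mid_eq_zero hz) (bary_eq_zero_of_mem_segment hzpq), this.1⟩
  have old2 : ∀ e ∈ pairs (A ++ p :: q :: B), e ≠ (p, q) → ∀ z ∈ seg e, z ∈ segment ℝ x q →
      z = q ∧ (z = e.1 ∨ z = e.2) := by
    intro e he hne z hze hz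
    have hzpq : z ∈ segment ℝ p q := hT ▸ ⟨segment_mid_right_subset_tri _ _ _ hz, hsegK e he hze⟩
    have := hB.edges e he (p, q) hpq hne z hze hzpq
    exact ⟨(eq_of_bary h).2.2 (bary_eq_zero_of_mem_segment hzpq) (bary_mid_right_eq_zero hz), this.1⟩
  have new : ∀ z ∈ segment ℝ p x, z ∈ segment ℝ x q → z = x := fun z h1 h2 =>
    (eq_of_bary h).1 (bary_left_mid_eq_zero h1) (bary_mid_right_eq_zero h2)
  refine ⟨?_, ?_, hB.compact.union (isCompact_tri _ _ _),
    isPreconnected_compl_union_tri hB.compact.isClosed hB.compl h hT, ?_, ?_⟩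
  · have hnot : x ∉ (A ++ p :: q :: B).tail := by
      rw [← pairs_map_snd]
      intro hx
      obtain ⟨e, he, rfl⟩ := List.mem_map.1 hx
      exact hxK (hsegK e he (right_mem_segment _ _ _))
    have perm : (A ++ p :: x :: q :: B).tail.Perm (x :: (A ++ p :: q :: B).tail) := by
      cases A with
      | nil => exact List.Perm.refl _
      | cons a A =>
        have := List.perm_middle (a := x) (l₁ := A ++ [p]) (l₂ := q :: B)
        simpa using this
    rw [perm.nodup_iff, List.nodup_cons]
    exact ⟨hnot, hB.nodup⟩
  · intro e he f hf hne z hze hzf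
    rcases split e he with rfl | rfl | ⟨he, hne1⟩ <;> rcases split f hf with rfl | rfl | ⟨hf, hne2⟩
    · exact absurd rfl hne
    · exact ⟨Or.inr (new z hze hzf), Or.inl (new z hze hzf)⟩
    · have := old1 f hf hne2 z hzf hze
      exact ⟨Or.inl this.1, this.2⟩
    · exact ⟨Or.inl (new z hzf hze), Or.inr (new z hzf hze)⟩
    · exact absurd rfl hne
    · have := old2 f hf hne2 z hzf hze
      exact ⟨Or.inr this.1, this.2⟩
    · have := old1 e he hne1 z hze hzf
      exact ⟨this.2, Or.inl this.1⟩
    · have := old2 e he hne1 z hze hzf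
      exact ⟨this.2, Or.inr this.1⟩
    · exact hB.edges e he f hf hne z hze hzf
  · have m1 : (p, x) ∈ pairs (A ++ p :: x :: q :: B) := by rw [e2]; simp
    have m2 : (x, q) ∈ pairs (A ++ p :: x :: q :: B) := by rw [e2]; simp
    intro z hz
    by_contra hcon
    push Not at hcon
    have n1 : z ∉ segment ℝ p x := hcon _ m1
    have n2 : z ∉ segment ℝ x q := hcon _ m2
    have hzpq : z ∈ segment ℝ p q := by
      rcases frontier_union_subset _ _ hz with ⟨hf, -⟩ | ⟨-, hf⟩
      · obtain ⟨e, he, hze⟩ := hB.frontier_subset z hf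
        by_cases hne : e = (p, q)
        · subst hne; exact hze
        · exact absurd hze (hcon e (unsplit e he hne))
      · have hzT : z ∈ tri p x q := (isClosed_tri p x q).frontier_subset hf
        obtain ⟨g1, g2, g3⟩ := (mem_tri_iff h).1 hzT
        have g1' : 0 < bary x p q z := by
          refine lt_of_le_of_ne g1 fun e => n2 ?_
          exact mem_segment_of_bary_eq_zero (cr_ne_swap_left h)
            (by rw [tri_swap_left]; exact hzT) e.symm
        have g3' : 0 < bary p q x z := by
          refine lt_of_le_of_ne g3 fun e => n1 ?_
          refine mem_segment_of_bary_eq_zero (cr_ne_swap_right h) ?_ e.symm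
          rw [← tri_swap, tri_swap_left, tri_swap]; exact hzT
        by_contra hseg
        have g2' : 0 < bary p x q z :=
          lt_of_le_of_ne g2 fun e => hseg (mem_segment_of_bary_eq_zero h hzT e.symm)
        apply hf.2
        rw [mem_interior_iff_mem_nhds]
        filter_upwards [(isOpen_lt continuous_const (continuous_bary x p q)).mem_nhds g1',
          (isOpen_lt continuous_const (continuous_bary p x q)).mem_nhds g2',
          (isOpen_lt continuous_const (continuous_bary p q x)).mem_nhds g3'] with w h1 h2 h3
        exact (mem_tri_iff h).2 ⟨le_of_lt h1, le_of_lt h2, le_of_lt h3⟩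
    -- The old edge `p q` disappears from the frontier: its inner points become interior, being
    -- covered from both sides, and its endpoints lie on the new edges.
    obtain ⟨y, hy, hyK⟩ := hB.thick _ hpq
    have := mem_interior_of_glue h (bary_neg_of_glue h hT hy hyK) hzpq
      (fun e => n1 (e ▸ left_mem_segment _ _ _)) (fun e => n2 (e ▸ right_mem_segment _ _ _))
    exact hz.2 (interior_mono (Set.union_subset_union_left _ hyK) this)
  · intro e he
    rcases split e he with rfl | rfl | ⟨he, -⟩
    · refine ⟨q, cr_ne_swap_right h, Set.subset_union_of_subset_right ?_ _⟩
      show tri p q x ⊆ _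
      rw [← tri_swap, tri_swap_left, tri_swap]
    · refine ⟨p, cr_ne_swap_left h, Set.subset_union_of_subset_right ?_ _⟩
      show tri x p q ⊆ _
      rw [tri_swap_left]
    · obtain ⟨y, hy, hyK⟩ := hB.thick e he
      exact ⟨y, hy, hyK.trans Set.subset_union_left⟩

/-- The single triangle from which the gluing starts. -/
lemma bounds_tri {p x q : Plane} (h : cr p x q ≠ 0) : Bounds [p, x, q, p] (tri p x q) := by
  have hx := cr_ne_swap_left h
  have hq := cr_ne_swap_right h
  have t1 : tri p q x = tri p x q := by rw [← tri_swap, tri_swap_left, tri_swap]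
  have ne1 : p ≠ x := by rintro rfl; simp [cr] at h
  have ne2 : p ≠ q := by rintro rfl; exact h (by unfold cr; ring)
  have ne3 : x ≠ q := by rintro rfl; exact h (by unfold cr; ring)
  have i1 : ∀ z ∈ segment ℝ p x, z ∈ segment ℝ x q → z = x := fun z h1 h2 =>
    (eq_of_bary h).1 (bary_left_mid_eq_zero h1) (bary_mid_right_eq_zero h2)
  have i2 : ∀ z ∈ segment ℝ p x, z ∈ segment ℝ q p → z = p := fun z h1 h2 =>
    (eq_of_bary h).2.1 (bary_left_mid_eq_zero h1)
      (bary_eq_zero_of_mem_segment (segment_symm ℝ q p ▸ h2))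
  have i3 : ∀ z ∈ segment ℝ x q, z ∈ segment ℝ q p → z = q := fun z h1 h2 =>
    (eq_of_bary h).2.2 (bary_eq_zero_of_mem_segment (segment_symm ℝ q p ▸ h2))
      (bary_mid_right_eq_zero h1)
  have mem : ∀ e, e ∈ pairs [p, x, q, p] ↔ e = (p, x) ∨ e = (x, q) ∨ e = (q, p) := by
    intro e; simp [pairs]
  refine ⟨?_, ?_, isCompact_tri _ _ _, isPreconnected_compl_tri h, ?_, ?_⟩
  · simp [ne3, ne1.symm, ne2.symm]
  · intro e he f hf hne z hze hzf
    rw [mem] at he hf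
    rcases he with rfl | rfl | rfl <;> rcases hf with rfl | rfl | rfl <;>
      simp only [seg, ne_eq, not_true_eq_false] at hne hze hzf ⊢
    · exact ⟨Or.inr (i1 z hze hzf), Or.inl (i1 z hze hzf)⟩
    · exact ⟨Or.inl (i2 z hze hzf), Or.inr (i2 z hze hzf)⟩
    · exact ⟨Or.inl (i1 z hzf hze), Or.inr (i1 z hzf hze)⟩
    · exact ⟨Or.inr (i3 z hze hzf), Or.inl (i3 z hze hzf)⟩
    · exact ⟨Or.inr (i2 z hzf hze), Or.inl (i2 z hzf hze)⟩
    · exact ⟨Or.inl (i3 z hzf hze), Or.inr (i3 z hzf hze)⟩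
  · intro z hz
    have hzT : z ∈ tri p x q := (isClosed_tri p x q).frontier_subset hz
    obtain ⟨g1, g2, g3⟩ := (mem_tri_iff h).1 hzT
    rcases g1.eq_or_lt with e | g1'
    · refine ⟨(x, q), (mem _).2 (by simp), ?_⟩
      exact mem_segment_of_bary_eq_zero hx (by rw [tri_swap_left]; exact hzT) e.symm
    rcases g2.eq_or_lt with e | g2'
    · refine ⟨(q, p), (mem _).2 (by simp), ?_⟩
      show z ∈ segment ℝ q p
      rw [segment_symm]
      exact mem_segment_of_bary_eq_zero h hzT e.symm
    rcases g3.eq_or_lt with e | g3'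
    · refine ⟨(p, x), (mem _).2 (by simp), ?_⟩
      exact mem_segment_of_bary_eq_zero hq (by rw [t1]; exact hzT) e.symm
    exfalso
    apply hz.2
    rw [mem_interior_iff_mem_nhds]
    filter_upwards [(isOpen_lt continuous_const (continuous_bary x p q)).mem_nhds g1',
      (isOpen_lt continuous_const (continuous_bary p x q)).mem_nhds g2',
      (isOpen_lt continuous_const (continuous_bary p q x)).mem_nhds g3'] with w h1 h2 h3
    exact (mem_tri_iff h).2 ⟨le_of_lt h1, le_of_lt h2, le_of_lt h3⟩
  · intro e he
    rw [mem] at he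
    rcases he with rfl | rfl | rfl
    · exact ⟨q, hq, t1.subset⟩
    · exact ⟨p, hx, (tri_swap_left _ _ _).subset⟩
    · exact ⟨x, cr_ne_swap h, (tri_swap _ _ _).subset⟩

/-! ### From vertex lists to simple polygons -/

/-- No three consecutive entries of the list are collinear. -/
def Turning : List Plane → Prop
  | a :: b :: c :: l => cr a b c ≠ 0 ∧ Turning (b :: c :: l)
  | _ => True

lemma Turning.getElem : ∀ {l : List Plane}, Turning l → ∀ i (h : i + 2 < l.length),
    cr l[i] l[i + 1] l[i + 2] ≠ 0
  | a :: b :: c :: l, ht, 0, _ => ht.1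
  | a :: b :: c :: l, ht, i + 1, h => Turning.getElem ht.2 i (by simpa using h)

lemma getElem_mem_pairs : ∀ (l : List Plane) (i : ℕ) (h : i + 1 < l.length),
    (l[i], l[i + 1]) ∈ pairs l
  | a :: b :: l, 0, _ => by simp [pairs]
  | a :: b :: l, i + 1, h => by
    have := getElem_mem_pairs (b :: l) i (by simpa using h)
    exact List.mem_cons_of_mem _ this

lemma exists_getElem_of_mem_pairs : ∀ {l : List Plane} {e : Plane × Plane}, e ∈ pairs l →
    ∃ (i : ℕ) (h : i + 1 < l.length), e = (l[i], l[i + 1])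
  | a :: b :: l, e, he => by
    rcases List.mem_cons.1 he with rfl | he
    · exact ⟨0, by simp, rfl⟩
    · obtain ⟨i, h, rfl⟩ := exists_getElem_of_mem_pairs he
      exact ⟨i + 1, by simpa using h, rfl⟩

lemma affineIndependent_of_cr {a b c : Plane} (h : cr a b c ≠ 0) :
    AffineIndependent ℝ ![a, b, c] := by
  rw [affineIndependent_iff_not_collinear_set]
  intro hc
  rw [collinear_iff_of_mem (Set.mem_insert a _)] at hc
  obtain ⟨v, hv⟩ := hc
  obtain ⟨s, rfl⟩ := hv b (by simp)
  obtain ⟨t, rfl⟩ := hv c (by simp)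
  apply h
  simp only [cr, vadd_eq_add, PiLp.add_apply, PiLp.smul_apply, smul_eq_mul]
  ring

/-- A compact set with connected complement whose frontier lies in a polygon that it contains is
the region of this polygon. -/
lemma region_eq {n : ℕ} {poly : Polygon Plane n} {K : Set Plane} (hK : IsCompact K)
    (hKc : IsPreconnected Kᶜ) (h1 : poly.boundary ℝ ⊆ K) (h2 : frontier K ⊆ poly.boundary ℝ) :
    region poly = K := by
  apply Set.Subset.antisymm
  · rintro x (hx | ⟨hx, hb⟩)
    · exact h1 hx
    · by_contra hxK
      have hsub : Kᶜ ⊆ connectedComponentIn (poly.boundary ℝ)ᶜ x :=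
        hKc.subset_connectedComponentIn hxK (Set.compl_subset_compl.2 h1)
      have : Bornology.IsBounded (K ∪ Kᶜ) := hK.isBounded.union (hb.subset hsub)
      rw [Set.union_compl_self] at this
      exact NormedSpace.unbounded_univ ℝ Plane this
  · intro x hx
    by_cases hxb : x ∈ poly.boundary ℝ
    · exact Or.inl hxb
    · refine Or.inr ⟨hxb, hK.isBounded.subset ?_⟩
      have hpc : IsPreconnected (connectedComponentIn (poly.boundary ℝ)ᶜ x) :=
        isPreconnected_connectedComponentIn
      have hxm : x ∈ connectedComponentIn (poly.boundary ℝ)ᶜ x := mem_connectedComponentIn hxb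
      have hsub := connectedComponentIn_subset (poly.boundary ℝ)ᶜ x
      have hint : ∀ y ∈ K, y ∉ poly.boundary ℝ → y ∈ interior K := by
        intro y hy hyb
        by_contra hyi
        exact hyb (h2 ⟨subset_closure hy, hyi⟩)
      -- A component of the complement of the boundary curve avoids the frontier of `K`, so it lies
      -- either in the interior of `K`, and is bounded, or outside `K`.
      have := isPreconnected_iff_subset_of_disjoint.1 hpc (interior K) Kᶜ isOpen_interior
        hK.isClosed.isOpen_compl (fun y hy => by
          by_cases hyK : y ∈ K
          · exact Or.inl (hint y hyK (hsub hy))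
          · exact Or.inr hyK) (by
          rw [← Set.subset_empty_iff]
          rintro y ⟨-, hy1, hy2⟩
          exact hy2 (interior_subset hy1))
      rcases this with h | h
      · exact h.trans interior_subset
      · exact absurd hx (h hxm)

/-- The cyclic order is encoded by appending initial vertices: one copy closes the last edge, two
copies supply the two corners that wrap around. Entry `i` of the extended list is the vertex with
index `i` modulo `n`, which converts the list conditions into the `Fin n` ones. -/
theorem Bounds.exists_polygon {n : ℕ} [NeZero n] {l : List Plane} {K : Set Plane}
    (hl : l.length = n) (h3 : 3 ≤ n) (hB : Bounds (l ++ l.take 1) K)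
    (ht : Turning (l ++ l.take 2)) :
    ∃ poly : Polygon Plane n, IsSimple poly ∧ region poly = K := by
  obtain ⟨m, rfl⟩ : ∃ m, n = m + 1 := ⟨n - 1, by omega⟩
  let v : Fin (m + 1) → Plane := fun i => l[i.val]'(by rw [hl]; exact i.2)
  have val1 : ∀ i : Fin (m + 1), (i + 1).val = (i.val + 1) % (m + 1) := by
    intro i; rw [Fin.val_add, Fin.val_one', Nat.add_mod_mod]
  have two : ∀ i : Fin (m + 1), i + 1 + 1 = i + 2 := by
    intro i
    rw [add_assoc]
    congr 1
    ext
    show (1 % (m + 1) + 1 % (m + 1)) % (m + 1) = 2 % (m + 1)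
    rw [← Nat.add_mod]
  have val2 : ∀ i : Fin (m + 1), (i + 2).val = (i.val + 2) % (m + 1) := by
    intro i
    rw [← two, val1, val1, Nat.mod_add_mod]
  have get : ∀ k ≤ 2, ∀ (i : ℕ) (hi : i < (l ++ l.take k).length),
      (l ++ l.take k)[i] = v ⟨i % (m + 1), Nat.mod_lt _ (by omega)⟩ := by
    intro k hk i hi
    have hi' : i < m + 1 + k := by simpa [hl, Nat.min_eq_left (show k ≤ m + 1 by omega)] using hi
    rcases lt_or_ge i (m + 1) with h | h
    · rw [List.getElem_append_left (by omega)]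
      simp [v, Nat.mod_eq_of_lt h]
    · rw [List.getElem_append_right (by omega), List.getElem_take]
      have : i % (m + 1) = i - l.length := by
        rw [hl, Nat.mod_eq_sub_mod h, Nat.mod_eq_of_lt (by omega)]
      simp [v, this]
  have len : ∀ k ≤ 2, (l ++ l.take k).length = m + 1 + k := by
    intro k hk; simp [hl, Nat.min_eq_left (show k ≤ m + 1 by omega)]
  have crne : ∀ i, cr (v i) (v (i + 1)) (v (i + 2)) ≠ 0 := by
    intro i
    have := ht.getElem i.val (by rw [len 2 le_rfl]; omega)
    rw [get 2 le_rfl, get 2 le_rfl, get 2 le_rfl] at this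
    convert this using 2
    · congr 1; ext; simp [Nat.mod_eq_of_lt i.2]
    · congr 1; ext; exact val1 i
    · congr 1; ext; exact val2 i
  have mem : ∀ i, (v i, v (i + 1)) ∈ pairs (l ++ l.take 1) := by
    intro i
    have := getElem_mem_pairs (l ++ l.take 1) i.val (by rw [len 1 (by omega)]; omega)
    rw [get 1 (by omega), get 1 (by omega)] at this
    convert this using 2
    · congr 1; ext; simp [Nat.mod_eq_of_lt i.2]
    · congr 1; ext; exact val1 i
  have mem' : ∀ e ∈ pairs (l ++ l.take 1), ∃ i, e = (v i, v (i + 1)) := by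
    intro e he
    obtain ⟨i, hi, rfl⟩ := exists_getElem_of_mem_pairs he
    rw [get 1 (by omega), get 1 (by omega)]
    refine ⟨⟨i % (m + 1), Nat.mod_lt _ (by omega)⟩, ?_⟩
    congr 2; ext; rw [val1]; simp
  have inj : Function.Injective v := by
    have hnd : l.Nodup := by
      have := hB.nodup
      cases l with
      | nil => simp
      | cons a l =>
        have p : (l ++ [a]).Perm (a :: l) := List.perm_append_comm
        exact p.nodup_iff.1 (by simpa using this)
    intro i j hij
    ext
    exact (List.Nodup.getElem_inj_iff hnd).1 hij
  let poly : Polygon Plane (m + 1) := ⟨v⟩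
  have edge : ∀ i, poly.edgeSet ℝ i = segment ℝ (v i) (v (i + 1)) := by
    intro i
    rw [Polygon.edgeSet, affineSegment_eq_segment, finRotate_apply]
  have hbd : poly.boundary ℝ = {z | ∃ e ∈ pairs (l ++ l.take 1), z ∈ seg e} := by
    ext z
    simp only [Polygon.boundary, Set.mem_iUnion, edge, Set.mem_ofPred_eq]
    constructor
    · rintro ⟨i, hi⟩; exact ⟨_, mem i, hi⟩
    · rintro ⟨e, he, hz⟩
      obtain ⟨i, rfl⟩ := mem' e he
      exact ⟨i, hz⟩
  refine ⟨poly, ⟨fun i => affineIndependent_of_cr (crne i), ?_, ?_⟩, ?_⟩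
  · intro i
    have ne1 : v i ≠ v (i + 1) := fun e => crne i (by rw [e]; simp [cr])
    have ne2 : v i ≠ v (i + 2) := fun e => crne i (by rw [e]; unfold cr; ring)
    rw [edge, edge, two]
    ext z
    simp only [Set.mem_inter_iff, Set.mem_singleton_iff]
    constructor
    · rintro ⟨h1, h2⟩
      have := hB.edges _ (mem i) _ (mem (i + 1)) (fun e => ne1 (congrArg Prod.fst e)) z h1
        (by rw [two]; exact h2)
      rw [two] at this
      -- The only way to meet elsewhere than in the shared vertex would identify vertices `i` and `i
      -- + 2`, which is excluded by the corner at `i + 1`.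
      rcases this with ⟨a | a, b | b⟩
      · exact b
      · exact absurd (a.symm.trans b) ne2
      · exact a
      · exact a
    · rintro rfl
      exact ⟨right_mem_segment _ _ _, left_mem_segment _ _ _⟩
  · intro i j hij h1 h2
    rw [edge, edge, Set.disjoint_left]
    intro z hz1 hz2
    obtain ⟨a, b⟩ := hB.edges _ (mem i) _ (mem j) (fun e => hij (inj (congrArg Prod.fst e))) z
      hz1 hz2
    rcases a with a | a <;> rcases b with b | b
    · exact hij (inj (a.symm.trans b))
    · exact h2 (inj (a.symm.trans b))
    · exact h1 (inj (b.symm.trans a))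
    · exact hij (add_right_cancel (inj (a.symm.trans b)))
  · apply region_eq hB.compact hB.compl
    · rw [hbd]; rintro z ⟨e, he, hz⟩; exact hB.seg_subset he hz
    · rw [hbd]; exact hB.frontier_subset

/-! ### Growing convex polygons by one vertex -/

lemma cr_combo_right (a b y z : Plane) {s t : ℝ} (h : s + t = 1) :
    cr a b (s • y + t • z) = s * cr a b y + t * cr a b z := by
  obtain rfl : t = 1 - s := by linarith
  simp only [cr, PiLp.add_apply, PiLp.smul_apply, smul_eq_mul]; ring

lemma convex_setOf_cr_nonpos (a b : Plane) : Convex ℝ {v | cr a b v ≤ 0} := by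
  intro x hx y hy s t hs ht hst
  simp only [Set.mem_ofPred_eq] at *
  rw [cr_combo_right _ _ _ _ hst]
  nlinarith [mul_nonneg hs (neg_nonneg.2 hx), mul_nonneg ht (neg_nonneg.2 hy)]

lemma cr_nonpos_of_mem_convexHull {S : Set Plane} {a b : Plane} (h : ∀ v ∈ S, cr a b v ≤ 0) :
    ∀ v ∈ convexHull ℝ S, cr a b v ≤ 0 :=
  convexHull_min (t := {v | cr a b v ≤ 0}) h (convex_setOf_cr_nonpos a b)

/-- A face of a convex hull cut out by the line through two of its points. -/
lemma mem_segment_of_mem_convexHull {S : Set Plane} {p q : Plane}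
    (h : ∀ v ∈ S, v = p ∨ v = q ∨ cr p q v < 0) {y : Plane} (hy : y ∈ convexHull ℝ S)
    (h0 : cr p q y = 0) : y ∈ segment ℝ p q := by
  have key : convexHull ℝ S ⊆ {v | cr p q v < 0} ∪ segment ℝ p q := by
    apply convexHull_min
    · intro v hv
      rcases h v hv with rfl | rfl | h'
      · exact Or.inr (left_mem_segment _ _ _)
      · exact Or.inr (right_mem_segment _ _ _)
      · exact Or.inl h'
    · have h0 : ∀ v ∈ segment ℝ p q, cr p q v = 0 := by
        rintro v ⟨s, t, -, -, hst, rfl⟩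
        rw [cr_combo_right _ _ _ _ hst]; unfold cr; ring
      have hle : ∀ v ∈ {v | cr p q v < 0} ∪ segment ℝ p q, cr p q v ≤ 0 := by
        rintro v (hv | hv)
        · exact le_of_lt hv
        · exact (h0 v hv).le
      intro v hv w hw s t hs ht hst
      rcases hs.eq_or_lt with rfl | hs
      · obtain rfl : t = 1 := by linarith
        simpa using hw
      rcases ht.eq_or_lt with rfl | ht
      · obtain rfl : s = 1 := by linarith
        simpa using hv
      have hv' := hle v hv
      have hw' := hle w hw
      have e := cr_combo_right p q v w hst
      rcases hv with hv | hv
      · left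
        show cr p q _ < 0
        rw [e]
        have : cr p q v < 0 := hv
        nlinarith
      rcases hw with hw | hw
      · left
        show cr p q _ < 0
        rw [e]
        have : cr p q w < 0 := hw
        nlinarith
      · exact Or.inr (convex_segment p q hv hw hs.le ht.le hst)
  rcases key hy with h' | h'
  · exact absurd h0 (ne_of_lt h')
  · exact h'

/-- Adding to a convex hull a point that sees only the side `p q`. -/
lemma convexHull_insert_eq {S : Set Plane} {a p x q b : Plane} (hp : p ∈ S) (hq : q ∈ S)
    (h1 : ∀ v ∈ S, v = p ∨ v = q ∨ cr p q v < 0) (h2 : 0 < cr p q x)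
    (h3 : ∀ v ∈ S, cr a p v ≤ 0) (h3x : cr a p x ≤ 0) (h3q : cr a p q < 0)
    (h4 : ∀ v ∈ S, cr q b v ≤ 0) (h4x : cr q b x ≤ 0) (h4p : cr q b p < 0) :
    convexHull ℝ (insert x S) = convexHull ℝ S ∪ tri p x q := by
  apply Set.Subset.antisymm
  · intro y hy
    rw [convexHull_insert ⟨p, hp⟩, mem_convexJoin] at hy
    obtain ⟨x', rfl, k, hk, s, t, hs, ht, hst, rfl⟩ := hy
    have hseg : ∀ v ∈ segment ℝ p q, v ∈ tri p x' q :=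
      fun v hv => segment_left_right_subset_tri _ _ _ hv
    have hk0 : cr p q k ≤ 0 := by
      refine cr_nonpos_of_mem_convexHull (fun v hv => ?_) k hk
      rcases h1 v hv with rfl | rfl | h
      · unfold cr; ring_nf; rfl
      · unfold cr; ring_nf; rfl
      · exact h.le
    -- the crossing point of the segment with the side
    have hne : 0 < cr p q x' - cr p q k := by linarith
    set l : ℝ := - cr p q k / (cr p q x' - cr p q k) with hl
    have hl0 : 0 ≤ l := div_nonneg (by linarith) hne.le
    have hl1 : l < 1 := by rw [hl, div_lt_one hne]; linarith
    set z := l • x' + (1 - l) • k with hz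
    have hpxq : cr p x' q ≠ 0 := by rw [cr_swap_right]; exact (neg_neg_of_pos h2).ne
    have hz0 : bary p x' q z = 0 := by
      have : cr p q z = 0 := by
        rw [hz, cr_combo_right _ _ _ _ (by ring), hl]; field_simp; ring
      unfold bary; rw [cr_swap_right, this]; simp
    have hzr := bary_reconstruct hpxq z
    have hza := bary_add hpxq z
    rw [hz0] at hzr hza
    simp only [zero_smul, add_zero] at hzr hza
    have hz3 : cr a p z ≤ 0 := by
      rw [hz, cr_combo_right _ _ _ _ (by ring)]
      have := cr_nonpos_of_mem_convexHull h3 k hk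
      nlinarith [mul_nonneg hl0 (neg_nonneg.2 h3x),
        mul_nonneg (sub_nonneg.2 hl1.le) (neg_nonneg.2 this)]
    have hz4 : cr q b z ≤ 0 := by
      rw [hz, cr_combo_right _ _ _ _ (by ring)]
      have := cr_nonpos_of_mem_convexHull h4 k hk
      nlinarith [mul_nonneg hl0 (neg_nonneg.2 h4x),
        mul_nonneg (sub_nonneg.2 hl1.le) (neg_nonneg.2 this)]
    -- The lines `a p` and `q b` support the enlarged set, so the crossing point on the line `p q`
    -- can pass neither beyond `p` nor beyond `q`.
    have hzseg : z ∈ segment ℝ p q := by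
      refine ⟨bary x' p q z, bary p q x' z, ?_, ?_, hza, hzr⟩
      · by_contra hneg
        rw [← hzr, cr_combo_right _ _ _ _ hza] at hz4
        have e : cr q b q = 0 := by unfold cr; ring
        rw [e] at hz4
        nlinarith
      · by_contra hneg
        rw [← hzr, cr_combo_right _ _ _ _ hza] at hz3
        have e : cr a p p = 0 := by unfold cr; ring
        rw [e] at hz3
        nlinarith
    have hzK : z ∈ convexHull ℝ S :=
      (convex_convexHull ℝ S).segment_subset (subset_convexHull _ _ hp) (subset_convexHull _ _ hq)
        hzseg
    -- The weight `s` of `x` tells on which side of the crossing point the given point lies: towards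
    -- `x` it is in the triangle, towards `k` in the old hull.
    rcases le_or_gt l s with hls | hls
    · right
      have hd : 0 < 1 - l := by linarith
      have hcv := convex_tri p x' q (mid_mem_tri p x' q) (hseg z hzseg)
        (a := (s - l) / (1 - l)) (b := t / (1 - l))
        (div_nonneg (by linarith) hd.le) (div_nonneg ht hd.le) (by field_simp; linarith)
      convert hcv using 1
      rw [hz, smul_add, smul_smul, smul_smul, ← add_assoc, ← add_smul]
      congr 2
      · field_simp
        obtain rfl : t = 1 - s := by linarith
        ring
      · field_simp
    · left
      have hl0' : 0 < l := lt_of_le_of_lt hs hls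
      have hcv := convex_convexHull ℝ S hzK hk
        (a := s / l) (b := 1 - s / l)
        (div_nonneg hs hl0'.le) (by rw [sub_nonneg, div_le_one hl0']; exact hls.le) (by ring)
      convert hcv using 1
      rw [hz, smul_add, smul_smul, smul_smul, add_assoc, ← add_smul]
      congr 2
      · field_simp
      · field_simp
        obtain rfl : t = 1 - s := by linarith
        ring
  · apply Set.union_subset (convexHull_mono (Set.subset_insert _ _))
    apply convexHull_mono
    rintro v (rfl | rfl | rfl)
    · exact Or.inr hp
    · exact Or.inl rfl
    · exact Or.inr hq

/-- The line `p q` separates the apex from the rest of the hull, and it touches the hull only along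
the segment `p q`. -/
lemma tri_inter_convexHull {S : Set Plane} {p x q : Plane} (hp : p ∈ S) (hq : q ∈ S)
    (h1 : ∀ v ∈ S, v = p ∨ v = q ∨ cr p q v < 0) (h2 : 0 < cr p q x) :
    tri p x q ∩ convexHull ℝ S = segment ℝ p q := by
  have hpxq : cr p x q ≠ 0 := by rw [cr_swap_right]; exact (neg_neg_of_pos h2).ne
  apply Set.Subset.antisymm
  · rintro y ⟨hy, hyS⟩
    have e1 := ((mem_tri_iff hpxq).1 hy).2.1
    have e2 : cr p q y ≤ 0 := by
      refine cr_nonpos_of_mem_convexHull (fun v hv => ?_) y hyS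
      rcases h1 v hv with rfl | rfl | h
      · unfold cr; ring_nf; rfl
      · unfold cr; ring_nf; rfl
      · exact h.le
    unfold bary at e1
    rw [cr_swap_right, cr_swap_right p q x, neg_div_neg_eq] at e1
    have e3 : 0 ≤ cr p q y := by
      by_contra h
      exact absurd e1 (not_le.2 (div_neg_of_neg_of_pos (not_le.1 h) h2))
    exact mem_segment_of_mem_convexHull h1 hyS (le_antisymm e2 e3)
  · exact Set.subset_inter (segment_left_right_subset_tri _ _ _)
      ((convex_convexHull ℝ S).segment_subset (subset_convexHull _ _ hp) (subset_convexHull _ _ hq))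

/-- Gluing a triangle to a convex polygon so that the result is convex. -/
theorem Bounds.glue_convexHull {A B : List Plane} {S : Set Plane} {a p x q b : Plane}
    (hB : Bounds (A ++ p :: q :: B) (convexHull ℝ S)) (hp : p ∈ S) (hq : q ∈ S)
    (h1 : ∀ v ∈ S, v = p ∨ v = q ∨ cr p q v < 0) (h2 : 0 < cr p q x)
    (h3 : ∀ v ∈ S, cr a p v ≤ 0) (h3x : cr a p x ≤ 0) (h3q : cr a p q < 0)
    (h4 : ∀ v ∈ S, cr q b v ≤ 0) (h4x : cr q b x ≤ 0) (h4p : cr q b p < 0) :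
    Bounds (A ++ p :: x :: q :: B) (convexHull ℝ (insert x S)) := by
  rw [convexHull_insert_eq hp hq h1 h2 h3 h3x h3q h4 h4x h4p]
  exact hB.glue (by rw [cr_swap_right]; exact (neg_neg_of_pos h2).ne)
    (tri_inter_convexHull hp hq h1 h2)

/-! ### The convex base -/

/-- Points on the line that bounds the base from above. -/
def top (X : ℝ) : Plane := !₂[X, -1 / 2]

/-- Points on the parabola that bounds the base from below. -/
def para (W u : ℝ) : Plane := !₂[-(W * u), -1 / 2 - W * (1 - u ^ 2)]

@[simp] lemma top_zero (X : ℝ) : top X 0 = X := rfl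
@[simp] lemma top_one (X : ℝ) : top X 1 = -1 / 2 := rfl
@[simp] lemma para_zero (W u : ℝ) : para W u 0 = -(W * u) := rfl
@[simp] lemma para_one (W u : ℝ) : para W u 1 = -1 / 2 - W * (1 - u ^ 2) := rfl

lemma top_eq_para_right (W : ℝ) : top W = para W (-1) := by
  apply plane_ext <;> simp
lemma top_eq_para_left (W : ℝ) : top (-W) = para W 1 := by
  apply plane_ext <;> simp

lemma cr_para (W u v w : ℝ) :
    cr (para W u) (para W v) (para W w) = -(W ^ 2 * ((v - u) * (w - u) * (w - v))) := by
  simp only [cr, para_zero, para_one]; ring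

/-- The upper triangle of the base with vertices along its upper side. -/
lemma bounds_top {W : ℝ} (hW : 0 < W) : ∀ (Xs : List ℝ) (X : ℝ),
    (X :: Xs).Pairwise (· < ·) → (∀ Y ∈ X :: Xs, Y < W) →
    Bounds (para W 0 :: top X :: (Xs.map top ++ [top W, para W 0]))
      (convexHull ℝ {para W 0, top X, top W})
  | [], X, _, h2 => by
    refine bounds_tri ?_
    have := h2 X (by simp)
    have : cr (para W 0) (top X) (top W) = W * (X - W) := by simp [cr]; ring
    rw [this]
    exact mul_ne_zero hW.ne' (by linarith)
  | Y :: Xs, X, h1, h2 => by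
    have ih := bounds_top hW Xs Y (List.Pairwise.of_cons h1) (fun Z hZ => h2 Z (by simp_all))
    have hXY : X < Y := List.rel_of_pairwise_cons h1 (by simp)
    have hYW : Y < W := h2 Y (by simp)
    have c1 : ∀ A B : ℝ, cr (para W 0) (top A) (top B) = W * (A - B) := by
      intro A B; simp [cr]; ring
    have c2 : ∀ A B : ℝ, cr (top A) (top B) (para W 0) = W * (A - B) := by
      intro A B; simp [cr]; ring
    have c3 : ∀ A B : ℝ, cr (top A) (para W 0) (top B) = - (W * (A - B)) := by
      intro A B; simp [cr]; ring
    have c4 : ∀ A B C : ℝ, cr (top A) (top B) (top C) = 0 := by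
      intro A B C; simp [cr]
    -- The feet of the arms are added from right to left. They are collinear, which `Bounds`
    -- permits; corners appear only when the arms are attached.
    have := ih.glue_convexHull (A := []) (x := top X) (a := top W) (b := top W) (by simp) (by simp)
      (by
        rintro v (rfl | rfl | rfl)
        · exact Or.inl rfl
        · exact Or.inr (Or.inl rfl)
        · refine Or.inr (Or.inr ?_); rw [c1]; nlinarith)
      (by rw [c1]; nlinarith)
      (by
        rintro v (rfl | rfl | rfl)
        · unfold cr; ring_nf; rfl
        · rw [c3]; nlinarith
        · rw [c3]; nlinarith)
      (by rw [c3]; nlinarith) (by rw [c3]; nlinarith)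
      (by
        rintro v (rfl | rfl | rfl)
        · rw [c2]; nlinarith
        · rw [c4]
        · rw [c4])
      (by rw [c4]) (by rw [c2]; nlinarith)
    convert this using 1
    · simp
    -- The former corner `top Y` now lies on the upper side between `top X` and `top W`, so it is
    -- redundant in the hull.
    apply Set.Subset.antisymm
    · apply convexHull_mono
      rintro v (rfl | rfl | rfl) <;> simp
    · apply convexHull_min _ (convex_convexHull _ _)
      rintro v (rfl | rfl | rfl | rfl)
      · exact subset_convexHull _ _ (by simp)
      · exact subset_convexHull _ _ (by simp)
      · have hXW : 0 < W - X := by linarith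
        have s1 : top X ∈ convexHull ℝ {para W 0, top X, top W} := subset_convexHull _ _ (by simp)
        have s2 : top W ∈ convexHull ℝ {para W 0, top X, top W} := subset_convexHull _ _ (by simp)
        have := convex_convexHull ℝ {para W 0, top X, top W} s1 s2
          (a := (W - Y) / (W - X)) (b := (Y - X) / (W - X))
          (div_nonneg (by linarith) hXW.le) (div_nonneg (by linarith) hXW.le)
          (by field_simp; ring)
        convert this using 1
        apply plane_ext
        · simp only [PiLp.add_apply, PiLp.smul_apply, smul_eq_mul, top_zero]; field_simp; ring
        · simp only [PiLp.add_apply, PiLp.smul_apply, smul_eq_mul, top_one]; field_simp; ring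
      · exact subset_convexHull _ _ (by simp)

/-- The base of the polygon: a polygon inscribed in a segment of a parabola. -/
def base (W : ℝ) (m j : ℕ) : Set Plane :=
  convexHull ℝ (para W '' ({-1, 1} ∪ {u | ∃ i < j, u = (i : ℝ) / m}))

/-- The first `j` vertices on the parabola. -/
def paraList (W : ℝ) (m j : ℕ) : List Plane :=
  (List.range j).map fun i : ℕ => para W ((i : ℝ) / m)

/-- Starting from the triangle with upper corners `top (-W)`, `top W` and lower corner `para W 0`,
each step cuts the last chord of the parabola, from `j / m` to `1`, at `(j + 1) / m`. Strict
convexity of the parabola makes every added point see that chord alone. The number `m` is free,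
which later fixes the number of vertices of the polygon. -/
lemma bounds_base {W : ℝ} (hW : 0 < W) {Xs : List ℝ} (h1 : (-W :: Xs).Pairwise (· < ·))
    (h2 : ∀ Y ∈ -W :: Xs, Y < W) (m : ℕ) : ∀ j : ℕ, j + 1 ≤ m →
    Bounds (paraList W m (j + 1) ++ top (-W) :: (Xs.map top ++ [top W, para W 0]))
      (base W m (j + 1))
  | 0, hj => by
    have := bounds_top hW Xs (-W) h1 h2
    convert this using 1
    · simp [paraList]
    · unfold base
      congr 1
      ext v
      rw [top_eq_para_left, top_eq_para_right]
      simp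
      aesop
  | j + 1, hj => by
    have ih := bounds_base hW h1 h2 m j (by omega)
    have hm : (0 : ℝ) < m := by exact_mod_cast (by omega : 0 < m)
    have hW2 : 0 < W ^ 2 := by positivity
    have e1 : paraList W m (j + 1) = paraList W m j ++ [para W ((j : ℝ) / m)] := by
      simp [paraList, List.range_succ]
    have e2 : paraList W m (j + 1 + 1) =
        paraList W m j ++ [para W ((j : ℝ) / m), para W (((j + 1 : ℕ) : ℝ) / m)] := by
      simp [paraList, List.range_succ]
    rw [e1, List.append_assoc] at ih
    rw [e2, List.append_assoc]
    have u1 : ((j + 1 : ℕ) : ℝ) / m < 1 := by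
      rw [div_lt_one hm]; exact_mod_cast (by omega : j + 1 < m)
    have u0 : (j : ℝ) / m < ((j + 1 : ℕ) : ℝ) / m := by gcongr; simp
    have u00 : 0 ≤ (j : ℝ) / m := by positivity
    -- the previous vertex on the parabola
    obtain ⟨u', hu', hprev⟩ : ∃ u' : ℝ, u' < (j : ℝ) / m ∧
        ∀ u ∈ ({-1, 1} ∪ {u | ∃ i < j + 1, u = (i : ℝ) / m} : Set ℝ),
          u ≤ u' ∨ (j : ℝ) / m ≤ u := by
      rcases Nat.eq_zero_or_pos j with rfl | hpos
      · refine ⟨-1, by simp, ?_⟩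
        rintro u ((rfl | rfl) | ⟨i, hi, rfl⟩)
        · exact Or.inl le_rfl
        · exact Or.inr (by simp)
        · right
          obtain rfl : i = 0 := by omega
          simp
      · refine ⟨((j - 1 : ℕ) : ℝ) / m, ?_, ?_⟩
        · gcongr; omega
        rintro u ((rfl | rfl) | ⟨i, hi, rfl⟩)
        · left
          have : 0 ≤ ((j - 1 : ℕ) : ℝ) / m := by positivity
          linarith
        · exact Or.inr (by linarith)
        · rcases Nat.lt_or_ge i j with h | h
          · left; gcongr; omega
          · right; gcongr
    have hrange : ∀ u ∈ ({-1, 1} ∪ {u | ∃ i < j + 1, u = (i : ℝ) / m} : Set ℝ),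
        -1 ≤ u ∧ (u = 1 ∨ u ≤ (j : ℝ) / m) := by
      rintro u ((rfl | rfl) | ⟨i, hi, rfl⟩)
      · exact ⟨le_rfl, Or.inr (by linarith)⟩
      · exact ⟨by norm_num, Or.inl rfl⟩
      · refine ⟨?_, Or.inr ?_⟩
        · have : 0 ≤ (i : ℝ) / m := by positivity
          linarith
        · gcongr; omega
    rw [top_eq_para_left] at ih ⊢
    have := Bounds.glue_convexHull (x := para W (((j + 1 : ℕ) : ℝ) / m)) (a := para W u')
      (b := para W (-1)) ih
      (Set.mem_image_of_mem _ (Or.inr ⟨j, by omega, rfl⟩))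
      (Set.mem_image_of_mem _ (Or.inl (by simp)))
      (by
        rintro v ⟨u, hu, rfl⟩
        rcases (hrange u hu).2 with rfl | h
        · exact Or.inr (Or.inl rfl)
        rcases h.eq_or_lt with rfl | h
        · exact Or.inl rfl
        · refine Or.inr (Or.inr ?_)
          rw [cr_para]
          have a1 : 0 < 1 - (j : ℝ) / m := by linarith
          have a2 : 0 < (j : ℝ) / m - u := by linarith
          have a3 : 0 < 1 - u := by linarith
          have := mul_pos hW2 (mul_pos (mul_pos a1 a2) a3)
          linarith)
      (by
        rw [cr_para]
        have a1 : 0 < 1 - (j : ℝ) / m := by linarith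
        have a2 := sub_pos.2 u0
        have a3 := sub_pos.2 u1
        have := mul_pos hW2 (mul_pos (mul_pos a1 a2) a3)
        linarith)
      (by
        rintro v ⟨u, hu, rfl⟩
        rw [cr_para]
        have a0 := sub_pos.2 hu'
        -- No vertex lies strictly between the neighbours `u'` and `j / m`, so the line through them
        -- supports the base.
        have : 0 ≤ (u - u') * (u - (j : ℝ) / m) := by
          rcases hprev u hu with h | h
          · exact mul_nonneg_of_nonpos_of_nonpos (by linarith) (by linarith)
          · exact mul_nonneg (by linarith) (by linarith)
        have := mul_nonneg hW2.le (mul_nonneg a0.le this)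
        linarith)
      (by
        rw [cr_para]
        have a0 := sub_pos.2 hu'
        have a1 := sub_pos.2 u0
        have := mul_pos hW2 (mul_pos (mul_pos a0 (by linarith : 0 < ((j + 1 : ℕ) : ℝ) / m - u')) a1)
        linarith)
      (by
        rw [cr_para]
        have a0 := sub_pos.2 hu'
        have := mul_pos hW2 (mul_pos (mul_pos a0 (by linarith : 0 < 1 - u'))
          (by linarith : 0 < 1 - (j : ℝ) / m))
        linarith)
      (by
        rintro v ⟨u, hu, rfl⟩
        rw [cr_para]
        have hu1 : u ≤ 1 := by
          rcases (hrange u hu).2 with rfl | h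
          · exact le_rfl
          · linarith
        have := mul_nonneg hW2.le (mul_nonneg (mul_nonneg (by norm_num : (0 : ℝ) ≤ 2)
          (sub_nonneg.2 hu1)) (by linarith [(hrange u hu).1] : 0 ≤ u + 1))
        linarith)
      (by
        rw [cr_para]
        have := mul_nonneg hW2.le (mul_nonneg (mul_nonneg (by norm_num : (0 : ℝ) ≤ 2)
          (sub_nonneg.2 u1.le)) (by linarith : 0 ≤ ((j + 1 : ℕ) : ℝ) / m + 1))
        linarith)
      (by
        rw [cr_para]
        have := mul_pos hW2 (mul_pos (mul_pos (by norm_num : (0 : ℝ) < 2)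
          (by linarith : 0 < 1 - (j : ℝ) / m)) (by linarith : 0 < (j : ℝ) / m + 1))
        linarith)
    convert this using 1
    · simp
    unfold base
    rw [← Set.image_insert_eq]
    congr 2
    ext u
    simp only [Set.mem_union, Set.mem_insert_iff, Set.mem_singleton_iff, Set.mem_ofPred_eq]
    constructor
    · rintro (h | ⟨i, hi, rfl⟩)
      · exact Or.inr (Or.inl h)
      · rcases Nat.lt_or_ge i (j + 1) with h | h
        · exact Or.inr (Or.inr ⟨i, h, rfl⟩)
        · left
          rw [show i = j + 1 by omega]
    · rintro (rfl | h | ⟨i, hi, rfl⟩)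
      · exact Or.inr ⟨j + 1, by omega, rfl⟩
      · exact Or.inl h
      · exact Or.inr ⟨i, by omega, rfl⟩

/-! ### Geometry of one cell of a corridor -/

section

/-- Neighbouring points of the integer grid. -/
def Adj (u v : ℤ × ℤ) : Prop :=
  (v.1 = u.1 + 1 ∧ v.2 = u.2) ∨ (v.1 = u.1 - 1 ∧ v.2 = u.2) ∨
  (v.1 = u.1 ∧ v.2 = u.2 + 1) ∨ (v.1 = u.1 ∧ v.2 = u.2 - 1)

/-- The point at offset `w` to the left of the midpoint of the grid edge from `u` to `v`. -/
def post (u v : ℤ × ℤ) (w : ℝ) : Plane :=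
  !₂[((u.1 : ℝ) + v.1) / 2 - w * ((v.2 : ℝ) - u.2), ((u.2 : ℝ) + v.2) / 2 + w * ((v.1 : ℝ) - u.1)]

@[simp] lemma post_zero (u v : ℤ × ℤ) (w : ℝ) :
    post u v w 0 = ((u.1 : ℝ) + v.1) / 2 - w * ((v.2 : ℝ) - u.2) := rfl
@[simp] lemma post_one (u v : ℤ × ℤ) (w : ℝ) :
    post u v w 1 = ((u.2 : ℝ) + v.2) / 2 + w * ((v.1 : ℝ) - u.1) := rfl

lemma Adj.cast {u v : ℤ × ℤ} (h : Adj u v) :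
    ((v.1 : ℝ) = u.1 + 1 ∧ (v.2 : ℝ) = u.2) ∨ ((v.1 : ℝ) = u.1 - 1 ∧ (v.2 : ℝ) = u.2) ∨
    ((v.1 : ℝ) = u.1 ∧ (v.2 : ℝ) = u.2 + 1) ∨ ((v.1 : ℝ) = u.1 ∧ (v.2 : ℝ) = u.2 - 1) := by
  rcases h with ⟨h1, h2⟩ | ⟨h1, h2⟩ | ⟨h1, h2⟩ | ⟨h1, h2⟩ <;> rw [h1, h2] <;> push_cast <;> simp

/-- The directions of two consecutive steps of a path that does not turn back. -/
lemma Adj.steps {a b c : ℤ × ℤ} (hab : Adj a b) (hbc : Adj b c) (hac : a ≠ c) :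
    ∃ d e d' e' : ℝ, (a.1 : ℝ) = b.1 - d ∧ (a.2 : ℝ) = b.2 - e ∧ (c.1 : ℝ) = b.1 + d' ∧
      (c.2 : ℝ) = b.2 + e' ∧
      ((d = 1 ∧ e = 0) ∨ (d = -1 ∧ e = 0) ∨ (d = 0 ∧ e = 1) ∨ (d = 0 ∧ e = -1)) ∧
      ((d' = d ∧ e' = e) ∨ (d' = -e ∧ e' = d) ∨ (d' = e ∧ e' = -d)) := by
  refine ⟨(b.1 : ℝ) - a.1, (b.2 : ℝ) - a.2, (c.1 : ℝ) - b.1, (c.2 : ℝ) - b.2, by ring, by ring,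
    by ring, by ring, ?_⟩
  have hac' : ¬ (a.1 = c.1 ∧ a.2 = c.2) := fun h => hac (Prod.ext h.1 h.2)
  rcases hab with ⟨h1, h2⟩ | ⟨h1, h2⟩ | ⟨h1, h2⟩ | ⟨h1, h2⟩ <;>
  rcases hbc with ⟨h3, h4⟩ | ⟨h3, h4⟩ | ⟨h3, h4⟩ | ⟨h3, h4⟩ <;>
  first
  | (exfalso; omega)
  | (rw [h3, h4, h1, h2]; push_cast; norm_num)

lemma sq_add_sq_of_unit {d e : ℝ}
    (h : (d = 1 ∧ e = 0) ∨ (d = -1 ∧ e = 0) ∨ (d = 0 ∧ e = 1) ∨ (d = 0 ∧ e = -1)) :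
    d ^ 2 + e ^ 2 = 1 := by
  rcases h with ⟨rfl, rfl⟩ | ⟨rfl, rfl⟩ | ⟨rfl, rfl⟩ | ⟨rfl, rfl⟩ <;> norm_num

lemma le_of_sq_le {a b : ℝ} (h : a ^ 2 ≤ b ^ 2) (hb : 0 ≤ b) : a ≤ b :=
  (le_abs_self a).trans (abs_le_of_sq_le_sq h hb)

/-- Admissible pairs of half-widths of consecutive doors. -/
def Widths (w w' : ℝ) : Prop := (w = 1 / 32 ∧ w' = 1 / 16) ∨ (w = 1 / 16 ∧ w' = 1 / 32)

lemma Widths.bounds {w w' : ℝ} (h : Widths w w') : 1 / 32 ≤ w ∧ w ≤ 1 / 16 ∧ 1 / 32 ≤ w' ∧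
    w' ≤ 1 / 16 := by
  rcases h with ⟨rfl, rfl⟩ | ⟨rfl, rfl⟩ <;> norm_num

/-- The segment between the posts of a grid edge. -/
def door (u v : ℤ × ℤ) (w : ℝ) : Set Plane := segment ℝ (post u v w) (post u v (-w))

lemma mem_door {u v : ℤ × ℤ} {w : ℝ} (hw : 0 ≤ w) {z : Plane} (hz : z ∈ door u v w) :
    ∃ t, -w ≤ t ∧ t ≤ w ∧ z = post u v t := by
  obtain ⟨s, t, hs, ht, hst, rfl⟩ := hz
  obtain rfl : t = 1 - s := by linarith
  refine ⟨s * w - (1 - s) * w, by nlinarith, by nlinarith, ?_⟩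
  apply plane_ext <;> simp only [PiLp.add_apply, PiLp.smul_apply, smul_eq_mul, post_zero, post_one]
    <;> ring

section cell

variable {a b c : ℤ × ℤ} {w w' : ℝ}

/-- The two triangles of a cell are clockwise with area bounded below, whether the path goes
straight or turns. The sign places them on opposite sides of the diagonal; the uniform bound feeds
the fatness estimate. -/
lemma cr_first (hab : Adj a b) (hbc : Adj b c) (hac : a ≠ c) (hw : Widths w w') :
    cr (post a b w) (post b c w') (post a b (-w)) ≤ -(1 / 40) := by
  obtain ⟨d, e, d', e', h1, h2, h3, h4, hu, h⟩ := hab.steps hbc hac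
  have hde := sq_add_sq_of_unit hu
  simp only [cr, post_zero, post_one, h1, h2, h3, h4]
  rcases hw with ⟨rfl, rfl⟩ | ⟨rfl, rfl⟩ <;>
  rcases h with ⟨rfl, rfl⟩ | ⟨rfl, rfl⟩ | ⟨rfl, rfl⟩ <;> linarith

lemma cr_second (hab : Adj a b) (hbc : Adj b c) (hac : a ≠ c) (hw : Widths w w') :
    cr (post b c w') (post b c (-w')) (post a b (-w)) ≤ -(1 / 40) := by
  obtain ⟨d, e, d', e', h1, h2, h3, h4, hu, h⟩ := hab.steps hbc hac
  have hde := sq_add_sq_of_unit hu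
  simp only [cr, post_zero, post_one, h1, h2, h3, h4]
  rcases hw with ⟨rfl, rfl⟩ | ⟨rfl, rfl⟩ <;>
  rcases h with ⟨rfl, rfl⟩ | ⟨rfl, rfl⟩ | ⟨rfl, rfl⟩ <;> linarith

/-- Needed only at the tip of an arm, where the boundary goes from the left posts over to the last
right post. -/
lemma cr_third (hab : Adj a b) (hbc : Adj b c) (hac : a ≠ c) (hw : Widths w w') :
    cr (post a b w) (post b c w') (post b c (-w')) ≠ 0 := by
  obtain ⟨d, e, d', e', h1, h2, h3, h4, hu, h⟩ := hab.steps hbc hac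
  have hde := sq_add_sq_of_unit hu
  simp only [cr, post_zero, post_one, h1, h2, h3, h4]
  intro h0
  rcases hw with ⟨rfl, rfl⟩ | ⟨rfl, rfl⟩ <;>
  rcases h with ⟨rfl, rfl⟩ | ⟨rfl, rfl⟩ | ⟨rfl, rfl⟩ <;> linarith

/-- Consecutive posts on one side of the path are not collinear. -/
lemma cr_posts {a₀ : ℤ × ℤ} (h0a : Adj a₀ a) (hab : Adj a b) (hbc : Adj b c) (h0b : a₀ ≠ b)
    (hac : a ≠ c) (hw : Widths w w') :
    cr (post a₀ a w) (post a b w') (post b c w) ≠ 0 ∧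
    cr (post a₀ a (-w)) (post a b (-w')) (post b c (-w)) ≠ 0 := by
  obtain ⟨d, e, d', e', h1, h2, h3, h4, hu, h⟩ := hab.steps hbc hac
  obtain ⟨d₀, e₀, d₁, e₁, g1, g2, g3, g4, gu, g⟩ := h0a.steps hab h0b
  have k1 : d = d₁ := by linarith
  have k2 : e = e₁ := by linarith
  subst k1 k2
  have k3 : (b.1 : ℝ) = a.1 + d := by linarith
  have k4 : (b.2 : ℝ) = a.2 + e := by linarith
  have hde := sq_add_sq_of_unit gu
  simp only [cr, post_zero, post_one, g1, g2, h3, h4, k3, k4]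
  -- On a straight stretch the determinant is a multiple of `w - w'`; this is the reason for
  -- alternating widths.
  rcases hw with ⟨rfl, rfl⟩ | ⟨rfl, rfl⟩ <;>
  rcases h with ⟨rfl, rfl⟩ | ⟨rfl, rfl⟩ | ⟨rfl, rfl⟩ <;>
  rcases g with ⟨rfl, rfl⟩ | ⟨rfl, rfl⟩ | ⟨rfl, rfl⟩ <;>
  constructor <;> intro h0 <;> linarith

/-- The open unit square around a grid point. -/
def box (b : ℤ × ℤ) : Set Plane := {z | |z 0 - b.1| < 1 / 2 ∧ |z 1 - b.2| < 1 / 2}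

/-- A proper convex combination of points on two different doors lies strictly inside the unit
square around `b`. Cells around different grid points can thus meet only in doors. -/
lemma hull_subset_box (hab : Adj a b) (hbc : Adj b c) (hac : a ≠ c) (hw : Widths w w') :
    convexHull ℝ {post a b w, post a b (-w), post b c w', post b c (-w')} ⊆
      box b ∪ door a b w ∪ door b c w' := by
  obtain ⟨hw1, hw2, hw3, hw4⟩ := hw.bounds
  obtain ⟨d, e, d', e', h1, h2, h3, h4, hu, h⟩ := hab.steps hbc hac
  rw [← convexJoin_segments]
  intro z hz
  rw [mem_convexJoin] at hz
  obtain ⟨u, hum, v, hv, s, t, hs, ht, hst, rfl⟩ := hz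
  rcases hs.eq_or_lt with rfl | hs
  · obtain rfl : t = 1 := by linarith
    right
    simpa [door] using hv
  rcases ht.eq_or_lt with rfl | ht
  · obtain rfl : s = 1 := by linarith
    left; right
    simpa [door] using hum
  left; left
  obtain ⟨x, hx1, hx2, rfl⟩ := mem_door (by linarith) hum
  obtain ⟨y, hy1, hy2, rfl⟩ := mem_door (by linarith) hv
  obtain rfl : t = 1 - s := by linarith
  have f1 : s * x ≤ s * (1 / 16) := by gcongr; linarith
  have f2 : s * (-(1 / 16)) ≤ s * x := by gcongr; linarith
  have f3 : (1 - s) * y ≤ (1 - s) * (1 / 16) := by gcongr; linarith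
  have f4 : (1 - s) * (-(1 / 16)) ≤ (1 - s) * y := by gcongr; linarith
  simp only [box, Set.mem_ofPred_eq, PiLp.add_apply, PiLp.smul_apply, smul_eq_mul, post_zero,
    post_one, h1, h2, h3, h4, abs_lt]
  rcases hu with ⟨rfl, rfl⟩ | ⟨rfl, rfl⟩ | ⟨rfl, rfl⟩ | ⟨rfl, rfl⟩ <;>
  rcases h with ⟨rfl, rfl⟩ | ⟨rfl, rfl⟩ | ⟨rfl, rfl⟩ <;>
  refine ⟨⟨?_, ?_⟩, ?_, ?_⟩ <;> linarith

lemma dist_sq (x y : Plane) : dist x y ^ 2 = (x 0 - y 0) ^ 2 + (x 1 - y 1) ^ 2 := by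
  rw [EuclideanSpace.dist_eq, Real.sq_sqrt (by positivity), Fin.sum_univ_two, Real.dist_eq,
    Real.dist_eq, sq_abs, sq_abs]

lemma abs_coord_le (x y : Plane) : |x 0 - y 0| ≤ dist x y ∧ |x 1 - y 1| ≤ dist x y := by
  have := dist_sq x y
  constructor <;> apply abs_le_of_sq_le_sq _ dist_nonneg <;> nlinarith [sq_nonneg (x 0 - y 0),
    sq_nonneg (x 1 - y 1)]

lemma dist_le_of_abs {x y : Plane} {r s : ℝ} (h0 : |x 0 - y 0| ≤ r) (h1 : |x 1 - y 1| ≤ s) :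
    dist x y ≤ r + s := by
  have hr := (abs_nonneg _).trans h0
  have hs := (abs_nonneg _).trans h1
  refine le_of_sq_le ?_ (by linarith)
  rw [dist_sq, ← sq_abs (x 0 - y 0), ← sq_abs (x 1 - y 1)]
  nlinarith [abs_nonneg (x 0 - y 0), abs_nonneg (x 1 - y 1)]

/-- The worst case is a turn, where both coordinates differ by at least `1 / 2 - 1 / 16`. Together
with the bound `21 / 20` of `post_dist` it matters that `21 / 20 < 2 * (3 / 5)`: the upper bound for
the length of an arm is less than twice the lower one. -/
lemma door_dist (hab : Adj a b) (hbc : Adj b c) (hac : a ≠ c) (hw : Widths w w') {x y : Plane}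
    (hx : x ∈ door a b w) (hy : y ∈ door b c w') : 3 / 5 ≤ dist x y := by
  obtain ⟨hw1, hw2, hw3, hw4⟩ := hw.bounds
  obtain ⟨d, e, d', e', h1, h2, h3, h4, hu, h⟩ := hab.steps hbc hac
  obtain ⟨s, hx1, hx2, rfl⟩ := mem_door (by linarith) hx
  obtain ⟨t, hy1, hy2, rfl⟩ := mem_door (by linarith) hy
  refine le_of_sq_le ?_ dist_nonneg
  rw [dist_sq]
  simp only [post_zero, post_one, h1, h2, h3, h4]
  rcases hu with ⟨rfl, rfl⟩ | ⟨rfl, rfl⟩ | ⟨rfl, rfl⟩ | ⟨rfl, rfl⟩ <;>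
  rcases h with ⟨rfl, rfl⟩ | ⟨rfl, rfl⟩ | ⟨rfl, rfl⟩ <;> nlinarith [sq_nonneg (s - t), sq_nonneg (s + t)]

lemma post_dist (hab : Adj a b) (hbc : Adj b c) (hac : a ≠ c) (hw : Widths w w') :
    dist (post a b w) (post b c w') ≤ 21 / 20 := by
  obtain ⟨d, e, d', e', h1, h2, h3, h4, hu, h⟩ := hab.steps hbc hac
  refine le_of_sq_le ?_ (by norm_num)
  rw [dist_sq]
  simp only [post_zero, post_one, h1, h2, h3, h4]
  rcases hw with ⟨rfl, rfl⟩ | ⟨rfl, rfl⟩ <;>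
  rcases hu with ⟨rfl, rfl⟩ | ⟨rfl, rfl⟩ | ⟨rfl, rfl⟩ | ⟨rfl, rfl⟩ <;>
  rcases h with ⟨rfl, rfl⟩ | ⟨rfl, rfl⟩ | ⟨rfl, rfl⟩ <;> linarith

end cell

end

/-! ### Arms as chains of cells along disjoint grid paths -/

section

/-- The alternating half-widths of the doors. -/
def wd (i : ℕ) : ℝ := if i % 2 = 0 then 1 / 32 else 1 / 16

lemma widths_wd (i : ℕ) : Widths (wd i) (wd (i + 1)) := by
  unfold wd Widths
  rcases Nat.mod_two_eq_zero_or_one i with h | h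
  · left; rw [if_pos h, if_neg (by omega)]; simp
  · right; rw [if_neg (by omega), if_pos (by omega)]; simp

lemma wd_bounds (i : ℕ) : 1 / 32 ≤ wd i ∧ wd i ≤ 1 / 16 :=
  ⟨(widths_wd i).bounds.1, (widths_wd i).bounds.2.1⟩

/-- Left and right posts of the `i`-th door of a grid path. -/
def L (c : ℕ → ℤ × ℤ) (i : ℕ) : Plane := post (c i) (c (i + 1)) (wd i)
def R (c : ℕ → ℤ × ℤ) (i : ℕ) : Plane := post (c i) (c (i + 1)) (-wd i)

/-- The two triangles that join the doors `i` and `i + 1`. -/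
def triL (c : ℕ → ℤ × ℤ) (i : ℕ) : Set Plane := tri (L c i) (L c (i + 1)) (R c i)
def triR (c : ℕ → ℤ × ℤ) (i : ℕ) : Set Plane := tri (L c (i + 1)) (R c (i + 1)) (R c i)

/-- The cell between the doors `i` and `i + 1`. -/
def strip (c : ℕ → ℤ × ℤ) (i : ℕ) : Set Plane := triL c i ∪ triR c i

/-- The segment between the posts of the `i`-th door. -/
def gate (c : ℕ → ℤ × ℤ) (i : ℕ) : Set Plane := segment ℝ (L c i) (R c i)

/-- A family of `k` disjoint grid paths that start at the lower boundary of the upper half plane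
and whose first `N + 1` steps are used. -/
structure Paths (k N : ℕ) (C : ℕ → ℕ → ℤ × ℤ) : Prop where
  adj : ∀ a < k, ∀ i ≤ N, Adj (C a i) (C a (i + 1))
  inj : ∀ a < k, ∀ b < k, ∀ i ≤ N + 1, ∀ j ≤ N + 1, C a i = C b j → a = b ∧ i = j
  zero : ∀ a < k, (C a 0).2 = -1
  one : ∀ a < k, C a 1 = ((C a 0).1, 0)
  nonneg : ∀ a < k, ∀ i ≤ N + 1, 1 ≤ i → 0 ≤ (C a i).2

variable {k N : ℕ} {C : ℕ → ℕ → ℤ × ℤ}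

lemma Paths.ne (hC : Paths k N C) {a : ℕ} (ha : a < k) {i : ℕ} (hi : i < N) :
    C a i ≠ C a (i + 2) := fun h => by
  have := (hC.inj a ha a ha i (by omega) (i + 2) (by omega) h).2
  omega

lemma Paths.cr_triL (hC : Paths k N C) {a : ℕ} (ha : a < k) {i : ℕ} (hi : i < N) :
    cr (L (C a) i) (L (C a) (i + 1)) (R (C a) i) ≤ -(1 / 40) :=
  cr_first (hC.adj a ha i hi.le) (hC.adj a ha (i + 1) hi) (hC.ne ha hi) (widths_wd i)

lemma Paths.cr_triR (hC : Paths k N C) {a : ℕ} (ha : a < k) {i : ℕ} (hi : i < N) :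
    cr (L (C a) (i + 1)) (R (C a) (i + 1)) (R (C a) i) ≤ -(1 / 40) :=
  cr_second (hC.adj a ha i hi.le) (hC.adj a ha (i + 1) hi) (hC.ne ha hi) (widths_wd i)

lemma Paths.strip_subset (hC : Paths k N C) {a : ℕ} (ha : a < k) {i : ℕ} (hi : i < N) :
    strip (C a) i ⊆ box (C a (i + 1)) ∪ gate (C a) i ∪ gate (C a) (i + 1) := by
  refine Set.Subset.trans ?_ (hull_subset_box (hC.adj a ha i hi.le) (hC.adj a ha (i + 1) hi)
    (hC.ne ha hi) (widths_wd i))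
  refine Set.union_subset (convexHull_mono ?_) (convexHull_mono ?_)
  · rintro v (rfl | rfl | rfl)
    · exact Or.inl rfl
    · exact Or.inr (Or.inr (Or.inl rfl))
    · exact Or.inr (Or.inl rfl)
  · rintro v (rfl | rfl | rfl)
    · exact Or.inr (Or.inr (Or.inl rfl))
    · exact Or.inr (Or.inr (Or.inr rfl))
    · exact Or.inr (Or.inl rfl)

lemma gate_subset_triL (c : ℕ → ℤ × ℤ) (i : ℕ) : gate c i ⊆ triL c i :=
  segment_left_right_subset_tri _ _ _

lemma gate_subset_triR (c : ℕ → ℤ × ℤ) (i : ℕ) : gate c (i + 1) ⊆ triR c i :=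
  segment_left_mid_subset_tri _ _ _

lemma Paths.triL_inter_triR (hC : Paths k N C) {a : ℕ} (ha : a < k) {i : ℕ} (hi : i < N) :
    triL (C a) i ∩ triR (C a) i = segment ℝ (L (C a) (i + 1)) (R (C a) i) := by
  have h1 := hC.cr_triL ha hi
  have h2 := hC.cr_triR ha hi
  rw [← cr_rot] at h1
  rw [cr_swap_right] at h2
  apply Set.Subset.antisymm
  · rintro z ⟨hz1, hz2⟩
    have e0 : ∀ p q : Plane, cr p q p = 0 ∧ cr p q q = 0 := by
      intro p q; constructor <;> unfold cr <;> ring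
    refine mem_segment_of_mem_convexHull (S := {L (C a) i, L (C a) (i + 1), R (C a) i}) ?_ hz1 ?_
    · rintro v (rfl | rfl | rfl)
      · exact Or.inr (Or.inr (by linarith))
      · exact Or.inl rfl
      · exact Or.inr (Or.inl rfl)
    · apply le_antisymm
      · refine cr_nonpos_of_mem_convexHull ?_ z hz1
        rintro v (rfl | rfl | rfl)
        · linarith
        · exact (e0 _ _).1.le
        · exact (e0 _ _).2.le
      · have : cr (R (C a) i) (L (C a) (i + 1)) z ≤ 0 := by
          refine cr_nonpos_of_mem_convexHull ?_ z hz2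
          rintro v (rfl | rfl | rfl)
          · exact (e0 _ _).2.le
          · rw [cr_swap_left]; linarith
          · exact (e0 _ _).1.le
        rw [cr_swap_left] at this
        linarith
  · exact Set.subset_inter (segment_mid_right_subset_tri _ _ _) (segment_left_right_subset_tri _ _ _)

lemma mem_gate {c : ℕ → ℤ × ℤ} {i : ℕ} {z : Plane} (hz : z ∈ gate c i) :
    ∃ t, |t| ≤ 1 / 16 ∧ z = post (c i) (c (i + 1)) t := by
  have hw := wd_bounds i
  obtain ⟨t, h1, h2, h3⟩ := mem_door (by linarith) hz
  exact ⟨t, abs_le.2 ⟨by linarith, by linarith⟩, h3⟩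

/-- Points of a gate are close to the midpoint of the grid edge. -/
lemma abs_sub_of_mem_gate {c : ℕ → ℤ × ℤ} {i : ℕ} (h : Adj (c i) (c (i + 1))) {z : Plane}
    (hz : z ∈ gate c i) :
    |z 0 - ((c i).1 + (c (i + 1)).1 : ℤ) / 2| ≤ 1 / 16 ∧
    |z 1 - ((c i).2 + (c (i + 1)).2 : ℤ) / 2| ≤ 1 / 16 := by
  obtain ⟨t, ht, rfl⟩ := mem_gate hz
  rw [post_zero, post_one]
  push_cast
  rcases h.cast with ⟨h1, h2⟩ | ⟨h1, h2⟩ | ⟨h1, h2⟩ | ⟨h1, h2⟩ <;> rw [h1, h2] <;>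
    ring_nf <;> simp only [abs_neg, abs_zero] <;> constructor <;> linarith

/-- Half-integers are `1 / 2` apart, so a point of a gate determines the midpoint of its grid edge,
and hence the unoriented edge. -/
lemma eq_of_abs_sub_half {x y : ℤ} {z : ℝ} (h1 : |z - (x : ℝ) / 2| ≤ 1 / 16)
    (h2 : |z - (y : ℝ) / 2| ≤ 1 / 16) : x = y := by
  rw [abs_le] at h1 h2
  have a : (x : ℝ) < y + 1 := by linarith
  have b : (y : ℝ) < x + 1 := by linarith
  have a' : x < y + 1 := by exact_mod_cast a
  have b' : y < x + 1 := by exact_mod_cast b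
  omega

lemma Adj.eq_of_add_eq {u v u' v' : ℤ × ℤ} (h : Adj u v) (h' : Adj u' v')
    (h1 : u.1 + v.1 = u'.1 + v'.1) (h2 : u.2 + v.2 = u'.2 + v'.2) :
    (u = u' ∧ v = v') ∨ (u = v' ∧ v = u') := by
  simp only [Prod.ext_iff]
  rcases h with ⟨a, b⟩ | ⟨a, b⟩ | ⟨a, b⟩ | ⟨a, b⟩ <;>
  rcases h' with ⟨a', b'⟩ | ⟨a', b'⟩ | ⟨a', b'⟩ | ⟨a', b'⟩ <;> omega

/-- Different gates are disjoint. -/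
lemma Paths.eq_of_mem_gate (hC : Paths k N C) {a b : ℕ} (ha : a < k) (hb : b < k) {i j : ℕ}
    (hi : i ≤ N) (hj : j ≤ N) {z : Plane} (h1 : z ∈ gate (C a) i) (h2 : z ∈ gate (C b) j) :
    a = b ∧ i = j := by
  obtain ⟨p1, p2⟩ := abs_sub_of_mem_gate (hC.adj a ha i hi) h1
  obtain ⟨q1, q2⟩ := abs_sub_of_mem_gate (hC.adj b hb j hj) h2
  rcases (hC.adj a ha i hi).eq_of_add_eq (hC.adj b hb j hj) (eq_of_abs_sub_half p1 q1)
    (eq_of_abs_sub_half p2 q2) with ⟨h, -⟩ | ⟨h, h'⟩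
  · exact hC.inj a ha b hb i (by omega) j (by omega) h
  · have e1 := hC.inj a ha b hb i (by omega) (j + 1) (by omega) h
    have e2 := hC.inj a ha b hb (i + 1) (by omega) j (by omega) h'
    omega

/-- A gate lies on a line where one coordinate is a half-integer, and such lines avoid the open unit
squares around grid points. -/
lemma gate_not_mem_box {c : ℕ → ℤ × ℤ} {i : ℕ} (h : Adj (c i) (c (i + 1))) {z : Plane}
    (hz : z ∈ gate c i) (b : ℤ × ℤ) : z ∉ box b := by
  obtain ⟨t, ht, rfl⟩ := mem_gate hz
  rintro ⟨h1, h2⟩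
  rw [post_zero] at h1
  rw [post_one] at h2
  rw [abs_lt] at h1 h2
  rcases h.cast with ⟨e1, e2⟩ | ⟨e1, e2⟩ | ⟨e1, e2⟩ | ⟨e1, e2⟩ <;> rw [e1, e2] at h1 h2
  · have a1 : ((c i).1 : ℝ) < b.1 := by linarith
    have a2 : (b.1 : ℝ) < (c i).1 + 1 := by linarith
    have a1' : (c i).1 < b.1 := by exact_mod_cast a1
    have a2' : b.1 < (c i).1 + 1 := by exact_mod_cast a2
    omega
  · have a1 : ((c i).1 : ℝ) - 1 < b.1 := by linarith
    have a2 : (b.1 : ℝ) < (c i).1 := by linarith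
    have a1' : (c i).1 - 1 < b.1 := by exact_mod_cast a1
    have a2' : b.1 < (c i).1 := by exact_mod_cast a2
    omega
  · have a1 : ((c i).2 : ℝ) < b.2 := by linarith
    have a2 : (b.2 : ℝ) < (c i).2 + 1 := by linarith
    have a1' : (c i).2 < b.2 := by exact_mod_cast a1
    have a2' : b.2 < (c i).2 + 1 := by exact_mod_cast a2
    omega
  · have a1 : ((c i).2 : ℝ) - 1 < b.2 := by linarith
    have a2 : (b.2 : ℝ) < (c i).2 := by linarith
    have a1' : (c i).2 - 1 < b.2 := by exact_mod_cast a1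
    have a2' : b.2 < (c i).2 := by exact_mod_cast a2
    omega

lemma box_disjoint {b b' : ℤ × ℤ} {z : Plane} (h : z ∈ box b) (h' : z ∈ box b') : b = b' := by
  obtain ⟨h1, h2⟩ := h
  obtain ⟨h3, h4⟩ := h'
  rw [abs_lt] at h1 h2 h3 h4
  have a1 : (b.1 : ℝ) < b'.1 + 1 := by linarith
  have a2 : (b'.1 : ℝ) < b.1 + 1 := by linarith
  have a3 : (b.2 : ℝ) < b'.2 + 1 := by linarith
  have a4 : (b'.2 : ℝ) < b.2 + 1 := by linarith
  have b1 : b.1 < b'.1 + 1 := by exact_mod_cast a1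
  have b2 : b'.1 < b.1 + 1 := by exact_mod_cast a2
  have b3 : b.2 < b'.2 + 1 := by exact_mod_cast a3
  have b4 : b'.2 < b.2 + 1 := by exact_mod_cast a4
  ext <;> omega

/-- Two different cells meet at most in a common gate. -/
lemma Paths.strip_inter_strip (hC : Paths k N C) {a b : ℕ} (ha : a < k) (hb : b < k) {i j : ℕ}
    (hi : i < N) (hj : j < N) (hne : ¬ (a = b ∧ i = j)) {z : Plane} (h1 : z ∈ strip (C a) i)
    (h2 : z ∈ strip (C b) j) :
    a = b ∧ ((j + 1 = i ∧ z ∈ gate (C a) i) ∨ (i + 1 = j ∧ z ∈ gate (C b) j)) := by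
  have g : ∀ (a) (_ : a < k) (i) (_ : i ≤ N) (b), z ∈ gate (C a) i → z ∉ box b :=
    fun a ha i hi b hz => gate_not_mem_box (hC.adj a ha i hi) hz b
  rcases hC.strip_subset ha hi h1 with (h1 | h1) | h1 <;>
  rcases hC.strip_subset hb hj h2 with (h2 | h2) | h2
  · have := hC.inj a ha b hb (i + 1) (by omega) (j + 1) (by omega) (box_disjoint h1 h2)
    omega
  · exact absurd h1 (g b hb _ hj.le _ h2)
  · exact absurd h1 (g b hb _ hj _ h2)
  · exact absurd h2 (g a ha _ hi.le _ h1)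
  · have := hC.eq_of_mem_gate ha hb hi.le hj.le h1 h2
    exact absurd this hne
  · have := hC.eq_of_mem_gate ha hb hi.le hj h1 h2
    exact ⟨this.1, Or.inl ⟨this.2.symm, h1⟩⟩
  · exact absurd h2 (g a ha _ hi _ h1)
  · have := hC.eq_of_mem_gate ha hb hi hj.le h1 h2
    exact ⟨this.1, Or.inr ⟨this.2, h2⟩⟩
  · have := hC.eq_of_mem_gate ha hb hi hj h1 h2
    omega

/-- A cell meets the lower half plane at most in the first gate. -/
lemma Paths.strip_inter_lower (hC : Paths k N C) {a : ℕ} (ha : a < k) {i : ℕ} (hi : i < N)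
    {z : Plane} (hz : z ∈ strip (C a) i) (hz1 : z 1 ≤ -1 / 2) : i = 0 ∧ z ∈ gate (C a) 0 := by
  have key : ∀ j ≤ N, z ∈ gate (C a) j → j = 0 := by
    intro j hj hzj
    by_contra hne
    have h1 := (abs_le.1 (abs_sub_of_mem_gate (hC.adj a ha j hj) hzj).2).1
    have h2 := hC.nonneg a ha j (by omega) (by omega)
    have h3 := hC.nonneg a ha (j + 1) (by omega) (by omega)
    have : (0 : ℝ) ≤ ((C a j).2 + (C a (j + 1)).2 : ℤ) := by exact_mod_cast add_nonneg h2 h3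
    linarith
  rcases hC.strip_subset ha hi hz with (h | h) | h
  · have h1 := (abs_lt.1 h.2).1
    have h2 : (0 : ℝ) ≤ (C a (i + 1)).2 := by
      exact_mod_cast hC.nonneg a ha (i + 1) (by omega) (by omega)
    linarith
  · obtain rfl := key i hi.le h
    exact ⟨rfl, h⟩
  · have := key (i + 1) hi h
    omega

/-- The vertices along an arm with `n` cells. -/
def armList (c : ℕ → ℤ × ℤ) (n : ℕ) : List Plane :=
  (List.range (n + 1)).map (L c) ++ ((List.range (n + 1)).map (R c)).reverse

/-- An arm with `n` cells. -/
def arm (c : ℕ → ℤ × ℤ) (n : ℕ) : Set Plane := {z | ∃ i < n, z ∈ strip c i}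

lemma armList_eq (c : ℕ → ℤ × ℤ) (n : ℕ) : armList c n =
    (List.range n).map (L c) ++ L c n :: R c n :: ((List.range n).map (R c)).reverse := by
  simp [armList, List.range_succ]

lemma armList_succ (c : ℕ → ℤ × ℤ) (n : ℕ) : armList c (n + 1) =
    (List.range n).map (L c) ++ L c n :: L c (n + 1) :: R c (n + 1) :: R c n ::
      ((List.range n).map (R c)).reverse := by
  simp [armList, List.range_succ]

lemma arm_succ (c : ℕ → ℤ × ℤ) (n : ℕ) : arm c (n + 1) = arm c n ∪ strip c n := by
  ext z
  simp only [arm, Set.mem_ofPred_eq, Set.mem_union]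
  constructor
  · rintro ⟨i, hi, hz⟩
    rcases Nat.lt_succ_iff_lt_or_eq.1 hi with h | rfl
    · exact Or.inl ⟨i, h, hz⟩
    · exact Or.inr hz
  · rintro (⟨i, hi, hz⟩ | hz)
    · exact ⟨i, by omega, hz⟩
    · exact ⟨n, by omega, hz⟩

/-- Gluing an arm onto a door. -/
lemma Paths.bounds_arm (hC : Paths k N C) {a : ℕ} (ha : a < k) {A B : List Plane} {K : Set Plane}
    (hB : Bounds (A ++ L (C a) 0 :: R (C a) 0 :: B) K)
    (hK : ∀ i < N, ∀ z ∈ strip (C a) i, z ∈ K → i = 0 ∧ z ∈ gate (C a) 0) :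
    ∀ n ≤ N, Bounds (A ++ armList (C a) n ++ B) (K ∪ arm (C a) n)
  | 0, _ => by
    have : arm (C a) 0 = ∅ := by simp [arm]
    simpa [armList, this] using hB
  | n + 1, hn => by
    have ih := hC.bounds_arm ha hB hK n (by omega)
    have hi : n < N := hn
    have c1 := hC.cr_triL ha hi
    have c2 := hC.cr_triR ha hi
    have eq1 : A ++ armList (C a) n ++ B = (A ++ (List.range n).map (L (C a))) ++
        L (C a) n :: R (C a) n :: (((List.range n).map (R (C a))).reverse ++ B) := by
      rw [armList_eq]; simp
    rw [eq1] at ih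
    have hgate : gate (C a) n ⊆ K ∪ arm (C a) n := by
      refine ih.seg_subset (e := (L (C a) n, R (C a) n)) ?_
      rw [pairs_append]; simp [pairs]
    have inter : ∀ z ∈ strip (C a) n, z ∈ K ∪ arm (C a) n → z ∈ gate (C a) n := by
      rintro z hz (hzK | ⟨j, hj, hzj⟩)
      · obtain ⟨rfl, h⟩ := hK n hi z hz hzK
        exact h
      · rcases (hC.strip_inter_strip ha ha hi (by omega) (by omega) hz hzj).2 with h | h
        · exact h.2
        · omega
    -- A cell is added by two gluings: the first triangle onto the last gate, the second onto the
    -- diagonal that the first has created.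
    have g1 := ih.glue (x := L (C a) (n + 1)) (by linarith) (by
      apply Set.Subset.antisymm
      · rintro z ⟨hz, hzK⟩
        exact inter z (Or.inl hz) hzK
      · exact Set.subset_inter (segment_left_right_subset_tri _ _ _) hgate)
    have eq2 : (A ++ (List.range n).map (L (C a))) ++ L (C a) n :: L (C a) (n + 1) ::
        R (C a) n :: (((List.range n).map (R (C a))).reverse ++ B) =
        ((A ++ (List.range n).map (L (C a))) ++ [L (C a) n]) ++ L (C a) (n + 1) ::
        R (C a) n :: (((List.range n).map (R (C a))).reverse ++ B) := by simp
    rw [eq2] at g1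
    have g2 := g1.glue (x := R (C a) (n + 1)) (by linarith) (by
      apply Set.Subset.antisymm
      · rintro z ⟨hz, hzK⟩
        rw [← hC.triL_inter_triR ha hi]
        refine ⟨?_, hz⟩
        rcases hzK with hzK | hzT
        · exact gate_subset_triL _ _ (inter z (Or.inr hz) hzK)
        · exact hzT
      · refine Set.subset_inter (segment_left_right_subset_tri _ _ _)
          (Set.subset_union_of_subset_right ?_ _)
        exact segment_mid_right_subset_tri _ _ _)
    convert g2 using 1
    · rw [armList_succ]; simp
    · rw [arm_succ, ← Set.union_assoc, Set.union_assoc _ (tri _ _ _)]; rfl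

/-- Gluing a list of arms. -/
lemma Paths.bounds_arms (hC : Paths k N C) {B : List Plane} : ∀ (idx : List ℕ), idx.Nodup →
    (∀ a ∈ idx, a < k) → ∀ (A : List Plane) (K : Set Plane),
    Bounds (A ++ idx.flatMap (fun a => [L (C a) 0, R (C a) 0]) ++ B) K →
    (∀ a ∈ idx, ∀ i < N, ∀ z ∈ strip (C a) i, z ∈ K → i = 0 ∧ z ∈ gate (C a) 0) →
    Bounds (A ++ idx.flatMap (fun a => armList (C a) N) ++ B)
      (K ∪ {z | ∃ a ∈ idx, z ∈ arm (C a) N})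
  | [], _, _, A, K, hB, _ => by simpa using hB
  | a :: idx, hnd, hlt, A, K, hB, hK => by
    have ha := hlt a (by simp)
    rw [List.nodup_cons] at hnd
    have h1 : Bounds (A ++ L (C a) 0 :: R (C a) 0 ::
        (idx.flatMap (fun a => [L (C a) 0, R (C a) 0]) ++ B)) K := by simpa using hB
    have h2 := hC.bounds_arm ha h1 (hK a (by simp)) N le_rfl
    rw [← List.append_assoc] at h2
    have h3 := hC.bounds_arms idx hnd.2 (fun b hb => hlt b (by simp [hb])) _ _ h2 (by
      rintro b hb i hi z hz (hzK | ⟨j, hj, hzj⟩)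
      · exact hK b (by simp [hb]) i hi z hz hzK
      · have hab : b ≠ a := fun e => hnd.1 (e ▸ hb)
        exact absurd (hC.strip_inter_strip (hlt b (by simp [hb])) ha hi hj (fun h => hab h.1) hz
          hzj).1 hab)
    convert h3 using 1
    · simp
    · ext z
      simp only [Set.mem_union, Set.mem_ofPred_eq, List.mem_cons]
      constructor
      · rintro (h | ⟨b, rfl | hb, hz⟩)
        · exact Or.inl (Or.inl h)
        · exact Or.inl (Or.inr hz)
        · exact Or.inr ⟨b, hb, hz⟩
      · rintro ((h | h) | ⟨b, hb, hz⟩)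
        · exact Or.inl h
        · exact Or.inr ⟨a, Or.inl rfl, h⟩
        · exact Or.inr ⟨b, Or.inr hb, hz⟩

end

/-! ### Corners and assembly of the whole polygon -/

section

variable {k N : ℕ} {C : ℕ → ℕ → ℤ × ℤ}

lemma Turning.append : ∀ (X : List Plane) {a b : Plane} {Y : List Plane},
    Turning (X ++ [a, b]) → Turning (a :: b :: Y) → Turning (X ++ a :: b :: Y)
  | [], _, _, _, _, h => h
  | [_], _, _, _, h1, h2 => ⟨h1.1, h2⟩
  | _ :: y :: X, _, _, _, h1, h2 => by
    rcases X with _ | ⟨z, X⟩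
    · exact ⟨h1.1, Turning.append [y] h1.2 h2⟩
    · exact ⟨h1.1, Turning.append (y :: z :: X) h1.2 h2⟩

lemma Turning.reverse : ∀ {l : List Plane}, Turning l → Turning l.reverse
  | [], _ => trivial
  | [_], _ => trivial
  | [_, _], _ => trivial
  | a :: b :: c :: l, h => by
    have ih : Turning (l.reverse ++ [c, b]) := by simpa using Turning.reverse h.2
    have : (a :: b :: c :: l).reverse = l.reverse ++ c :: b :: [a] := by simp
    rw [this]
    refine Turning.append _ ih ⟨?_, trivial⟩
    exact cr_ne_swap h.1

lemma turning_range {f : ℕ → Plane} : ∀ (n s : ℕ),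
    (∀ i, i + 2 < n → cr (f (s + i)) (f (s + i + 1)) (f (s + i + 2)) ≠ 0) →
    Turning ((List.range' s n).map f)
  | 0, _, _ => trivial
  | 1, _, _ => trivial
  | 2, _, _ => trivial
  | n + 3, s, h => by
    refine ⟨h 0 (by omega), ?_⟩
    refine turning_range (n + 2) (s + 1) fun i hi => ?_
    have := h (i + 1) (by omega)
    convert this using 2 <;> congr 1 <;> omega

lemma Paths.turning_armList (hC : Paths k N C) {a : ℕ} (ha : a < k) (hN : 1 ≤ N) :
    Turning (armList (C a) N) := by
  have step : ∀ i, i + 2 < N + 1 →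
      cr (L (C a) i) (L (C a) (i + 1)) (L (C a) (i + 2)) ≠ 0 ∧
      cr (R (C a) i) (R (C a) (i + 1)) (R (C a) (i + 2)) ≠ 0 := by
    intro i hi
    have := cr_posts (hC.adj a ha i (by omega)) (hC.adj a ha (i + 1) (by omega))
      (hC.adj a ha (i + 2) (by omega)) (hC.ne ha (by omega)) (hC.ne ha (by omega)) (widths_wd i)
    have e : wd (i + 2) = wd i := by unfold wd; simp
    unfold L R
    rw [e]
    exact this
  obtain ⟨n, rfl⟩ : ∃ n, N = n + 1 := ⟨N - 1, by omega⟩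
  have tL : Turning ((List.range (n + 2)).map (L (C a))) := by
    rw [List.range_eq_range']
    refine turning_range _ _ fun i hi => ?_
    rw [zero_add]
    exact (step i hi).1
  have tR : Turning ((List.range (n + 2)).map (R (C a))).reverse := by
    rw [List.range_eq_range']
    refine (turning_range _ _ fun i hi => ?_).reverse
    rw [zero_add]
    exact (step i hi).2
  have eL : (List.range (n + 2)).map (L (C a)) =
      (List.range n).map (L (C a)) ++ [L (C a) n, L (C a) (n + 1)] := by
    simp [List.range_succ]
  have eR : ((List.range (n + 2)).map (R (C a))).reverse =
      R (C a) (n + 1) :: R (C a) n :: ((List.range n).map (R (C a))).reverse := by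
    simp [List.range_succ]
  have hw := widths_wd n
  rw [armList, eL, eR, List.append_assoc]
  rw [eL] at tL
  rw [eR] at tR
  refine Turning.append _ tL ⟨?_, ?_, tR⟩
  · exact cr_third (hC.adj a ha n (by omega)) (hC.adj a ha (n + 1) (by omega))
      (hC.ne ha (by omega)) hw
  · exact (lt_of_le_of_lt (hC.cr_triR ha (show n < n + 1 by omega)) (by norm_num)).ne

lemma Paths.L_zero (hC : Paths k N C) {a : ℕ} (ha : a < k) :
    L (C a) 0 = top ((C a 0).1 - 1 / 32) := by
  have h0 := hC.zero a ha
  have h1 := hC.one a ha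
  apply plane_ext <;> simp [L, wd, h0, h1]

lemma Paths.R_zero (hC : Paths k N C) {a : ℕ} (ha : a < k) :
    R (C a) 0 = top ((C a 0).1 + 1 / 32) := by
  have h0 := hC.zero a ha
  have h1 := hC.one a ha
  apply plane_ext <;> simp [R, wd, h0, h1]

lemma Paths.posts_one_pos (hC : Paths k N C) {a : ℕ} (ha : a < k) (hN : 1 ≤ N) :
    -1 / 2 < L (C a) 1 1 ∧ -1 / 2 < R (C a) 1 1 := by
  have h1 := hC.nonneg a ha 1 (by omega) le_rfl
  have h2 := hC.nonneg a ha 2 (by omega) (by omega)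
  have h12 : (0 : ℝ) ≤ ((C a 1).2 + (C a (1 + 1)).2 : ℤ) := by exact_mod_cast add_nonneg h1 h2
  have gl := abs_sub_of_mem_gate (hC.adj a ha 1 hN) (left_mem_segment ℝ (L (C a) 1) (R (C a) 1))
  have gr := abs_sub_of_mem_gate (hC.adj a ha 1 hN) (right_mem_segment ℝ (L (C a) 1) (R (C a) 1))
  constructor
  · have := (abs_le.1 gl.2).1; linarith
  · have := (abs_le.1 gr.2).1; linarith

/-- Arms along the upper side, from left to right, followed by the end of the polygon. -/
lemma Paths.turning_arms (hC : Paths k N C) (hN : 1 ≤ N) {W : ℝ} {E : List Plane}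
    (hE : ∀ Y < W, Turning (top Y :: top W :: E)) : ∀ (idx : List ℕ),
    (∀ a ∈ idx, a < k ∧ ((C a 0).1 : ℝ) + 1 / 32 < W) →
    idx.Pairwise (fun a b => ((C a 0).1 : ℝ) + 1 / 32 < (C b 0).1 - 1 / 32) →
    ∃ X rest, idx.flatMap (fun a => armList (C a) N) ++ top W :: E = top X :: rest ∧
      (X = W ∨ ∃ a ∈ idx, X = (C a 0).1 - 1 / 32) ∧
      ∀ Y < X, Turning (top Y :: top X :: rest)
  | [], _, _ => ⟨W, E, rfl, Or.inl rfl, hE⟩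
  | a :: idx, hlt, hsort => by
    obtain ⟨ha, haW⟩ := hlt a (by simp)
    obtain ⟨X, rest, e, hX, hT⟩ := hC.turning_arms hN hE idx (fun b hb => hlt b (by simp [hb]))
      (List.Pairwise.of_cons hsort)
    have hRX : ((C a 0).1 : ℝ) + 1 / 32 < X := by
      rcases hX with rfl | ⟨b, hb, rfl⟩
      · exact haW
      · exact List.rel_of_pairwise_cons hsort hb
    have tA := hC.turning_armList ha hN
    obtain ⟨p1, p2⟩ := hC.posts_one_pos ha hN
    -- The foot of an arm is a genuine corner: its neighbour on the base side is on the line `-1 /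
    -- 2`, its neighbour on the arm strictly above it.
    have crL : ∀ Y < ((C a 0).1 : ℝ) - 1 / 32, cr (top Y) (L (C a) 0) (L (C a) 1) ≠ 0 := by
      intro Y hY
      rw [hC.L_zero ha]
      have : cr (top Y) (top ((C a 0).1 - 1 / 32)) (L (C a) 1) =
        ((C a 0).1 - 1 / 32 - Y) * (L (C a) 1 1 - -1 / 2) := by simp [cr]
      rw [this]
      exact mul_ne_zero (by linarith) (by linarith)
    have crR : cr (R (C a) 1) (R (C a) 0) (top X) ≠ 0 := by
      rw [hC.R_zero ha, ← cr_rot]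
      have : cr (top ((C a 0).1 + 1 / 32)) (top X) (R (C a) 1) =
        (X - ((C a 0).1 + 1 / 32)) * (R (C a) 1 1 - -1 / 2) := by simp [cr]
      rw [this]
      exact mul_ne_zero (by linarith) (by linarith)
    obtain ⟨n, rfl⟩ : ∃ n, N = n + 1 := ⟨N - 1, by omega⟩
    obtain ⟨M, eM⟩ : ∃ M, armList (C a) (n + 1) = L (C a) 0 :: L (C a) 1 :: M := by
      refine ⟨(List.range' 2 n).map (L (C a)) ++ ((List.range (n + 2)).map (R (C a))).reverse, ?_⟩
      rw [armList, List.range_eq_range']; rfl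
    obtain ⟨M', eM'⟩ : ∃ M', armList (C a) (n + 1) = M' ++ [R (C a) 1, R (C a) 0] := by
      refine ⟨(List.range (n + 2)).map (L (C a)) ++ ((List.range' 2 n).map (R (C a))).reverse, ?_⟩
      have : List.range (n + 2) = 0 :: 1 :: List.range' 2 n := by
        rw [List.range_eq_range']; rfl
      rw [armList]
      nth_rewrite 2 [this]
      simp
    refine ⟨(C a 0).1 - 1 / 32, (L (C a) 1 :: M) ++ top X :: rest, ?_,
      Or.inr ⟨a, by simp, rfl⟩, ?_⟩
    · rw [List.flatMap_cons, List.append_assoc, e, eM, hC.L_zero ha]; rfl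
    · intro Y hY
      have t2 : Turning (armList (C a) (n + 1) ++ top X :: rest) := by
        rw [eM', List.append_assoc]
        rw [eM'] at tA
        refine Turning.append _ tA ⟨crR, ?_⟩
        have := hT _ hRX
        rw [← hC.R_zero ha] at this
        exact this
      rw [eM] at t2
      rw [← hC.L_zero ha]
      exact ⟨crL Y hY, t2⟩

/-- The vertices of the polygon. -/
def polyList (k N : ℕ) (C : ℕ → ℕ → ℤ × ℤ) (W : ℝ) (m : ℕ) : List Plane :=
  paraList W m m ++ top (-W) :: ((List.range k).flatMap (fun a => armList (C a) N) ++ [top W])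

/-- The region of the polygon. -/
def bigSet (k N : ℕ) (C : ℕ → ℕ → ℤ × ℤ) (W : ℝ) (m : ℕ) : Set Plane :=
  base W m m ∪ {z | ∃ a ∈ List.range k, z ∈ arm (C a) N}

lemma length_polyList (k N : ℕ) (C : ℕ → ℕ → ℤ × ℤ) (W : ℝ) (m : ℕ) :
    (polyList k N C W m).length = m + 2 + k * (2 * N + 2) := by
  have : ∀ a, (armList (C a) N).length = 2 * N + 2 := by
    intro a; simp [armList]; omega
  simp [polyList, paraList, List.length_flatMap, this]
  omega

lemma base_lower {W : ℝ} (hW : 0 ≤ W) {m j : ℕ} (hj : j ≤ m) :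
    base W m j ⊆ {z | z 1 ≤ -1 / 2} := by
  apply convexHull_min
  · rintro v ⟨u, hu, rfl⟩
    have : u ^ 2 ≤ 1 := by
      rcases hu with (rfl | rfl) | ⟨i, hi, rfl⟩
      · norm_num
      · norm_num
      · have h1 : (i : ℝ) / m ≤ 1 := by
          rw [div_le_one (by exact_mod_cast (by omega : 0 < m))]
          exact_mod_cast (by omega : i ≤ m)
        have h0 : 0 ≤ (i : ℝ) / m := by positivity
        nlinarith
    show -1 / 2 - W * (1 - u ^ 2) ≤ -1 / 2
    nlinarith
  · intro x hx y hy s t hs ht hst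
    simp only [Set.mem_ofPred_eq, PiLp.add_apply, PiLp.smul_apply, smul_eq_mul] at *
    nlinarith

theorem Paths.bounds (hC : Paths k N C) {W : ℝ} (hW : 0 < W)
    (hsort : ∀ a < k, ∀ b < k, a < b → ((C a 0).1 : ℝ) + 1 / 32 < (C b 0).1 - 1 / 32)
    (hrange : ∀ a < k, -W < ((C a 0).1 : ℝ) - 1 / 32 ∧ ((C a 0).1 : ℝ) + 1 / 32 < W)
    {m : ℕ} (hm : 1 ≤ m) :
    Bounds (polyList k N C W m ++ (polyList k N C W m).take 1) (bigSet k N C W m) := by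
  obtain ⟨j, rfl⟩ : ∃ j, m = j + 1 := ⟨m - 1, by omega⟩
  let Xs : List ℝ := (List.range k).flatMap fun a =>
    [((C a 0).1 : ℝ) - 1 / 32, ((C a 0).1 : ℝ) + 1 / 32]
  have memXs : ∀ x ∈ Xs, -W < x ∧ x < W := by
    intro x hx
    obtain ⟨a, ha, hx⟩ := List.mem_flatMap.1 hx
    rw [List.mem_range] at ha
    have := hrange a ha
    simp only [List.mem_cons, List.not_mem_nil, or_false] at hx
    rcases hx with rfl | rfl <;> constructor <;> linarith
  have h1 : (-W :: Xs).Pairwise (· < ·) := by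
    rw [List.pairwise_cons]
    refine ⟨fun x hx => (memXs x hx).1, ?_⟩
    rw [List.pairwise_flatMap]
    constructor
    · intro a _
      simp
      linarith
    · refine List.Pairwise.imp_of_mem ?_ (List.pairwise_lt_range (n := k))
      intro a b ha hb hab x hx y hy
      have := hsort a (List.mem_range.1 ha) b (List.mem_range.1 hb) hab
      simp only [List.mem_cons, List.not_mem_nil, or_false] at hx hy
      rcases hx with rfl | rfl <;> rcases hy with rfl | rfl <;> linarith
  have h2 : ∀ Y ∈ -W :: Xs, Y < W := by
    intro Y hY
    rcases List.mem_cons.1 hY with rfl | hY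
    · linarith
    · exact (memXs Y hY).2
  have hb := bounds_base hW h1 h2 (j + 1) j le_rfl
  have eX : Xs.map top = (List.range k).flatMap (fun a => [L (C a) 0, R (C a) 0]) := by
    rw [List.map_flatMap]
    refine List.flatMap_congr fun a ha => ?_
    have ha := List.mem_range.1 ha
    rw [hC.L_zero ha, hC.R_zero ha]
    simp
  rw [eX] at hb
  have := hC.bounds_arms (B := [top W, para W 0]) (List.range k) List.nodup_range
    (fun a ha => List.mem_range.1 ha) (paraList W (j + 1) (j + 1) ++ [top (-W)])
    (base W (j + 1) (j + 1)) (by simpa using hb) (by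
      intro a ha i hi z hz hzB
      exact hC.strip_inter_lower (List.mem_range.1 ha) hi hz (base_lower hW.le le_rfl hzB))
  have take1 : (polyList k N C W (j + 1)).take 1 = [para W 0] := by
    simp [polyList, paraList, List.range_succ_eq_map]
  rw [take1]
  convert this using 1
  · simp [polyList]
  · rfl

theorem Paths.turning (hC : Paths k N C) (hN : 1 ≤ N) {W : ℝ} (hW : 0 < W)
    (hsort : ∀ a < k, ∀ b < k, a < b → ((C a 0).1 : ℝ) + 1 / 32 < (C b 0).1 - 1 / 32)
    (hrange : ∀ a < k, -W < ((C a 0).1 : ℝ) - 1 / 32 ∧ ((C a 0).1 : ℝ) + 1 / 32 < W)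
    {m : ℕ} (hm : 1 ≤ m) :
    Turning (polyList k N C W m ++ (polyList k N C W m).take 2) := by
  obtain ⟨j, rfl⟩ : ∃ j, m = j + 1 := ⟨m - 1, by omega⟩
  have hj : (0 : ℝ) < (j + 1 : ℕ) := by positivity
  have hpara : ∀ {u v w : ℝ}, u ≠ v → u ≠ w → v ≠ w →
      cr (para W u) (para W v) (para W w) ≠ 0 := by
    intro u v w h1 h2 h3
    rw [cr_para]
    exact neg_ne_zero.2 (mul_ne_zero (by positivity) (mul_ne_zero (mul_ne_zero
      (sub_ne_zero.2 h1.symm) (sub_ne_zero.2 h2.symm)) (sub_ne_zero.2 h3.symm)))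
  let f : ℕ → Plane := fun i => para W ((i : ℝ) / (j + 1 : ℕ))
  have f_last : f (j + 1) = top (-W) := by
    rw [top_eq_para_left]
    simp only [f]
    rw [div_self hj.ne']
  have f_zero : f 0 = para W 0 := by simp [f]
  have take2 : (polyList k N C W (j + 1)).take 2 = [f 0, f 1] := by
    rcases j with _ | j
    · have : f 1 = top (-W) := f_last
      rw [this]
      simp [polyList, paraList, f]
    · simp [polyList, paraList, List.range_succ_eq_map, f]
  have hfne : ∀ {i i' : ℕ}, i ≠ i' → (i : ℝ) / (j + 1 : ℕ) ≠ (i' : ℝ) / (j + 1 : ℕ) := by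
    intro i i' h e
    rw [div_left_inj' hj.ne'] at e
    exact h (by exact_mod_cast e)
  have tail : ∀ Y < W, Turning (top Y :: top W :: [f 0, f 1]) := by
    intro Y hY
    refine ⟨?_, ?_, trivial⟩
    · rw [f_zero]
      have : cr (top Y) (top W) (para W 0) = - ((W - Y) * W) := by simp [cr]
      rw [this]
      exact neg_ne_zero.2 (mul_ne_zero (by linarith) hW.ne')
    · rw [top_eq_para_right]
      have : ∀ i : ℕ, (-1 : ℝ) ≠ (i : ℝ) / (j + 1 : ℕ) := fun i e => by
        have : (0 : ℝ) ≤ (i : ℝ) / (j + 1 : ℕ) := by positivity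
        linarith
      exact hpara (this 0) (this 1) (hfne (by norm_num))
  obtain ⟨X, rest, e, hX, hT⟩ := hC.turning_arms hN tail (List.range k)
    (fun a ha => ⟨List.mem_range.1 ha, (hrange a (List.mem_range.1 ha)).2⟩)
    (List.Pairwise.imp_of_mem (fun ha hb hab =>
      hsort _ (List.mem_range.1 ha) _ (List.mem_range.1 hb) hab) List.pairwise_lt_range)
  have hXW : -W < X := by
    rcases hX with rfl | ⟨a, ha, rfl⟩
    · linarith
    · exact (hrange a (List.mem_range.1 ha)).1
  have t1 : Turning ((List.range j).map f ++ [f j, top (-W)]) := by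
    have : Turning ((List.range' 0 (j + 2)).map f) := by
      refine turning_range _ _ fun i _ => hpara (hfne ?_) (hfne ?_) (hfne ?_) <;> omega
    rw [← List.range_eq_range'] at this
    simpa [List.range_succ, f_last] using this
  have eq : polyList k N C W (j + 1) ++ (polyList k N C W (j + 1)).take 2 =
      (List.range j).map f ++ f j :: top (-W) :: top X :: rest := by
    rw [take2, ← e]
    simp [polyList, paraList, List.range_succ, f]
  rw [eq]
  refine Turning.append _ t1 ⟨?_, hT _ hXW⟩
  have : cr (f j) (top (-W)) (top X) ≠ 0 := by
    rw [← cr_rot]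
    have h1 : (j : ℝ) / (j + 1 : ℕ) < 1 := by
      rw [div_lt_one hj]; push_cast; linarith
    have h0 : 0 ≤ (j : ℝ) / (j + 1 : ℕ) := by positivity
    have : cr (top (-W)) (top X) (f j) = - ((X + W) * (W * (1 - ((j : ℝ) / (j + 1 : ℕ)) ^ 2))) := by
      simp only [cr, f, top_zero, top_one, para_zero, para_one]; ring
    rw [this]
    refine neg_ne_zero.2 (mul_ne_zero (by linarith) (mul_ne_zero hW.ne' ?_))
    nlinarith
  exact this

end

/-! ### Hilbert curves -/

/-- The Hilbert curve of level `l`, a path through the grid points of a square of side `2 ^ l`. -/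
def hilbert : ℕ → ℕ → ℤ × ℤ
  | 0, _ => (0, 0)
  | l + 1, i =>
    let p := hilbert l (i % 4 ^ l)
    if i / 4 ^ l = 0 then (p.2, p.1)
    else if i / 4 ^ l = 1 then (p.1, p.2 + 2 ^ l)
    else if i / 4 ^ l = 2 then (p.1 + 2 ^ l, p.2 + 2 ^ l)
    else (2 * 2 ^ l - 1 - p.2, 2 ^ l - 1 - p.1)

/-- The four quarters of the Hilbert curve. -/
lemma hilbert_quarter (l : ℕ) {q r : ℕ} (hr : r < 4 ^ l) :
    hilbert (l + 1) (q * 4 ^ l + r) =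
      if q = 0 then ((hilbert l r).2, (hilbert l r).1)
      else if q = 1 then ((hilbert l r).1, (hilbert l r).2 + 2 ^ l)
      else if q = 2 then ((hilbert l r).1 + 2 ^ l, (hilbert l r).2 + 2 ^ l)
      else (2 * 2 ^ l - 1 - (hilbert l r).2, 2 ^ l - 1 - (hilbert l r).1) := by
  have h1 : (q * 4 ^ l + r) / 4 ^ l = q := by
    rw [mul_comm, Nat.mul_add_div (by positivity), Nat.div_eq_of_lt hr, add_zero]
  have h2 : (q * 4 ^ l + r) % 4 ^ l = r := by
    rw [mul_comm, Nat.mul_add_mod, Nat.mod_eq_of_lt hr]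
  simp only [hilbert, h1, h2]

lemma exists_quarter {l i : ℕ} (hi : i < 4 ^ (l + 1)) :
    ∃ q r, q < 4 ∧ r < 4 ^ l ∧ i = q * 4 ^ l + r := by
  refine ⟨i / 4 ^ l, i % 4 ^ l, ?_, Nat.mod_lt _ (by positivity), (Nat.div_add_mod' _ _).symm⟩
  rw [Nat.div_lt_iff_lt_mul (by positivity)]
  rw [pow_succ] at hi; omega

lemma hilbert_mem : ∀ (l : ℕ) {i : ℕ}, i < 4 ^ l → 0 ≤ (hilbert l i).1 ∧ (hilbert l i).1 < 2 ^ l ∧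
    0 ≤ (hilbert l i).2 ∧ (hilbert l i).2 < 2 ^ l
  | 0, _, _ => by simp [hilbert]
  | l + 1, i, hi => by
    obtain ⟨q, r, hq, hr, rfl⟩ := exists_quarter hi
    obtain ⟨h1, h2, h3, h4⟩ := hilbert_mem l hr
    rw [hilbert_quarter l hr, pow_succ]
    generalize (2 : ℤ) ^ l = t at *
    interval_cases q <;> simp <;> omega

lemma hilbert_inj : ∀ (l : ℕ) {i j : ℕ}, i < 4 ^ l → j < 4 ^ l → hilbert l i = hilbert l j → i = j
  | 0, i, j, hi, hj, _ => by simp at hi hj; omega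
  | l + 1, i, j, hi, hj, h => by
    obtain ⟨q, r, hq, hr, rfl⟩ := exists_quarter hi
    obtain ⟨q', r', hq', hr', rfl⟩ := exists_quarter hj
    obtain ⟨h1, h2, h3, h4⟩ := hilbert_mem l hr
    obtain ⟨h1', h2', h3', h4'⟩ := hilbert_mem l hr'
    have ih := hilbert_inj l hr hr'
    rw [Prod.ext_iff] at ih
    rw [hilbert_quarter l hr, hilbert_quarter l hr', Prod.ext_iff] at h
    generalize (2 : ℤ) ^ l = t at *
    interval_cases q <;> interval_cases q' <;> simp at h <;> first
    | (exfalso; omega)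
    | (rw [ih (by omega)])

lemma hilbert_zero : ∀ l, hilbert l 0 = (0, 0)
  | 0 => rfl
  | l + 1 => by
    have := hilbert_quarter l (q := 0) (r := 0) (by positivity)
    simpa [hilbert_zero l] using this

/-- Each curve enters and leaves its square at the two lower corners; this is what lets the
reflected quarters join up in `hilbert_adj`. -/
lemma hilbert_last : ∀ l, hilbert l (4 ^ l - 1) = (2 ^ l - 1, 0)
  | 0 => rfl
  | l + 1 => by
    have hp : 0 < 4 ^ l := by positivity
    have e : 4 ^ (l + 1) - 1 = 3 * 4 ^ l + (4 ^ l - 1) := by rw [pow_succ]; omega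
    rw [e, hilbert_quarter l (by omega), hilbert_last l, pow_succ]
    simp; ring

lemma hilbert_adj : ∀ (l : ℕ) {i : ℕ}, i + 1 < 4 ^ l → Adj (hilbert l i) (hilbert l (i + 1))
  | 0, i, hi => by simp at hi
  | l + 1, i, hi => by
    obtain ⟨q, r, hq, hr, rfl⟩ := exists_quarter (show i < 4 ^ (l + 1) by omega)
    rcases Nat.lt_or_ge (r + 1) (4 ^ l) with h | h
    · have ih := hilbert_adj l h
      rw [add_assoc, hilbert_quarter l hr, hilbert_quarter l h]
      unfold Adj at ih ⊢
      generalize (2 : ℤ) ^ l = t at *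
      interval_cases q <;> simp <;> omega
    · have hr' : r = 4 ^ l - 1 := by omega
      have hp : 0 < 4 ^ l := by positivity
      have e : q * 4 ^ l + r + 1 = (q + 1) * 4 ^ l + 0 := by rw [hr', Nat.add_mul]; omega
      have hq3 : q < 3 := by
        by_contra hcon
        obtain rfl : q = 3 := by omega
        rw [pow_succ] at hi; omega
      rw [e, hilbert_quarter l hr, hilbert_quarter l hp, hr', hilbert_last, hilbert_zero]
      unfold Adj
      generalize (2 : ℤ) ^ l = t at *
      interval_cases q <;> simp
      omega

/-- Aligned blocks of length `4 ^ s` lie in squares of side `2 ^ s`. -/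
lemma hilbert_block : ∀ (l s : ℕ) {i j : ℕ}, i < 4 ^ l → j < 4 ^ l → i / 4 ^ s = j / 4 ^ s →
    |(hilbert l i).1 - (hilbert l j).1| < 2 ^ s ∧ |(hilbert l i).2 - (hilbert l j).2| < 2 ^ s := by
  intro l s
  rcases Nat.lt_or_ge s l with hsl | hsl
  swap
  · intro i j hi hj _
    obtain ⟨h1, h2, h3, h4⟩ := hilbert_mem l hi
    obtain ⟨h1', h2', h3', h4'⟩ := hilbert_mem l hj
    have : (2 : ℤ) ^ l ≤ 2 ^ s := pow_le_pow_right₀ (by norm_num) hsl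
    constructor <;> rw [abs_lt] <;> constructor <;> omega
  obtain ⟨d, rfl⟩ : ∃ d, l = s + d := ⟨l - s, by omega⟩
  clear hsl
  induction d with
  | zero =>
    intro i j hi hj _
    obtain ⟨h1, h2, h3, h4⟩ := hilbert_mem _ hi
    obtain ⟨h1', h2', h3', h4'⟩ := hilbert_mem _ hj
    constructor <;> rw [abs_lt] <;> constructor <;> simp at * <;> omega
  | succ d ih =>
    intro i j hi hj hij
    obtain ⟨q, r, hq, hr, rfl⟩ := exists_quarter (l := s + d) hi
    obtain ⟨q', r', hq', hr', rfl⟩ := exists_quarter (l := s + d) hj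
    -- For blocks no longer than a quarter, the block index determines the quarter and the block
    -- inside it. The quarter maps are isometries, so the bound is inherited.
    have hdiv : ∀ q r, (q * 4 ^ (s + d) + r) / 4 ^ s = q * 4 ^ d + r / 4 ^ s := by
      intro q r
      rw [show q * 4 ^ (s + d) + r = 4 ^ s * (q * 4 ^ d) + r by rw [pow_add]; ring,
        Nat.mul_add_div (by positivity)]
    have hlt : ∀ r < 4 ^ (s + d), r / 4 ^ s < 4 ^ d := by
      intro r hr
      rw [Nat.div_lt_iff_lt_mul (by positivity), mul_comm, ← pow_add]
      exact hr
    rw [hdiv, hdiv] at hij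
    have hqq : q = q' := by
      have a := congrArg (· / 4 ^ d) hij
      simp only [mul_comm _ (4 ^ d), Nat.mul_add_div (show 0 < 4 ^ d by positivity),
        Nat.div_eq_of_lt (hlt r hr), Nat.div_eq_of_lt (hlt r' hr')] at a
      omega
    subst hqq
    obtain ⟨h1, h2⟩ := ih hr hr' (by omega)
    rw [show s + (d + 1) = s + d + 1 by ring, hilbert_quarter _ hr, hilbert_quarter _ hr']
    generalize (2 : ℤ) ^ (s + d) = t at *
    generalize (2 : ℤ) ^ s = u at *
    rw [abs_lt] at h1 h2
    simp only [abs_lt]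
    interval_cases q <;> simp <;> omega

/-- The paths of the polygon: translated Hilbert curves, preceded by a point of the base. -/
def hpath (l : ℕ) (a i : ℕ) : ℤ × ℤ :=
  if i = 0 then ((a : ℤ) * 2 ^ l, -1)
  else ((hilbert l (i - 1)).1 + (a : ℤ) * 2 ^ l, (hilbert l (i - 1)).2)

lemma hpath_zero (l a : ℕ) : hpath l a 0 = ((a : ℤ) * 2 ^ l, -1) := by simp [hpath]
lemma hpath_succ (l a i : ℕ) : hpath l a (i + 1) =
    ((hilbert l i).1 + (a : ℤ) * 2 ^ l, (hilbert l i).2) := by simp [hpath]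

/-- With `N = 4 ^ l - 1` there are `4 ^ l` doors, the last one leading from the penultimate to the
last point of the curve; no cell is built around that last point. -/
lemma paths_hpath (k l : ℕ) : Paths k (4 ^ l - 1) (hpath l) := by
  have hp : 0 < 4 ^ l := by positivity
  refine ⟨?_, ?_, ?_, ?_, ?_⟩
  · rintro a - (_ | i) hi
    · rw [hpath_zero, hpath_succ, hilbert_zero]
      simp [Adj]
    · rw [hpath_succ, hpath_succ]
      have := hilbert_adj l (i := i) (by omega)
      unfold Adj at *
      simp only
      omega
  · rintro a - b - (_ | i) hi (_ | j) hj h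
    · rw [hpath_zero, hpath_zero, Prod.mk.injEq] at h
      refine ⟨?_, rfl⟩
      have := mul_right_cancel₀ (by positivity) h.1
      exact_mod_cast this
    · rw [hpath_zero, hpath_succ, Prod.mk.injEq] at h
      have := hilbert_mem l (i := j) (by omega)
      omega
    · rw [hpath_zero, hpath_succ, Prod.mk.injEq] at h
      have := hilbert_mem l (i := i) (by omega)
      omega
    · rw [hpath_succ, hpath_succ, Prod.mk.injEq] at h
      obtain ⟨h1, h2, -, -⟩ := hilbert_mem l (i := i) (by omega)
      obtain ⟨h1', h2', -, -⟩ := hilbert_mem l (i := j) (by omega)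
      have hab : (a : ℤ) = b := by
        -- The squares of different arms are translates by multiples of their side, so dividing the
        -- first coordinate by the side recovers the arm.
        have e := congrArg (· / (2 : ℤ) ^ l) h.1
        rwa [Int.add_mul_ediv_right _ _ (by positivity), Int.add_mul_ediv_right _ _ (by positivity),
          Int.ediv_eq_zero_of_lt h1 h2, Int.ediv_eq_zero_of_lt h1' h2', zero_add, zero_add] at e
      have hab' : a = b := by exact_mod_cast hab
      subst hab'
      refine ⟨rfl, ?_⟩
      rw [hilbert_inj l (i := i) (j := j) (by omega) (by omega) (Prod.ext (by omega) h.2)]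
  · intro a _; rw [hpath_zero]
  · intro a _
    rw [hpath_zero, show (1 : ℕ) = 0 + 1 from rfl, hpath_succ, hilbert_zero]
    simp
  · rintro a - (_ | i) hi h
    · omega
    · rw [hpath_succ]
      exact (hilbert_mem l (i := i) (by omega)).2.2.1

/-! ### Lower and upper bounds for the geodesic distance -/

/-- A function that is `1`-Lipschitz at every point of `P` changes along a path by at most the
length of the path. -/
lemma edist_le_eVariationOn {P : Set Plane} {f : Plane → ℝ}
    (hf : ∀ x ∈ P, ∀ᶠ y in nhds x, y ∈ P → dist (f y) (f x) ≤ dist y x) {p q : P} (σ : Path p q) :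
    edist (f q) (f p) ≤ eVariationOn (fun t => (σ t : Plane)) Set.univ := by
  set g : unitInterval → Plane := fun t => (σ t : Plane) with hg
  have hgc : Continuous g := continuous_subtype_val.comp σ.continuous
  have hgP : ∀ t, g t ∈ P := fun t => (σ t).2
  have hloc : ∀ x, ∀ᶠ u in nhds x, dist (f (g u)) (f (g x)) ≤ dist (g u) (g x) := by
    intro x
    filter_upwards [hgc.continuousAt.eventually (hf (g x) (hgP x))] with u hu
    exact hu (hgP u)
  have hfg : Continuous fun t => f (g t) := by
    rw [continuous_iff_continuousAt]
    intro x
    have h0 : Filter.Tendsto (fun u => dist (g u) (g x)) (nhds x) (nhds 0) := by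
      rw [← tendsto_iff_dist_tendsto_zero]; exact hgc.continuousAt
    exact tendsto_iff_dist_tendsto_zero.2
      (squeeze_zero' (Filter.Eventually.of_forall fun _ => dist_nonneg) (hloc x) h0)
  let V : unitInterval → ℝ≥0∞ := fun t => eVariationOn g (Set.Icc 0 t)
  have hVmono : ∀ {s t}, s ≤ t → V s ≤ V t := fun h =>
    eVariationOn.mono g (Set.Icc_subset_Icc_right h)
  -- Continuous induction on the parameter: the hypothesis compares values only with those at a
  -- centre `x`, so the set of times up to which the bound holds is shown to be closed and
  -- extendable beyond each of its points.
  let S : Set unitInterval := {t | ∀ u ≤ t, edist (f (g u)) (f (g 0)) ≤ V u}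
  have hS : IsClosed S := by
    rw [← closure_subset_iff_isClosed]
    intro t ht
    by_cases h : ∃ u ∈ S, t ≤ u
    · obtain ⟨u, hu, htu⟩ := h
      exact fun v hv => hu v (hv.trans htu)
    · push Not at h
      have hcl : ∀ c : ℝ≥0∞, IsClosed {u | edist (f (g u)) (f (g 0)) ≤ c} := fun c =>
        isClosed_le (hfg.edist continuous_const) continuous_const
      intro u hu
      rcases hu.eq_or_lt with rfl | hlt
      · exact closure_minimal (fun v hv => (hv v le_rfl).trans (hVmono (h v hv).le)) (hcl (V u)) ht
      · obtain ⟨v, hv, hvS⟩ := mem_closure_iff_nhds.1 ht (Set.Ioi u) (Ioi_mem_nhds hlt)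
        exact hvS u (le_of_lt hv)
  have hsub : Set.Icc (0 : unitInterval) 1 ⊆ S := by
    apply IsClosed.Icc_subset_of_forall_exists_gt (hS.inter isClosed_Icc)
    · intro u hu
      obtain rfl : u = 0 := le_antisymm hu u.2.1
      simp
    · rintro x ⟨hx, hx0, hx1⟩ y hy
      have hxy : x < y := hy
      obtain ⟨u, hu, hsub⟩ := (mem_nhdsGT_iff_exists_mem_Ioc_Ioo_subset hxy).1
        (nhdsWithin_le_nhds (hloc x))
      obtain ⟨z, hxz, hzu⟩ := exists_between hu.1
      have main : ∀ w, x ≤ w → dist (f (g w)) (f (g x)) ≤ dist (g w) (g x) →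
          edist (f (g w)) (f (g 0)) ≤ V w := by
        intro w hxw hw
        have e1 : V x + eVariationOn g (Set.Icc x w) = V w := by
          have := eVariationOn.Icc_add_Icc g (s := Set.univ) (show (0 : unitInterval) ≤ x from hx0)
            hxw (Set.mem_univ _)
          simpa using this
        have e2 : edist (f (g w)) (f (g x)) ≤ eVariationOn g (Set.Icc x w) := by
          refine le_trans ?_ (eVariationOn.edist_le g (Set.right_mem_Icc.2 hxw)
            (Set.left_mem_Icc.2 hxw))
          rw [edist_dist, edist_dist]
          exact ENNReal.ofReal_le_ofReal hw
        calc edist (f (g w)) (f (g 0)) ≤ edist (f (g w)) (f (g x)) + edist (f (g x)) (f (g 0)) :=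
              edist_triangle _ _ _
          _ ≤ eVariationOn g (Set.Icc x w) + V x := add_le_add e2 (hx x le_rfl)
          _ = V w := by rw [add_comm, e1]
      refine ⟨z, fun w hw => ?_, hxz, hzu.le.trans hu.2⟩
      rcases le_or_gt w x with h | h
      · exact hx w h
      · exact main w h.le (hsub ⟨h, lt_of_le_of_lt hw hzu⟩)
  have h1 := hsub (Set.right_mem_Icc.2 zero_le_one) 1 le_rfl
  have e1 : g 1 = q := by simp [hg]
  have e0 : g 0 = p := by simp [hg]
  rw [e1, e0] at h1
  exact h1.trans (eVariationOn.mono g (Set.subset_univ _))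

lemma le_geodesicDist {P : Set Plane} {f : Plane → ℝ}
    (hf : ∀ x ∈ P, ∀ᶠ y in nhds x, y ∈ P → dist (f y) (f x) ≤ dist y x) (p q : P) :
    edist (f q) (f p) ≤ geodesicDist P p q :=
  le_iInf fun σ => edist_le_eVariationOn hf σ

/-- Lipschitz functions on finitely many closed pieces. -/
lemma eventually_dist_le {ι : Type*} {s : Finset ι} {D : ι → Set Plane} {P : Set Plane}
    (hD : ∀ i ∈ s, IsClosed (D i)) (hP : ∀ x ∈ P, ∃ i ∈ s, x ∈ D i) {f : Plane → ℝ}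
    (hf : ∀ i ∈ s, ∀ x ∈ D i, ∀ y ∈ D i, dist (f y) (f x) ≤ dist y x) :
    ∀ x ∈ P, ∀ᶠ y in nhds x, y ∈ P → dist (f y) (f x) ≤ dist y x := by
  intro x _
  have : ∀ᶠ y in nhds x, ∀ i ∈ s, y ∈ D i → x ∈ D i := by
    rw [Filter.eventually_all_finset]
    intro i hi
    by_cases hx : x ∈ D i
    · exact Filter.Eventually.of_forall fun _ _ => hx
    · filter_upwards [(hD i hi).isOpen_compl.mem_nhds hx] with y hy hy'
      exact absurd hy' hy
  -- Close to `x` only the pieces containing `x` occur, so `y` shares a piece with `x` and the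
  -- estimate on that piece applies.
  filter_upwards [this] with y hy hyP
  obtain ⟨i, hi, hyi⟩ := hP y hyP
  exact hf i hi x (hy i hi hyi) y hyi

lemma geodesicDist_le_of_segment {P : Set Plane} (p q : P)
    (h : segment ℝ (p : Plane) q ⊆ P) : geodesicDist P p q ≤ ENNReal.ofReal (dist (p : Plane) q) := by
  let σ : Path p q :=
    { toFun := fun t => ⟨AffineMap.lineMap (p : Plane) (q : Plane) (t : ℝ), h (by
        rw [segment_eq_image_lineMap]; exact ⟨t, t.2, rfl⟩)⟩
      continuous_toFun := by
        refine Continuous.subtype_mk ?_ _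
        exact (AffineMap.lineMap_continuous).comp continuous_subtype_val
      source' := by simp
      target' := by simp }
  refine (iInf_le _ σ).trans ?_
  have hl : LipschitzWith (nndist (p : Plane) q)
      (AffineMap.lineMap (p : Plane) (q : Plane) : ℝ → Plane) := lipschitzWith_lineMap _ _
  have hm : Monotone (fun t : unitInterval => (t : ℝ)) := fun _ _ h => h
  have hv : eVariationOn (fun t : unitInterval => (t : ℝ)) Set.univ ≤ 1 := by
    have := (hm.monotoneOn Set.univ).eVariationOn_eq (Set.mem_univ 0) (Set.mem_univ 1)
    have e : (Set.univ ∩ Set.Icc (0 : unitInterval) 1) = Set.univ :=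
      Set.eq_univ_of_forall fun t => ⟨trivial, t.2.1, t.2.2⟩
    rw [e] at this
    rw [this]
    simp
  have := hl.lipschitzOnWith (s := Set.univ) |>.comp_eVariationOn_le
    (f := (AffineMap.lineMap (p : Plane) (q : Plane) : ℝ → Plane))
    (g := fun t : unitInterval => (t : ℝ)) (s := Set.univ) (Set.mapsTo_univ _ _)
  refine this.trans ?_
  calc _ ≤ (nndist (p : Plane) q : ℝ≥0∞) * 1 := by gcongr
    _ = ENNReal.ofReal (dist (p : Plane) q) := by
      rw [mul_one, ← edist_dist, edist_nndist]

lemma geodesicDist_triangle {P : Set Plane} (p q r : P) :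
    geodesicDist P p r ≤ geodesicDist P p q + geodesicDist P q r := by
  unfold geodesicDist
  rw [ENNReal.iInf_add]
  refine le_iInf fun σ => ?_
  rw [ENNReal.add_iInf]
  refine le_iInf fun τ => iInf_le_of_le (σ.trans τ) ?_
  let h : unitInterval := ⟨1 / 2, by norm_num, by norm_num⟩
  have split := eVariationOn.Icc_add_Icc (fun t => ((σ.trans τ) t : Plane)) (s := Set.univ)
    (show (0 : unitInterval) ≤ h from h.2.1) (show h ≤ 1 from h.2.2) (Set.mem_univ _)
  simp only [Set.univ_inter] at split
  have e : Set.Icc (0 : unitInterval) 1 = Set.univ :=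
    Set.eq_univ_of_forall fun t => ⟨t.2.1, t.2.2⟩
  rw [e] at split
  rw [← split]
  have mono : ∀ c : ℝ, Monotone fun t : unitInterval =>
      Set.projIcc (0 : ℝ) 1 zero_le_one (2 * (t : ℝ) - c) := by
    intro c s t hst
    apply Set.monotone_projIcc
    have : (s : ℝ) ≤ t := hst
    linarith
  refine add_le_add ?_ ?_
  · have : Set.EqOn (fun t => ((σ.trans τ) t : Plane)) ((fun t => (σ t : Plane)) ∘
        fun t : unitInterval => Set.projIcc (0 : ℝ) 1 zero_le_one (2 * (t : ℝ) - 0))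
        (Set.Icc 0 h) := by
      intro t ht
      have ht2 : (t : ℝ) ≤ 1 / 2 := ht.2
      have ht0 : (0 : ℝ) ≤ t := t.2.1
      simp only [Path.trans_apply, ht2, dite_true, Function.comp_apply, sub_zero]
      rw [Set.projIcc_of_mem zero_le_one (x := 2 * (t : ℝ)) ⟨by linarith, by linarith⟩]
    rw [eVariationOn.congr this]
    exact eVariationOn.comp_le_of_monotoneOn _ _ ((mono 0).monotoneOn _) (Set.mapsTo_univ _ _)
  · have : Set.EqOn (fun t => ((σ.trans τ) t : Plane)) ((fun t => (τ t : Plane)) ∘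
        fun t : unitInterval => Set.projIcc (0 : ℝ) 1 zero_le_one (2 * (t : ℝ) - 1))
        (Set.Icc h 1) := by
      intro t ht
      have ht2 : 1 / 2 ≤ (t : ℝ) := ht.1
      have ht1 : (t : ℝ) ≤ 1 := t.2.2
      rcases ht2.eq_or_lt with e | ht2
      · have e' : t = h := Subtype.ext e.symm
        subst e'
        simp [Path.trans_apply, h]
      · simp only [Path.trans_apply, not_le.2 ht2, dite_false, Function.comp_apply]
        rw [Set.projIcc_of_mem zero_le_one (x := 2 * (t : ℝ) - 1) ⟨by linarith, by linarith⟩]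
    rw [eVariationOn.congr this]
    exact eVariationOn.comp_le_of_monotoneOn _ _ ((mono 1).monotoneOn _) (Set.mapsTo_univ _ _)

/-! ### The potential along an arm and the doubling bound -/

section

variable {k N : ℕ} {C : ℕ → ℕ → ℤ × ℤ}

/-- The length function on the `i`-th cell of an arm. -/
def cellPotential (c : ℕ → ℤ × ℤ) (i : ℕ) (x : Plane) : ℝ :=
  3 / 5 * i + min (3 / 5) (Metric.infDist x (gate c i))

lemma dist_cellPotential_le (c : ℕ → ℤ × ℤ) (i : ℕ) (x y : Plane) :
    dist (cellPotential c i y) (cellPotential c i x) ≤ dist y x := by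
  have h : LipschitzWith 1 fun z => min (3 / 5 : ℝ) (Metric.infDist z (gate c i)) :=
    (Metric.lipschitz_infDist_pt _).const_min _
  have := h.dist_le_mul y x
  simpa [cellPotential] using this

/-- Consecutive doors are at least `3 / 5` apart, so on the next gate the truncation has taken
effect. The value there is the starting value of the next cell, which makes the pieces of the
potential fit together. -/
lemma Paths.cellPotential_gate (hC : Paths k N C) {a : ℕ} (ha : a < k) {i : ℕ} (hi : i < N)
    {x : Plane} (hx : x ∈ gate (C a) (i + 1)) :
    cellPotential (C a) i x = 3 / 5 * ((i + 1 : ℕ) : ℝ) := by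
  have : 3 / 5 ≤ Metric.infDist x (gate (C a) i) := by
    rw [Metric.le_infDist
      (⟨L (C a) i, left_mem_segment ℝ _ _⟩ : (gate (C a) i).Nonempty)]
    intro y hy
    rw [dist_comm]
    exact door_dist (hC.adj a ha i hi.le) (hC.adj a ha (i + 1) hi) (hC.ne ha hi) (widths_wd i) hy hx
  rw [cellPotential, min_eq_left this]
  push_cast; ring

lemma cellPotential_gate_self {c : ℕ → ℤ × ℤ} {i : ℕ} {x : Plane} (hx : x ∈ gate c i) :
    cellPotential c i x = 3 / 5 * i := by
  rw [cellPotential, Metric.infDist_zero_of_mem hx]; norm_num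

open Classical in
/-- The length function along an arm, extended by zero. -/
def potential (c : ℕ → ℤ × ℤ) (N : ℕ) (x : Plane) : ℝ :=
  if h : ∃ i < N, x ∈ strip c i then cellPotential c h.choose x else 0

lemma Paths.potential_eq (hC : Paths k N C) {a : ℕ} (ha : a < k) {i : ℕ} (hi : i < N) {x : Plane}
    (hx : x ∈ strip (C a) i) : potential (C a) N x = cellPotential (C a) i x := by
  have h : ∃ i < N, x ∈ strip (C a) i := ⟨i, hi, hx⟩
  rw [potential, dif_pos h]
  obtain ⟨hj, hxj⟩ := h.choose_spec
  generalize h.choose = j at *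
  by_cases hij : i = j
  · rw [hij]
  · rcases (hC.strip_inter_strip ha ha hi hj (fun e => hij e.2) hx hxj).2 with ⟨e, hg⟩ | ⟨e, hg⟩
    · subst e
      rw [hC.cellPotential_gate ha hj hg, cellPotential_gate_self hg]
    · subst e
      rw [hC.cellPotential_gate ha hi hg, cellPotential_gate_self hg]

lemma potential_eq_zero {c : ℕ → ℤ × ℤ} {x : Plane} (h : x ∉ arm c N) : potential c N x = 0 :=
  dif_neg h

lemma isClosed_strip (c : ℕ → ℤ × ℤ) (i : ℕ) : IsClosed (strip c i) :=
  (isClosed_tri _ _ _).union (isClosed_tri _ _ _)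

lemma mem_bigSet {W : ℝ} {m : ℕ} {x : Plane} : x ∈ bigSet k N C W m ↔
    x ∈ base W m m ∨ ∃ a < k, ∃ i < N, x ∈ strip (C a) i := by
  simp [bigSet, arm]

lemma isClosed_base (W : ℝ) (m : ℕ) : IsClosed (base W m m) := by
  refine (Set.Finite.isCompact_convexHull (𝕜 := ℝ) (Set.Finite.image _ ?_)).isClosed
  refine (Set.toFinite _).union ?_
  refine ((Set.finite_lt_nat m).image fun i : ℕ => (i : ℝ) / m).subset ?_
  rintro u ⟨i, hi, rfl⟩
  exact ⟨i, hi, rfl⟩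

/-- The base and the cells are finitely many closed pieces. On cells of arm `a` the potential is a
truncated distance; on the base and on the other arms it vanishes, also at the shared gate, where it
starts from zero. -/
lemma Paths.potential_lipschitz (hC : Paths k N C) {W : ℝ} (hW : 0 ≤ W) {m : ℕ} {a : ℕ}
    (ha : a < k) : ∀ x ∈ bigSet k N C W m, ∀ᶠ y in nhds x, y ∈ bigSet k N C W m →
      dist (potential (C a) N y) (potential (C a) N x) ≤ dist y x := by
  let D : Option (ℕ × ℕ) → Set Plane := fun o =>
    o.elim (base W m m) fun p => strip (C p.1) p.2
  let s : Finset (Option (ℕ × ℕ)) := insert none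
    ((Finset.range k ×ˢ Finset.range N).image some)
  have mem_s : ∀ o, o ∈ s ↔ o = none ∨ ∃ b < k, ∃ i < N, o = some (b, i) := by
    intro o
    simp only [s, Finset.mem_insert, Finset.mem_image, Finset.mem_product, Finset.mem_range,
      Prod.exists]
    constructor
    · rintro (h | ⟨b, i, ⟨hb, hi⟩, rfl⟩)
      · exact Or.inl h
      · exact Or.inr ⟨b, hb, i, hi, rfl⟩
    · rintro (h | ⟨b, hb, i, hi, rfl⟩)
      · exact Or.inl h
      · exact Or.inr ⟨b, i, ⟨hb, hi⟩, rfl⟩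
  have zero_base : ∀ x ∈ base W m m, potential (C a) N x = 0 := by
    intro x hx
    by_cases h : x ∈ arm (C a) N
    · obtain ⟨i, hi, hxi⟩ := h
      obtain ⟨rfl, hg⟩ := hC.strip_inter_lower ha hi hxi (base_lower hW le_rfl hx)
      rw [hC.potential_eq ha hi hxi, cellPotential_gate_self hg]; simp
    · exact potential_eq_zero h
  apply eventually_dist_le (s := s) (D := D)
  · intro o ho
    rcases (mem_s o).1 ho with rfl | ⟨b, hb, i, hi, rfl⟩
    · exact isClosed_base W m
    · exact isClosed_strip _ _
  · intro x hx
    rcases mem_bigSet.1 hx with h | ⟨b, hb, i, hi, h⟩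
    · exact ⟨none, (mem_s _).2 (Or.inl rfl), h⟩
    · exact ⟨some (b, i), (mem_s _).2 (Or.inr ⟨b, hb, i, hi, rfl⟩), h⟩
  · intro o ho x hx y hy
    rcases (mem_s o).1 ho with rfl | ⟨b, hb, i, hi, rfl⟩
    · rw [zero_base x hx, zero_base y hy, dist_self]; exact dist_nonneg
    · by_cases hab : b = a
      · subst hab
        rw [hC.potential_eq ha hi hx, hC.potential_eq ha hi hy]
        exact dist_cellPotential_le _ _ _ _
      · have hz : ∀ z ∈ strip (C b) i, potential (C a) N z = 0 := by
          intro z hz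
          apply potential_eq_zero
          rintro ⟨j, hj, hzj⟩
          exact hab (hC.strip_inter_strip hb ha hi hj (fun h => hab h.1) hz hzj).1
        rw [hz x hx, hz y hy, dist_self]; exact dist_nonneg

lemma top_mem_base {W X : ℝ} (h1 : -W ≤ X) (h2 : X ≤ W) (m j : ℕ) : top X ∈ base W m j := by
  rcases eq_or_lt_of_le (h1.trans h2) with h | h
  · obtain rfl : X = W := by linarith
    rw [top_eq_para_right]
    exact subset_convexHull _ _ ⟨-1, by simp, rfl⟩
  have p1 : top W ∈ base W m j := by
    rw [top_eq_para_right]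
    exact subset_convexHull _ _ ⟨-1, by simp, rfl⟩
  have p2 : top (-W) ∈ base W m j := by
    rw [top_eq_para_left]
    exact subset_convexHull _ _ ⟨1, by simp, rfl⟩
  have hW : 0 < 2 * W := by linarith
  have hW' : W ≠ 0 := by linarith
  have hc : ((X + W) / (2 * W)) • top W + ((W - X) / (2 * W)) • top (-W) ∈ base W m j :=
    convex_convexHull ℝ _ p1 p2
      (div_nonneg (by linarith) hW.le) (div_nonneg (by linarith) hW.le) (by field_simp; ring)
  suffices h : top X = ((X + W) / (2 * W)) • top W + ((W - X) / (2 * W)) • top (-W) by rwa [h]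
  apply plane_ext
  · simp only [PiLp.add_apply, PiLp.smul_apply, smul_eq_mul, top_zero]; field_simp; ring
  · simp only [PiLp.add_apply, PiLp.smul_apply, smul_eq_mul, top_one]; field_simp; ring

lemma L_mem_bigSet {W : ℝ} {m a : ℕ} (ha : a < k) (hN : 1 ≤ N) {n : ℕ} (hn : n ≤ N) :
    L (C a) n ∈ bigSet k N C W m := by
  rw [mem_bigSet]
  right
  rcases hn.lt_or_eq with h | rfl
  · exact ⟨a, ha, n, h, Or.inl (left_mem_tri _ _ _)⟩
  · obtain ⟨n, rfl⟩ : ∃ n', n = n' + 1 := ⟨n - 1, by omega⟩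
    exact ⟨a, ha, n, by omega, Or.inl (mid_mem_tri _ _ _)⟩

/-- The comparison path crosses the base along a segment and then follows the left posts of the arm.
-/
lemma Paths.geodesicDist_post_le (hC : Paths k N C) {W : ℝ} {m a : ℕ} (ha : a < k) (hN : 1 ≤ N)
    (hrange : ∀ a < k, -W < ((C a 0).1 : ℝ) - 1 / 32 ∧ ((C a 0).1 : ℝ) + 1 / 32 < W)
    {o : ℕ} (ho : o < k) {ρ : ℝ} (hρ : dist (L (C o) 0) (L (C a) 0) ≤ ρ) :
    ∀ n (hn : n ≤ N), geodesicDist (bigSet k N C W m) ⟨L (C o) 0, L_mem_bigSet ho hN (Nat.zero_le _)⟩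
      ⟨L (C a) n, L_mem_bigSet ha hN hn⟩ ≤ ENNReal.ofReal (ρ + 21 / 20 * n)
  | 0, hn => by
    refine (geodesicDist_le_of_segment _ _ ?_).trans (ENNReal.ofReal_le_ofReal (by simpa using hρ))
    have hb : ∀ b < k, L (C b) 0 ∈ base W m m := by
      intro b hb
      rw [hC.L_zero hb]
      have := hrange b hb
      exact top_mem_base this.1.le (by linarith) _ _
    intro z hz
    exact Or.inl ((convex_convexHull ℝ _).segment_subset (hb o ho) (hb a ha) hz)
  | n + 1, hn => by
    have hρ0 : 0 ≤ ρ := dist_nonneg.trans hρ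
    have ih := hC.geodesicDist_post_le (m := m) ha hN hrange ho hρ n (by omega)
    have hn' : n < N := hn
    have step : geodesicDist (bigSet k N C W m) ⟨L (C a) n, L_mem_bigSet ha hN hn'.le⟩
        ⟨L (C a) (n + 1), L_mem_bigSet ha hN hn⟩ ≤ ENNReal.ofReal (21 / 20) := by
      refine (geodesicDist_le_of_segment _ _ ?_).trans (ENNReal.ofReal_le_ofReal
        (post_dist (hC.adj a ha n hn'.le) (hC.adj a ha (n + 1) hn) (hC.ne ha hn') (widths_wd n)))
      intro z hz
      exact mem_bigSet.2 (Or.inr ⟨a, ha, n, hn', Or.inl (segment_left_mid_subset_tri _ _ _ hz)⟩)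
    refine (geodesicDist_triangle _ _ _).trans ((add_le_add ih step).trans ?_)
    rw [← ENNReal.ofReal_add (by positivity) (by norm_num)]
    apply ENNReal.ofReal_le_ofReal
    push_cast
    linarith

/-- The tips of the arms force the doubling constant to be at least the number of arms. -/
theorem Paths.le_of_isDoubling (hC : Paths k N C) {W : ℝ} (hW : 0 ≤ W) {m : ℕ} (hN : 1 ≤ N)
    (hrange : ∀ a < k, -W < ((C a 0).1 : ℝ) - 1 / 32 ∧ ((C a 0).1 : ℝ) + 1 / 32 < W)
    {ρ : ℝ} (hρ : ∀ a < k, ∀ b < k, dist (L (C a) 0) (L (C b) 0) ≤ ρ) (hρN : ρ < 3 / 20 * N)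
    {k' : ℕ} (hd : IsDoubling (geodesicDist (bigSet k N C W m)) k') : k ≤ k' := by
  rcases Nat.eq_zero_or_pos k with rfl | hk
  · exact Nat.zero_le _
  let tip : ∀ a, a < k → bigSet k N C W m := fun a ha => ⟨L (C a) N, L_mem_bigSet ha hN le_rfl⟩
  have hρ0 : 0 ≤ ρ := dist_nonneg.trans (hρ 0 hk 0 hk)
  have hN0 : (1 : ℝ) ≤ N := by exact_mod_cast hN
  -- All tips lie within `r` of one arm foot. The hypothesis `ρ < 3 / 20 * N` says exactly that `r /
  -- 2 < 3 / 5 * N`, the potential at a tip.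
  set r : ℝ := ρ + 21 / 20 * N with hr
  obtain ⟨s, hs, hcov⟩ := hd ⟨L (C 0) 0, L_mem_bigSet hk hN (Nat.zero_le _)⟩ r (by positivity)
  have hz : ∀ a : Fin k, ∃ z ∈ s, geodesicDist (bigSet k N C W m) z (tip a a.2) ≤
      ENNReal.ofReal (r / 2) := fun a =>
    hcov _ (hC.geodesicDist_post_le a.2 hN hrange hk (hρ 0 hk a a.2) N le_rfl)
  choose z hzs hzd using hz
  -- A centre outside arm `a` has potential zero, hence is farther than `r / 2` from the tip of that
  -- arm.
  have harm : ∀ a : Fin k, (z a : Plane) ∈ arm (C a) N := by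
    intro a
    by_contra hcon
    have h1 := (le_geodesicDist (hC.potential_lipschitz hW (m := m) a.2) (z a) (tip a a.2)).trans
      (hzd a)
    rw [potential_eq_zero hcon, edist_dist, ENNReal.ofReal_le_ofReal_iff (by positivity),
      Real.dist_eq, sub_zero] at h1
    obtain ⟨n, rfl⟩ : ∃ n, N = n + 1 := ⟨N - 1, by omega⟩
    have hg : L (C a) (n + 1) ∈ gate (C a) (n + 1) := left_mem_segment _ _ _
    have : potential (C a) (n + 1) (tip a a.2) = 3 / 5 * ((n + 1 : ℕ) : ℝ) := by
      rw [hC.potential_eq a.2 (Nat.lt_succ_self n) (Or.inr (gate_subset_triR _ _ hg)),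
        hC.cellPotential_gate a.2 (Nat.lt_succ_self n) hg]
    rw [this, abs_of_nonneg (by positivity)] at h1
    linarith
  have hinj : Function.Injective z := by
    intro a b hab
    obtain ⟨i, hi, hzi⟩ := harm a
    obtain ⟨j, hj, hzj⟩ := harm b
    rw [← hab] at hzj
    by_contra hne
    have hne' : ¬ ((a : ℕ) = b) := fun h => hne (Fin.ext h)
    exact hne' (hC.strip_inter_strip a.2 b.2 hi hj (fun h => hne' h.1) hzi hzj).1
  calc k = Fintype.card (Fin k) := (Fintype.card_fin k).symm
    _ = (Finset.univ.image z).card := by rw [Finset.card_image_of_injective _ hinj]; rfl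
    _ ≤ s.card := Finset.card_le_card (by
        intro x hx
        obtain ⟨a, -, rfl⟩ := Finset.mem_image.1 hx
        exact hzs a)
    _ ≤ k' := hs

end

/-! ### Area estimates for local fatness -/

section

open MeasureTheory

section fat

lemma volume_closedBall_plane (p : Plane) {r : ℝ} (hr : 0 ≤ r) :
    volume (Metric.closedBall p r) = ENNReal.ofReal (r ^ 2) * volume (Metric.ball (0 : Plane) 1) := by
  rw [Measure.addHaar_closedBall _ _ hr]
  simp

/-- A connected set that contains the centre of a disk bounds from below the component of the
centre; its area is estimated by disjoint small disks. -/
lemma fat_of_closedBalls {ι : Type*} {A P : Set Plane} {p : Plane} {r γ δ : ℝ} (hγ : 0 ≤ γ)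
    (hr : 0 ≤ r) (hδ : 0 ≤ δ) (hA : IsPreconnected A) (hp : p ∈ A)
    (hAP : A ⊆ Metric.closedBall p r ∩ P) (s : Finset ι) (q : ι → Plane)
    (hq : ∀ j ∈ s, Metric.closedBall (q j) δ ⊆ A)
    (hdisj : ∀ i ∈ s, ∀ j ∈ s, i ≠ j →
      Disjoint (Metric.closedBall (q i) δ) (Metric.closedBall (q j) δ))
    (hc : γ * r ^ 2 ≤ s.card * δ ^ 2) :
    ENNReal.ofReal γ * volume (Metric.closedBall p r) ≤
      volume (connectedComponentIn (Metric.closedBall p r ∩ P) p) := by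
  have h1 : A ⊆ connectedComponentIn (Metric.closedBall p r ∩ P) p :=
    hA.subset_connectedComponentIn hp hAP
  have h2 : (⋃ j ∈ s, Metric.closedBall (q j) δ) ⊆
      connectedComponentIn (Metric.closedBall p r ∩ P) p :=
    Set.Subset.trans (Set.iUnion₂_subset hq) h1
  refine le_trans ?_ (measure_mono h2)
  rw [measure_biUnion_finset (fun i hi j hj hij => hdisj i hi j hj hij)
    fun _ _ => Metric.isClosed_closedBall.measurableSet]
  simp_rw [volume_closedBall_plane _ hδ, volume_closedBall_plane _ hr]
  rw [Finset.sum_const, nsmul_eq_mul, ← mul_assoc, ← mul_assoc, ← ENNReal.ofReal_mul hγ,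
    ← ENNReal.ofReal_natCast, ← ENNReal.ofReal_mul (Nat.cast_nonneg _)]
  gcongr

lemma fat_of_closedBall {A P : Set Plane} {p q : Plane} {r γ δ : ℝ} (hγ : 0 ≤ γ)
    (hr : 0 ≤ r) (hδ : 0 ≤ δ) (hA : IsPreconnected A) (hp : p ∈ A)
    (hAP : A ⊆ Metric.closedBall p r ∩ P) (hq : Metric.closedBall q δ ⊆ A)
    (hc : γ * r ^ 2 ≤ δ ^ 2) :
    ENNReal.ofReal γ * volume (Metric.closedBall p r) ≤
      volume (connectedComponentIn (Metric.closedBall p r ∩ P) p) :=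
  fat_of_closedBalls hγ hr hδ hA hp hAP {()} (fun _ => q) (fun _ _ => hq)
    (fun _ _ _ _ h => (h rfl).elim) (by simpa using hc)

/-- The homothety with centre `p` and ratio `r / ρ` maps the convex set `E` into itself and into the
disk of radius `r`, and it scales the inscribed disk accordingly. -/
lemma exists_closedBall_subset_inter {E : Set Plane} (hE : Convex ℝ E) {p q : Plane} {η ρ r : ℝ}
    (hr : 0 < r) (hrρ : r ≤ ρ) (hq : Metric.closedBall q (η * ρ) ⊆ E)
    (hEp : E ⊆ Metric.closedBall p ρ) (hp : p ∈ E) :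
    ∃ q', Metric.closedBall q' (η * r) ⊆ E ∩ Metric.closedBall p r := by
  have hρ : 0 < ρ := hr.trans_le hrρ
  refine ⟨p + (r / ρ) • (q - p), fun y hy => ?_⟩
  set z : Plane := p + (ρ / r) • (y - p) with hz
  have hyz : y = p + (r / ρ) • (z - p) := by
    rw [hz, add_sub_cancel_left, smul_smul, show r / ρ * (ρ / r) = 1 by field_simp, one_smul,
      add_sub_cancel]
  have hzE : z ∈ E := by
    apply hq
    rw [Metric.mem_closedBall, dist_eq_norm] at hy ⊢
    have : z - q = (ρ / r) • (y - (p + (r / ρ) • (q - p))) := by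
      rw [hz, sub_add_eq_sub_sub y, smul_sub (ρ / r) (y - p), smul_smul,
        show ρ / r * (r / ρ) = 1 by field_simp, one_smul]
      abel
    rw [this, norm_smul, Real.norm_of_nonneg (by positivity)]
    calc ρ / r * _ ≤ ρ / r * (η * r) := by gcongr
      _ = η * ρ := by field_simp
  constructor
  · rw [hyz]
    exact hE.add_smul_sub_mem hp hzE ⟨by positivity, (div_le_one hρ).2 hrρ⟩
  · have := hEp hzE
    rw [Metric.mem_closedBall, dist_eq_norm] at this ⊢
    rw [hyz, add_sub_cancel_left, norm_smul, Real.norm_of_nonneg (by positivity)]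
    calc r / ρ * ‖z - p‖ ≤ r / ρ * ρ := by gcongr
      _ = r := by field_simp

lemma fat_of_convex {E P : Set Plane} (hE : Convex ℝ E) (hEP : E ⊆ P) {p q : Plane} {η ρ r γ : ℝ}
    (hr : 0 < r) (hrρ : r ≤ ρ) (hq : Metric.closedBall q (η * ρ) ⊆ E) (hη : 0 ≤ η)
    (hEp : E ⊆ Metric.closedBall p ρ) (hp : p ∈ E) (hγ : 0 ≤ γ) (hγη : γ ≤ η ^ 2) :
    ENNReal.ofReal γ * volume (Metric.closedBall p r) ≤
      volume (connectedComponentIn (Metric.closedBall p r ∩ P) p) := by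
  obtain ⟨q', hq'⟩ := exists_closedBall_subset_inter hE hr hrρ hq hEp hp
  refine fat_of_closedBall hγ hr.le (by positivity)
    (hE.inter (convex_closedBall p r)).isPreconnected ⟨hp, Metric.mem_closedBall_self hr.le⟩
    (fun z hz => ⟨hz.2, hEP hz.1⟩) hq' ?_
  rw [mul_pow]; gcongr

lemma abs_cr_sub_le {u w y g : Plane} {D δ : ℝ} (hy : dist y g ≤ δ) (h0 : |u 0 - w 0| ≤ D)
    (h1 : |u 1 - w 1| ≤ D) : |cr u y w - cr u g w| ≤ 2 * D * δ := by
  have e : cr u y w - cr u g w = (y 1 - g 1) * (u 0 - w 0) - (y 0 - g 0) * (u 1 - w 1) := by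
    unfold cr; ring
  obtain ⟨a0, a1⟩ := abs_coord_le y g
  have hδ := (abs_nonneg _).trans (a0.trans hy)
  rw [e]
  refine (abs_sub _ _).trans ?_
  rw [abs_mul, abs_mul]
  have := mul_le_mul (a1.trans hy) h0 (abs_nonneg _) hδ
  have := mul_le_mul (a0.trans hy) h1 (abs_nonneg _) hδ
  linarith

/-- The centroid of a triangle. -/
def centroid (p x q : Plane) : Plane := (1 / 3 : ℝ) • p + (1 / 3 : ℝ) • x + (1 / 3 : ℝ) • q

/-- A triangle contains a disk around its centroid on which the barycentric coordinates are
positive. -/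
lemma bary_pos_of_dist_le {p x q : Plane} {D δ : ℝ} (h : 6 * D * δ < |cr p x q|)
    (hpx : |p 0 - x 0| ≤ D ∧ |p 1 - x 1| ≤ D) (hxq : |x 0 - q 0| ≤ D ∧ |x 1 - q 1| ≤ D)
    (hpq : |p 0 - q 0| ≤ D ∧ |p 1 - q 1| ≤ D) {y : Plane}
    (hy : dist y (centroid p x q) ≤ δ) :
    0 < bary x p q y ∧ 0 < bary p x q y ∧ 0 < bary p q x y := by
  set g : Plane := centroid p x q with hg
  -- At the centroid each determinant is a third of the full one, and within distance `δ` it changes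
  -- by at most `2 * D * δ`.
  have key : ∀ {u v w : Plane}, |cr u v w| = |cr p x q| → cr u g w = cr u v w / 3 →
      (|u 0 - w 0| ≤ D ∧ |u 1 - w 1| ≤ D) → 0 < bary u v w y := by
    intro u v w h1 h2 h3
    have h4 := abs_cr_sub_le hy h3.1 h3.2
    rw [h2] at h4
    rw [← h1] at h
    rw [abs_le] at h4
    unfold bary
    rcases lt_or_ge (cr u v w) 0 with hs | hs
    · rw [abs_of_neg hs] at h
      exact div_pos_of_neg_of_neg (by linarith) hs
    · rw [abs_of_nonneg hs] at h
      have hD : 0 ≤ D * δ := mul_nonneg ((abs_nonneg _).trans h3.1) (dist_nonneg.trans hy)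
      exact div_pos (by linarith) (by linarith)
  refine ⟨key ?_ ?_ hxq, key rfl ?_ hpq, key ?_ ?_ ⟨?_, ?_⟩⟩
  · rw [cr_swap_left, abs_neg]
  · simp only [cr, hg, centroid, PiLp.add_apply, PiLp.smul_apply, smul_eq_mul]; ring
  · simp only [cr, hg, centroid, PiLp.add_apply, PiLp.smul_apply, smul_eq_mul]; ring
  · rw [cr_swap_right, abs_neg]
  · simp only [cr, hg, centroid, PiLp.add_apply, PiLp.smul_apply, smul_eq_mul]; ring
  · exact hpx.1
  · exact hpx.2

end fat

section cells

variable {k N : ℕ} {C : ℕ → ℕ → ℤ × ℤ}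

lemma Paths.abs_sub_le_of_mem_strip (hC : Paths k N C) {a : ℕ} (ha : a < k) {i : ℕ} (hi : i < N)
    {z : Plane} (hz : z ∈ strip (C a) i) :
    |z 0 - (C a (i + 1)).1| ≤ 9 / 16 ∧ |z 1 - (C a (i + 1)).2| ≤ 9 / 16 := by
  rcases hC.strip_subset ha hi hz with (⟨h1, h2⟩ | h) | h
  · exact ⟨by linarith, by linarith⟩
  · obtain ⟨h1, h2⟩ := abs_sub_of_mem_gate (hC.adj a ha i hi.le) h
    push_cast at h1 h2
    rw [abs_le] at *
    rw [abs_le]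
    rcases (hC.adj a ha i hi.le).cast with ⟨e1, e2⟩ | ⟨e1, e2⟩ | ⟨e1, e2⟩ | ⟨e1, e2⟩ <;>
      rw [e1] at h1 ⊢ <;> rw [e2] at h2 ⊢ <;>
      exact ⟨⟨by linarith, by linarith⟩, ⟨by linarith, by linarith⟩⟩
  · obtain ⟨h1, h2⟩ := abs_sub_of_mem_gate (hC.adj a ha (i + 1) hi) h
    push_cast at h1 h2
    rw [abs_le] at *
    rw [abs_le]
    rcases (hC.adj a ha (i + 1) hi).cast with ⟨e1, e2⟩ | ⟨e1, e2⟩ | ⟨e1, e2⟩ | ⟨e1, e2⟩ <;>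
      rw [e1] at h1 <;> rw [e2] at h2 <;>
      exact ⟨⟨by linarith, by linarith⟩, ⟨by linarith, by linarith⟩⟩

lemma Paths.abs_sub_le_of_mem_strips (hC : Paths k N C) {a : ℕ} (ha : a < k) {i j : ℕ} (hi : i < N)
    (hj : j < N) {D : ℝ} (h0 : |((C a (i + 1)).1 : ℝ) - (C a (j + 1)).1| ≤ D)
    (h1 : |((C a (i + 1)).2 : ℝ) - (C a (j + 1)).2| ≤ D)
    {y z : Plane} (hy : y ∈ strip (C a) i) (hz : z ∈ strip (C a) j) :
    |y 0 - z 0| ≤ D + 9 / 8 ∧ |y 1 - z 1| ≤ D + 9 / 8 := by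
  obtain ⟨a1, a2⟩ := hC.abs_sub_le_of_mem_strip ha hi hy
  obtain ⟨b1, b2⟩ := hC.abs_sub_le_of_mem_strip ha hj hz
  rw [abs_le] at *
  rw [abs_le]
  exact ⟨⟨by linarith, by linarith⟩, ⟨by linarith, by linarith⟩⟩

lemma Paths.abs_sub_le_of_mem_cell (hC : Paths k N C) {a : ℕ} (ha : a < k) {i : ℕ} (hi : i < N)
    {y z : Plane} (hy : y ∈ strip (C a) i) (hz : z ∈ strip (C a) i) :
    |y 0 - z 0| ≤ 9 / 8 ∧ |y 1 - z 1| ≤ 9 / 8 := by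
  have := hC.abs_sub_le_of_mem_strips ha hi hi (D := 0) (by simp) (by simp) hy hz
  simpa using this

lemma posts_mem_strip (c : ℕ → ℤ × ℤ) (i : ℕ) : L c i ∈ strip c i ∧ L c (i + 1) ∈ strip c i ∧
    R c i ∈ strip c i ∧ R c (i + 1) ∈ strip c i :=
  ⟨Or.inl (left_mem_tri _ _ _), Or.inl (mid_mem_tri _ _ _), Or.inl (right_mem_tri _ _ _),
    Or.inr (mid_mem_tri _ _ _)⟩

/-- Keeping the disk inside the open unit square as well makes the disks of different cells
disjoint, so that their areas add up. Positive barycentric coordinates keep its points off both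
gates. The radius `1 / 500` satisfies `6 * (9 / 8) / 500 < 1 / 40`. -/
lemma Paths.exists_closedBall_subset_triL (hC : Paths k N C) {a : ℕ} (ha : a < k) {i : ℕ}
    (hi : i < N) : ∃ q, Metric.closedBall q (1 / 500) ⊆ triL (C a) i ∩ box (C a (i + 1)) := by
  have hcr := hC.cr_triL ha hi
  have h0 : cr (L (C a) i) (L (C a) (i + 1)) (R (C a) i) ≠ 0 := by linarith
  obtain ⟨m1, m2, m3, m4⟩ := posts_mem_strip (C a) i
  refine ⟨centroid (L (C a) i) (L (C a) (i + 1)) (R (C a) i), fun y hy => ?_⟩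
  have hb := bary_pos_of_dist_le (D := 9 / 8) (δ := 1 / 500)
    (by rw [abs_of_neg (by linarith)]; linarith) (hC.abs_sub_le_of_mem_cell ha hi m1 m2)
    (hC.abs_sub_le_of_mem_cell ha hi m2 m3) (hC.abs_sub_le_of_mem_cell ha hi m1 m3) hy
  have hy : y ∈ triL (C a) i := (mem_tri_iff h0).2 ⟨hb.1.le, hb.2.1.le, hb.2.2.le⟩
  refine ⟨hy, ?_⟩
  rcases hC.strip_subset ha hi (Or.inl hy) with (h | h) | h
  · exact h
  · exact absurd (bary_eq_zero_of_mem_segment h) hb.2.1.ne'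
  · have : y ∈ triL (C a) i ∩ triR (C a) i := ⟨hy, gate_subset_triR _ _ h⟩
    rw [hC.triL_inter_triR ha hi] at this
    exact absurd (bary_eq_zero_of_mem_segment this) hb.1.ne'

lemma Paths.exists_closedBall_subset_triR (hC : Paths k N C) {a : ℕ} (ha : a < k) {i : ℕ}
    (hi : i < N) : ∃ q, Metric.closedBall q (1 / 500) ⊆ triR (C a) i := by
  have hcr := hC.cr_triR ha hi
  have h0 : cr (L (C a) (i + 1)) (R (C a) (i + 1)) (R (C a) i) ≠ 0 := by linarith
  obtain ⟨m1, m2, m3, m4⟩ := posts_mem_strip (C a) i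
  refine ⟨centroid (L (C a) (i + 1)) (R (C a) (i + 1)) (R (C a) i), fun y hy => ?_⟩
  have hb := bary_pos_of_dist_le (D := 9 / 8) (δ := 1 / 500)
    (by rw [abs_of_neg (by linarith)]; linarith) (hC.abs_sub_le_of_mem_cell ha hi m2 m4)
    (hC.abs_sub_le_of_mem_cell ha hi m4 m3) (hC.abs_sub_le_of_mem_cell ha hi m2 m3) hy
  exact (mem_tri_iff h0).2 ⟨hb.1.le, hb.2.1.le, hb.2.2.le⟩

/-- Fatness at a point of an arm for small radii. -/
lemma Paths.fat_of_le (hC : Paths k N C) {a : ℕ} (ha : a < k) {i : ℕ} (hi : i < N) {P : Set Plane}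
    (hP : strip (C a) i ⊆ P) {p : Plane} (hp : p ∈ strip (C a) i) {r : ℝ} (hr : 0 < r)
    (hr' : r ≤ 12) :
    ENNReal.ofReal (1 / 10 ^ 9) * volume (Metric.closedBall p r) ≤
      volume (connectedComponentIn (Metric.closedBall p r ∩ P) p) := by
  have key : ∀ (E : Set Plane) (q : Plane), Convex ℝ E → E ⊆ strip (C a) i → p ∈ E →
      Metric.closedBall q (1 / 500) ⊆ E → ENNReal.ofReal (1 / 10 ^ 9) *
        volume (Metric.closedBall p r) ≤
          volume (connectedComponentIn (Metric.closedBall p r ∩ P) p) := by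
    intro E q hE hEs hpE hq
    -- The triangle fits in a disk of radius `12`, and `12 / 6000` is the radius of its inscribed
    -- disk.
    refine fat_of_convex hE (hEs.trans hP) hr hr' (η := 1 / 6000) (q := q) ?_ (by norm_num) ?_ hpE
      (by positivity) (by norm_num)
    · convert hq using 2; norm_num
    · intro z hz
      obtain ⟨h0, h1⟩ := hC.abs_sub_le_of_mem_cell ha hi (hEs hz) hp
      rw [Metric.mem_closedBall]
      exact (dist_le_of_abs h0 h1).trans (by norm_num)
  rcases hp with h | h
  · obtain ⟨q, hq⟩ := hC.exists_closedBall_subset_triL ha hi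
    exact key _ q (convex_tri _ _ _) Set.subset_union_left h fun y hy => (hq hy).1
  · obtain ⟨q, hq⟩ := hC.exists_closedBall_subset_triR ha hi
    exact key _ q (convex_tri _ _ _) Set.subset_union_right h hq

lemma isPreconnected_strip (c : ℕ → ℤ × ℤ) (i : ℕ) : IsPreconnected (strip c i) :=
  IsPreconnected.union (L c (i + 1)) (mid_mem_tri _ _ _) (left_mem_tri _ _ _)
    (convex_tri _ _ _).isPreconnected (convex_tri _ _ _).isPreconnected

lemma isPreconnected_strips (c : ℕ → ℤ × ℤ) (i j : ℕ) :
    IsPreconnected (⋃ n ∈ Set.Icc i j, strip c n) :=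
  IsPreconnected.biUnion_of_chain Set.ordConnected_Icc (fun n _ => isPreconnected_strip c n)
    fun n _ _ => ⟨L c (n + 1), (posts_mem_strip c n).2.1, (posts_mem_strip c (n + 1)).1⟩

end cells

section hilbert

/-- Cells of the Hilbert path whose indices are close are close in the plane. -/
lemma hilbert_window (l s : ℕ) {i j : ℕ} (hi : i < 4 ^ l) (hji : j ≤ i) (hij : i < j + 4 ^ s) :
    |(hilbert l i).1 - (hilbert l j).1| < 2 * 2 ^ s ∧
    |(hilbert l i).2 - (hilbert l j).2| < 2 * 2 ^ s := by
  have h2 : (0 : ℤ) < 2 ^ s := by positivity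
  have h4 : 0 < 4 ^ s := by positivity
  by_cases hb : i / 4 ^ s = j / 4 ^ s
  · obtain ⟨h0, h1⟩ := hilbert_block l s hi (hji.trans_lt hi) hb
    exact ⟨by linarith, by linarith⟩
  · have hd : i / 4 ^ s = j / 4 ^ s + 1 := by
      have h5 : j / 4 ^ s ≤ i / 4 ^ s := Nat.div_le_div_right hji
      have h6 : i / 4 ^ s ≤ (j + 4 ^ s) / 4 ^ s := Nat.div_le_div_right hij.le
      rw [Nat.add_div_right _ h4] at h6
      omega
    obtain ⟨e, he⟩ : ∃ e, (j / 4 ^ s + 1) * 4 ^ s = e + 1 :=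
      ⟨(j / 4 ^ s + 1) * 4 ^ s - 1, by have : 0 < (j / 4 ^ s + 1) * 4 ^ s := by positivity
                                       omega⟩
    have hei : e + 1 ≤ i := by rw [← he, ← hd]; exact Nat.div_mul_le_self _ _
    have e1 : (e + 1) / 4 ^ s = i / 4 ^ s := by rw [← he, hd, Nat.mul_div_cancel _ h4]
    have e2 : e / 4 ^ s = j / 4 ^ s := by
      apply Nat.div_eq_of_lt_le
      · rw [add_mul] at he; omega
      · rw [he]; omega
    obtain ⟨a0, a1⟩ := hilbert_block l s hi (show e + 1 < 4 ^ l by omega) e1.symm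
    obtain ⟨b0, b1⟩ := hilbert_block l s (show e < 4 ^ l by omega) (hji.trans_lt hi) e2
    have hadj := hilbert_adj l (show e + 1 < 4 ^ l by omega)
    unfold Adj at hadj
    rw [abs_lt] at *
    rw [abs_lt]
    omega

end hilbert

end

/-! ### Local fatness of the polygon -/

section

open MeasureTheory

lemma convex_base (W : ℝ) (m j : ℕ) : Convex ℝ (base W m j) := convex_convexHull ℝ _

lemma base_subset_rectangle {W : ℝ} (hW : 0 ≤ W) (m : ℕ) :
    ∀ z ∈ base W m m, |z 0| ≤ W ∧ -1 / 2 - W ≤ z 1 := by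
  have h : base W m m ⊆ {z | -W ≤ z 0} ∩ {z | z 0 ≤ W} ∩ {z | -1 / 2 - W ≤ z 1} := by
    apply convexHull_min
    · rintro v ⟨u, hu, rfl⟩
      have hu' : -1 ≤ u ∧ u ≤ 1 := by
        rcases hu with (rfl | rfl) | ⟨i, hi, rfl⟩
        · norm_num
        · norm_num
        · have hm : (0 : ℝ) < m := by exact_mod_cast (Nat.zero_le i).trans_lt hi
          have him : (i : ℝ) ≤ m := by exact_mod_cast hi.le
          exact ⟨by linarith [show (0 : ℝ) ≤ i / m by positivity], (div_le_one hm).2 him⟩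
      refine ⟨⟨?_, ?_⟩, ?_⟩ <;> simp only [Set.mem_ofPred_eq, para_zero, para_one] <;>
        nlinarith [mul_nonneg hW (sq_nonneg u)]
    · refine (Convex.inter ?_ ?_).inter ?_
      · exact convex_halfSpace_ge ⟨fun _ _ => rfl, fun _ _ => rfl⟩ _
      · exact convex_halfSpace_le ⟨fun _ _ => rfl, fun _ _ => rfl⟩ _
      · exact convex_halfSpace_ge ⟨fun _ _ => rfl, fun _ _ => rfl⟩ _
  intro z hz
  obtain ⟨⟨h1, h2⟩, h3⟩ := h hz
  exact ⟨abs_le.2 ⟨h1, h2⟩, h3⟩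

lemma exists_closedBall_subset_base {W : ℝ} (hW : 0 < W) {m : ℕ} (hm : 1 ≤ m) :
    ∃ q, Metric.closedBall q (1 / 50 * (5 * W)) ⊆ base W m m := by
  have v1 : para W (-1) ∈ base W m m := subset_convexHull _ _ ⟨-1, by simp, rfl⟩
  have v2 : para W 1 ∈ base W m m := subset_convexHull _ _ ⟨1, by simp, rfl⟩
  have v3 : para W 0 ∈ base W m m :=
    subset_convexHull _ _ ⟨0, Or.inr ⟨0, by omega, by simp⟩, rfl⟩
  have hcr : cr (para W (-1)) (para W 1) (para W 0) = 2 * W ^ 2 := by simp [cr]; ring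
  refine ⟨centroid (para W (-1)) (para W 1) (para W 0), fun y hy => ?_⟩
  -- The disk has radius `W / 10`, written as a fraction of `5 * W`, which bounds the diameter of
  -- the whole region.
  have hb := bary_pos_of_dist_le (D := 2 * W) (δ := 1 / 50 * (5 * W))
    (by rw [hcr, abs_of_pos (by positivity)]; nlinarith [mul_pos hW hW])
    (by simp only [para_zero, para_one, abs_le]
        exact ⟨⟨by linarith, by linarith⟩, by linarith, by linarith⟩)
    (by simp only [para_zero, para_one, abs_le]
        exact ⟨⟨by linarith, by linarith⟩, by linarith, by linarith⟩)
    (by simp only [para_zero, para_one, abs_le]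
        exact ⟨⟨by linarith, by linarith⟩, by linarith, by linarith⟩) hy
  have h0 : cr (para W (-1)) (para W 1) (para W 0) ≠ 0 := by rw [hcr]; positivity
  have : y ∈ tri (para W (-1)) (para W 1) (para W 0) :=
    (mem_tri_iff h0).2 ⟨hb.1.le, hb.2.1.le, hb.2.2.le⟩
  refine convexHull_min ?_ (convex_base W m m) this
  rintro z (rfl | rfl | rfl) <;> assumption

/-- The half-width of the polygon with `k` arms of size `2 ^ l`. -/
def width (k l : ℕ) : ℝ := (k + 1) * 2 ^ l

/-- The region of the polygon with `k` arms along Hilbert paths of order `l`. -/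
def hilbertSet (k l m : ℕ) : Set Plane := bigSet k (4 ^ l - 1) (hpath l) (width k l) m

lemma one_le_width (k l : ℕ) : 1 ≤ width k l :=
  one_le_mul_of_one_le_of_one_le (by linarith [Nat.cast_nonneg (α := ℝ) k])
    (one_le_pow₀ (by norm_num))

lemma base_subset_hilbertSet (k l m : ℕ) : base (width k l) m m ⊆ hilbertSet k l m :=
  Set.subset_union_left

lemma strip_subset_hilbertSet {k l m a i : ℕ} (ha : a < k) (hi : i < 4 ^ l - 1) :
    strip (hpath l a) i ⊆ hilbertSet k l m := fun _ hz =>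
  mem_bigSet.2 (Or.inr ⟨a, ha, i, hi, hz⟩)

lemma hilbertSet_subset_rectangle {k l m : ℕ} {z : Plane} (hz : z ∈ hilbertSet k l m) :
    |z 0| ≤ width k l ∧ -1 / 2 - width k l ≤ z 1 ∧ z 1 ≤ width k l := by
  have hw := one_le_width k l
  rcases mem_bigSet.1 hz with h | ⟨a, ha, i, hi, h⟩
  · obtain ⟨h1, h2⟩ := base_subset_rectangle (by linarith) m z h
    have h3 : z 1 ≤ -1 / 2 := base_lower (by linarith) le_rfl h
    exact ⟨h1, h2, by linarith⟩
  · obtain ⟨h0, h1⟩ := (paths_hpath k l).abs_sub_le_of_mem_strip ha hi h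
    obtain ⟨b1, b2, b3, b4⟩ := hilbert_mem l (show i < 4 ^ l by omega)
    rw [hpath_succ] at h0 h1
    push_cast at h0 h1
    have c1 : (0 : ℝ) ≤ (hilbert l i).1 := by exact_mod_cast b1
    have c2 : ((hilbert l i).1 : ℝ) + 1 ≤ 2 ^ l := by exact_mod_cast b2
    have c3 : (0 : ℝ) ≤ (hilbert l i).2 := by exact_mod_cast b3
    have c4 : ((hilbert l i).2 : ℝ) + 1 ≤ 2 ^ l := by exact_mod_cast b4
    have ha' : (a : ℝ) + 1 ≤ k := by exact_mod_cast ha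
    have hp : (0 : ℝ) < 2 ^ l := by positivity
    have d1 : ((a : ℝ) + 1) * 2 ^ l ≤ k * 2 ^ l := by gcongr
    have d2 : (0 : ℝ) ≤ a * 2 ^ l := by positivity
    rw [abs_le] at *
    unfold width at *
    refine ⟨⟨?_, ?_⟩, ?_, ?_⟩ <;> linarith

lemma dist_le_of_mem_hilbertSet {k l m : ℕ} {y z : Plane} (hy : y ∈ hilbertSet k l m)
    (hz : z ∈ hilbertSet k l m) : dist y z ≤ 5 * width k l := by
  have hw := one_le_width k l
  obtain ⟨a1, a2, a3⟩ := hilbertSet_subset_rectangle hy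
  obtain ⟨b1, b2, b3⟩ := hilbertSet_subset_rectangle hz
  rw [abs_le] at a1 b1
  refine (dist_le_of_abs (r := 2 * width k l) (s := 2 * width k l + 1 / 2) ?_ ?_).trans
    (by linarith) <;> rw [abs_le] <;> constructor <;> linarith

lemma L_zero_mem_base {k l m a : ℕ} (ha : a < k) :
    L (hpath l a) 0 ∈ base (width k l) m m := by
  rw [(paths_hpath k l).L_zero ha, hpath_zero]
  have ha' : (a : ℝ) + 1 ≤ k := by exact_mod_cast ha
  have hp : (1 : ℝ) ≤ 2 ^ l := one_le_pow₀ (by norm_num)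
  have d1 : ((a : ℝ) + 1) * 2 ^ l ≤ k * 2 ^ l := by gcongr
  have d2 : (0 : ℝ) ≤ a * 2 ^ l := by positivity
  apply top_mem_base <;> push_cast <;> unfold width <;> linarith

lemma dist_le_of_window {k l a s i j : ℕ} (ha : a < k) (hi : i < 4 ^ l - 1) (hji : j ≤ i)
    (hij : i < j + 4 ^ s) {y z : Plane} (hy : y ∈ strip (hpath l a) i)
    (hz : z ∈ strip (hpath l a) j) : dist z y ≤ 4 * 2 ^ s + 1 := by
  obtain ⟨h0, h1⟩ := hilbert_window l s (show i < 4 ^ l by omega) hji hij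
  have h0' : |((hilbert l i).1 : ℝ) - (hilbert l j).1| + 1 ≤ 2 * 2 ^ s := by exact_mod_cast h0
  have h1' : |((hilbert l i).2 : ℝ) - (hilbert l j).2| + 1 ≤ 2 * 2 ^ s := by exact_mod_cast h1
  obtain ⟨c0, c1⟩ := (paths_hpath k l).abs_sub_le_of_mem_strips ha hi (hji.trans_lt hi)
    (D := 2 * 2 ^ s - 1)
    (by rw [hpath_succ, hpath_succ]; push_cast; rw [add_sub_add_right_eq_sub]; linarith)
    (by rw [hpath_succ, hpath_succ]; linarith) hy hz
  rw [dist_comm]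
  exact (dist_le_of_abs c0 c1).trans (by linarith)

lemma exists_scale {r : ℝ} (hr : 12 ≤ r) : ∃ s : ℕ, 12 * 2 ^ s ≤ r ∧ r < 24 * 2 ^ s := by
  obtain ⟨s, h1, h2⟩ := exists_nat_pow_near (show 1 ≤ r / 12 by linarith) (one_lt_two (α := ℝ))
  rw [pow_succ] at h2
  exact ⟨s, by linarith, by linarith⟩

/-- The `4 ^ s` cells ending at `i` form a connected set inside the disk, and each contributes a
disk of radius `1 / 500`. The total is proportional to `4 ^ s`, that is, to `r ^ 2`. -/
lemma fat_of_window {k l m a i s : ℕ} (ha : a < k) (hi : i < 4 ^ l - 1) (hs : 4 ^ s ≤ i + 1)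
    {p : Plane} (hp : p ∈ strip (hpath l a) i) {r : ℝ} (h1 : 12 * 2 ^ s ≤ r)
    (h2 : r < 24 * 2 ^ s) :
    ENNReal.ofReal (1 / 10 ^ 9) * volume (Metric.closedBall p r) ≤
      volume (connectedComponentIn (Metric.closedBall p r ∩ hilbertSet k l m) p) := by
  have hC := paths_hpath k l
  have hs1 : (1 : ℝ) ≤ 2 ^ s := one_le_pow₀ (by norm_num)
  have hs4 : 0 < 4 ^ s := by positivity
  set j := i + 1 - 4 ^ s with hj
  have hlt : ∀ n ∈ Finset.Icc j i, n < 4 ^ l - 1 := fun n hn =>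
    (Finset.mem_Icc.1 hn).2.trans_lt hi
  have hq : ∀ n : ℕ, ∃ q, n ∈ Finset.Icc j i → Metric.closedBall q (1 / 500) ⊆
      triL (hpath l a) n ∩ box (hpath l a (n + 1)) := by
    intro n
    by_cases hn : n ∈ Finset.Icc j i
    · obtain ⟨q, hq⟩ := hC.exists_closedBall_subset_triL ha (hlt n hn)
      exact ⟨q, fun _ => hq⟩
    · exact ⟨0, fun h => absurd h hn⟩
  choose q hq using hq
  refine fat_of_closedBalls (A := ⋃ n ∈ Set.Icc j i, strip (hpath l a) n) (by positivity)
    (by linarith) (δ := 1 / 500) (by norm_num) (isPreconnected_strips _ _ _) ?_ ?_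
    (Finset.Icc j i) q ?_ ?_ ?_
  · exact Set.mem_biUnion (x := i) ⟨by omega, le_rfl⟩ hp
  · refine Set.iUnion₂_subset fun n hn z hz => ⟨?_, ?_⟩
    · rw [Metric.mem_closedBall]
      exact (dist_le_of_window (s := s) ha hi hn.2 (by have := hn.1; omega) hp hz).trans (by linarith)
    · exact strip_subset_hilbertSet ha (hn.2.trans_lt hi) hz
  · intro n hn z hz
    exact Set.mem_biUnion (Finset.mem_Icc.1 hn) (Or.inl (hq n hn hz).1)
  · intro n hn n' hn' hne
    rw [Set.disjoint_left]
    intro z hz hz'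
    have := box_disjoint (hq n hn hz).2 (hq n' hn' hz').2
    have hlt1 := hlt n hn
    have hlt2 := hlt n' hn'
    exact hne (by have := (hC.inj a ha a ha (n + 1) (by omega) (n' + 1) (by omega) this).2; omega)
  · have hcard : (Finset.Icc j i).card = 4 ^ s := by rw [Nat.card_Icc]; omega
    have h4 : ((4 : ℝ)) ^ s = (2 ^ s) ^ 2 := by rw [← pow_mul, mul_comm, pow_mul]; norm_num
    rw [hcard]
    push_cast
    rw [h4]
    have : r ^ 2 ≤ (24 * 2 ^ s) ^ 2 := pow_le_pow_left₀ (by linarith) h2.le 2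
    nlinarith

/-- Fewer than `4 ^ s` cells separate `p` from the mouth of the arm, so the component contains the
way back to the base and continues there. The mouth is within `4 * 2 ^ s + 1 ≤ r / 2` of `p`, which
leaves a disk of radius `r / 2` around it, and the base is fat. -/
lemma fat_of_near_base {k l m a i s : ℕ} (hm : 1 ≤ m) (ha : a < k) (hi : i < 4 ^ l - 1)
    (hs : i < 4 ^ s) {p : Plane} (hp : p ∈ strip (hpath l a) i) {r : ℝ} (h1 : 12 * 2 ^ s ≤ r)
    (h2 : r ≤ 5 * width k l) :
    ENNReal.ofReal (1 / 10 ^ 9) * volume (Metric.closedBall p r) ≤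
      volume (connectedComponentIn (Metric.closedBall p r ∩ hilbertSet k l m) p) := by
  have hs1 : (1 : ℝ) ≤ 2 ^ s := one_le_pow₀ (by norm_num)
  have hr : 0 < r := by linarith
  have hw := one_le_width k l
  have hg : L (hpath l a) 0 ∈ base (width k l) m m := L_zero_mem_base ha
  obtain ⟨q, hq⟩ := exists_closedBall_subset_base (by linarith : 0 < width k l) hm
  obtain ⟨q', hq'⟩ := exists_closedBall_subset_inter (convex_base _ _ _) (half_pos hr)
    (by linarith : r / 2 ≤ 5 * width k l) hq (fun z hz => Metric.mem_closedBall.2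
      (dist_le_of_mem_hilbertSet (base_subset_hilbertSet k l m hz)
        (base_subset_hilbertSet k l m hg))) hg
  have hwin : ∀ n ≤ i, ∀ z ∈ strip (hpath l a) n, dist z p ≤ 4 * 2 ^ s + 1 := fun n hn z hz =>
    dist_le_of_window ha hi hn (by omega) hp hz
  refine fat_of_closedBall (q := q') (δ := 1 / 50 * (r / 2))
    (A := (⋃ n ∈ Set.Icc 0 i, strip (hpath l a) n) ∪
      base (width k l) m m ∩ Metric.closedBall (L (hpath l a) 0) (r / 2)) (by positivity) hr.le
      (by positivity) ?_ ?_ ?_ ?_ ?_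
  · refine IsPreconnected.union (L (hpath l a) 0) ?_ ⟨hg, Metric.mem_closedBall_self (by linarith)⟩
      (isPreconnected_strips _ _ _)
      ((convex_base _ _ _).inter (convex_closedBall _ _)).isPreconnected
    exact Set.mem_biUnion (x := 0) ⟨le_rfl, Nat.zero_le _⟩ (posts_mem_strip _ _).1
  · exact Or.inl (Set.mem_biUnion (x := i) ⟨Nat.zero_le _, le_rfl⟩ hp)
  · refine Set.union_subset (Set.iUnion₂_subset fun n hn z hz => ⟨?_, ?_⟩) fun z hz => ⟨?_, ?_⟩
    · rw [Metric.mem_closedBall]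
      exact (hwin n hn.2 z hz).trans (by linarith)
    · exact strip_subset_hilbertSet ha (hn.2.trans_lt hi) hz
    · have := hwin 0 (Nat.zero_le _) _ (posts_mem_strip _ _).1
      have h3 := Metric.mem_closedBall.1 hz.2
      rw [Metric.mem_closedBall]
      exact (dist_triangle _ (L (hpath l a) 0) _).trans (by linarith)
    · exact base_subset_hilbertSet k l m hz.1
  · exact Set.Subset.trans hq' Set.subset_union_right
  · nlinarith [mul_pos hr hr]

theorem isLocallyFat_hilbertSet (k l : ℕ) {m : ℕ} (hm : 1 ≤ m) :
    IsLocallyFat (1 / 10 ^ 9) (hilbertSet k l m) := by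
  intro p hp r hr hnot
  have hw := one_le_width k l
  -- Only disks that do not contain the whole region matter, so radii are at most the bound for its
  -- diameter.
  have hrW : r ≤ 5 * width k l := by
    by_contra hlt
    exact hnot fun z hz => Metric.mem_closedBall.2
      ((dist_le_of_mem_hilbertSet hz hp).trans (not_le.1 hlt).le)
  rcases mem_bigSet.1 hp with h | ⟨a, ha, i, hi, h⟩
  · obtain ⟨q, hq⟩ := exists_closedBall_subset_base (by linarith : 0 < width k l) hm
    exact fat_of_convex (convex_base _ _ _) (base_subset_hilbertSet k l m) hr hrW hq (by norm_num)
      (fun z hz => Metric.mem_closedBall.2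
        (dist_le_of_mem_hilbertSet (base_subset_hilbertSet k l m hz) hp)) h (by positivity)
        (by norm_num)
  · rcases le_total r 12 with h12 | h12
    · exact (paths_hpath k l).fat_of_le ha hi (strip_subset_hilbertSet ha hi) h hr h12
    · obtain ⟨s, h1, h2⟩ := exists_scale h12
      rcases Nat.lt_or_ge i (4 ^ s) with hs | hs
      · exact fat_of_near_base hm ha hi hs h h1 hrW
      · exact fat_of_window ha hi (by omega) h h1 h2

end

/-! ### Choice of parameters and conclusion -/

lemma hpath_zero_range (k l : ℕ) : ∀ a < k, -width k l < ((hpath l a 0).1 : ℝ) - 1 / 32 ∧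
    ((hpath l a 0).1 : ℝ) + 1 / 32 < width k l := by
  intro a ha
  have ha' : (a : ℝ) + 1 ≤ k := by exact_mod_cast ha
  have hp : (1 : ℝ) ≤ 2 ^ l := one_le_pow₀ (by norm_num)
  have d1 : ((a : ℝ) + 1) * 2 ^ l ≤ k * 2 ^ l := by gcongr
  have d2 : (0 : ℝ) ≤ a * 2 ^ l := by positivity
  rw [hpath_zero]
  push_cast
  unfold width
  constructor <;> linarith

/-- The region of the polygon is bounded by a simple polygon. -/
lemma exists_polygon_hilbertSet {k l m n : ℕ} [NeZero n] (hl : 1 ≤ l) (hm : 1 ≤ m)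
    (hn : m + 2 + k * (2 * 4 ^ l) = n) :
    ∃ poly : Polygon Plane n, IsSimple poly ∧ region poly = hilbertSet k l m := by
  have hC := paths_hpath k l
  have h4 : 4 ≤ 4 ^ l := by simpa using Nat.pow_le_pow_right (n := 4) (by norm_num) hl
  have hp : (1 : ℝ) ≤ 2 ^ l := one_le_pow₀ (by norm_num)
  have hW : 0 < width k l := zero_lt_one.trans_le (one_le_width k l)
  have hsort : ∀ a < k, ∀ b < k, a < b →
      ((hpath l a 0).1 : ℝ) + 1 / 32 < (hpath l b 0).1 - 1 / 32 := by
    intro a _ b _ hab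
    have hab' : (a : ℝ) + 1 ≤ b := by exact_mod_cast hab
    have : ((a : ℝ) + 1) * 2 ^ l ≤ b * 2 ^ l := by gcongr
    rw [hpath_zero, hpath_zero]; push_cast; linarith
  have hrange : ∀ a < k, -width k l < ((hpath l a 0).1 : ℝ) - 1 / 32 ∧
      ((hpath l a 0).1 : ℝ) + 1 / 32 < width k l := hpath_zero_range k l
  exact (hC.bounds hW hsort hrange hm).exists_polygon (by rw [length_polyList, ← hn]; congr 2; omega)
    (by omega) (hC.turning (by omega) hW hsort hrange hm)

/-- For `k = 2 ^ j` and `l = j + 4` the arm feet are within `16 * 4 ^ j` of each other, while an arm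
has `256 * 4 ^ j - 1` cells, more than enough for the ratio `3 / 20`. -/
lemma le_of_isDoubling_hilbertSet {j m k' : ℕ}
    (hd : IsDoubling (geodesicDist (hilbertSet (2 ^ j) (j + 4) m)) k') : 2 ^ j ≤ k' := by
  have hC := paths_hpath (2 ^ j) (j + 4)
  have h4 : 256 ≤ 4 ^ (j + 4) := by simpa using Nat.pow_le_pow_right (n := 4) (by norm_num) (Nat.le_add_left 4 j)
  refine hC.le_of_isDoubling (zero_le_one.trans (one_le_width _ _)) (by omega)
    (hpath_zero_range _ _) (ρ := 2 ^ j * 2 ^ (j + 4)) ?_ ?_ hd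
  · intro a ha b hb
    have ha' : (a : ℝ) ≤ 2 ^ j := by exact_mod_cast ha.le
    have hb' : (b : ℝ) ≤ 2 ^ j := by exact_mod_cast hb.le
    have ha1 : (a : ℝ) * 2 ^ (j + 4) ≤ 2 ^ j * 2 ^ (j + 4) := by gcongr
    have hb1 : (b : ℝ) * 2 ^ (j + 4) ≤ 2 ^ j * 2 ^ (j + 4) := by gcongr
    have ha2 : (0 : ℝ) ≤ a * 2 ^ (j + 4) := by positivity
    have hb2 : (0 : ℝ) ≤ b * 2 ^ (j + 4) := by positivity
    rw [hC.L_zero ha, hC.L_zero hb, hpath_zero, hpath_zero]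
    refine (dist_le_of_abs (r := 2 ^ j * 2 ^ (j + 4)) (s := 0) ?_ ?_).trans (add_zero _).le
    · simp only [top_zero]; push_cast; rw [abs_le]; constructor <;> linarith
    · simp
  · rw [Nat.cast_sub (by omega)]
    push_cast
    have h1 : (4 : ℝ) ^ (j + 4) = 256 * (2 ^ j) ^ 2 := by
      rw [pow_add, ← pow_mul, mul_comm j 2, pow_mul]; norm_num; ring
    have h2 : (1 : ℝ) ≤ 2 ^ j := one_le_pow₀ (by norm_num)
    rw [h1, pow_add]
    nlinarith

lemma one_le_of_isDoubling {X : Type*} [Nonempty X] {d : X → X → ℝ≥0∞} (hd : ∀ x, d x x = 0)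
    {k : ℕ} (h : IsDoubling d k) : 1 ≤ k := by
  obtain ⟨x⟩ := ‹Nonempty X›
  obtain ⟨s, hs, hcov⟩ := h x 1 one_pos
  obtain ⟨z, hz, -⟩ := hcov x (by rw [hd]; exact zero_le)
  exact (Finset.card_pos.2 ⟨z, hz⟩).trans_le hs

lemma geodesicDist_self {P : Set Plane} (p : P) : geodesicDist P p p = 0 := by
  refine le_antisymm ((geodesicDist_le_of_segment p p ?_).trans ?_) zero_le
  · rw [segment_same]; exact Set.singleton_subset_iff.2 p.2
  · simp

lemma le_doublingConstant {X : Type*} {d : X → X → ℝ≥0∞} {D n : ℕ}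
    (h : ∀ k, IsDoubling d k → D ≤ k) (hn : n ≤ (20 * D) ^ 3) :
    ENNReal.ofReal (1 / 20 * (n : ℝ) ^ (1 / 3 : ℝ)) ≤ ((doublingConstant d : ℕ∞) : ℝ≥0∞) := by
  have h1 : (n : ℝ) ^ (1 / 3 : ℝ) ≤ 20 * D := by
    have h2 : (n : ℝ) ≤ (20 * D : ℝ) ^ 3 := by exact_mod_cast hn
    calc (n : ℝ) ^ (1 / 3 : ℝ) ≤ ((20 * D : ℝ) ^ 3) ^ (1 / 3 : ℝ) :=
          Real.rpow_le_rpow (by positivity) h2 (by norm_num)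
      _ = 20 * D := by
          rw [← Real.rpow_natCast, ← Real.rpow_mul (by positivity)]; norm_num
  have h3 : (D : ℕ∞) ≤ doublingConstant d := le_iInf₂ fun k hk => by exact_mod_cast h k hk
  calc ENNReal.ofReal (1 / 20 * (n : ℝ) ^ (1 / 3 : ℝ)) ≤ ENNReal.ofReal D :=
        ENNReal.ofReal_le_ofReal (by linarith)
    _ = ((D : ℕ∞) : ℝ≥0∞) := by simp
    _ ≤ _ := by exact_mod_cast h3

theorem exists_polygon_doubling (n : ℕ) [NeZero n] (hn : 3 ≤ n) :
    ∃ poly : Polygon Plane n, IsSimple poly ∧ IsLocallyFat (1 / 10 ^ 9) (region poly) ∧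
      ENNReal.ofReal (1 / 20 * (n : ℝ) ^ (1 / 3 : ℝ)) ≤
        ((doublingConstant (geodesicDist (region poly)) : ℕ∞) : ℝ≥0∞) := by
  have key : ∀ {k l m D : ℕ}, 1 ≤ l → 1 ≤ m → m + 2 + k * (2 * 4 ^ l) = n →
      (∀ k', IsDoubling (geodesicDist (hilbertSet k l m)) k' → D ≤ k') → n ≤ (20 * D) ^ 3 →
      ∃ poly : Polygon Plane n, IsSimple poly ∧ IsLocallyFat (1 / 10 ^ 9) (region poly) ∧
        ENNReal.ofReal (1 / 20 * (n : ℝ) ^ (1 / 3 : ℝ)) ≤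
          ((doublingConstant (geodesicDist (region poly)) : ℕ∞) : ℝ≥0∞) := by
    intro k l m D hl hm hkn hD hnD
    obtain ⟨poly, h1, h2⟩ := exists_polygon_hilbertSet hl hm hkn
    exact ⟨poly, h1, by rw [h2]; exact isLocallyFat_hilbertSet k l hm,
      by rw [h2]; exact le_doublingConstant hD hnD⟩
  -- For small `n` the base alone serves, with the trivial bound `1`; the constant `1 / 20` absorbs
  -- this case, as `515 < 20 ^ 3`.
  rcases Nat.lt_or_ge n 515 with h | h
  · refine key (k := 0) (l := 1) (m := n - 2) (D := 1) le_rfl (by omega) (by omega) ?_ (by omega)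
    intro k' hk'
    have : Nonempty (hilbertSet 0 1 (n - 2)) := by
      obtain ⟨q, hq⟩ := exists_closedBall_subset_base
        (zero_lt_one.trans_le (one_le_width 0 1)) (show 1 ≤ n - 2 by omega)
      exact ⟨q, base_subset_hilbertSet _ _ _ (hq (Metric.mem_closedBall_self
        (by linarith [one_le_width 0 1])))⟩
    exact one_le_of_isDoubling geodesicDist_self hk'
  · obtain ⟨j, h1, h2⟩ := exists_nat_pow_near (show 1 ≤ (n - 3) / 512 by omega)
      (show 1 < 8 by norm_num)
    have h3 : 2 ^ j * (2 * 4 ^ (j + 4)) = 512 * 8 ^ j := by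
      rw [pow_add, show 8 = 2 * 4 by rfl, mul_pow]; ring
    have h4 : 0 < 8 ^ j := by positivity
    rw [pow_succ] at h2
    refine key (k := 2 ^ j) (l := j + 4) (m := n - 2 - 512 * 8 ^ j) (D := 2 ^ j) (by omega)
      (by omega) (by omega) (fun k' hk' => le_of_isDoubling_hilbertSet hk') ?_
    have h5 : (20 * 2 ^ j) ^ 3 = 8000 * 8 ^ j := by
      rw [mul_pow, ← pow_mul, mul_comm j 3, pow_mul]; norm_num
    omega

end FatPolygon

end

/-- There are absolute constants `γ, c > 0` such that for every `n ≥ 3` there is a simple polygon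
with `n` vertices that is locally `γ`-fat and whose geodesic metric has doubling constant at least
`c * n ^ (1 / 3)`. -/
theorem mainTheorem1 :
    ∃ γ : ℝ, 0 < γ ∧ ∃ c : ℝ, 0 < c ∧
      ∀ (n : ℕ) [NeZero n], 3 ≤ n →
        ∃ poly : Polygon FatPolygon.Plane n,
          FatPolygon.IsSimple poly ∧
          FatPolygon.IsLocallyFat γ (FatPolygon.region poly) ∧
          ENNReal.ofReal (c * (n : ℝ) ^ (1 / 3 : ℝ)) ≤
            ((FatPolygon.doublingConstant
              (FatPolygon.geodesicDist (FatPolygon.region poly)) : ℕ∞) : ENNReal) :=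
  ⟨1 / 10 ^ 9, by positivity, 1 / 20, by positivity, fun n _ hn =>
    FatPolygon.exists_polygon_doubling n hn⟩
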